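/- Let $k\ge 1$ be a fixed integer. For a finite simple connected graph $G=(V,E)$ with $n=|V|\ge k$ vertices, a \emph{configuration} of $k$ agents is a $k$-tuple $(v_1,\dots,v_k)$ of pairwise distinct vertices such that the subgraph of $G$ induced by $\{v_1,\dots,v_k\}$ is connected. Two configurations $(v_1,\dots,v_k)$ and $(w_1,\dots,w_k)$ are \emph{adjacent} if for every $i$ either $v_i=w_i$ or $v_iw_i\in E$. In the $k$-agent Hamiltonian walk problem ($k$-HWP), a feasible solution of length $l$ for $G$ is a sequence $\mathcal C_0,\dots,\mathcal C_l$ of configurations such that consecutive configurations are adjacent and every vertex of $G$ occurs in at least one $\mathcal C_t$. Let $h_k(G)$ denote the minimum length of a feasible solution. Theorem. For every constant $k\ge 1$ there is a deterministic polynomial-time $2(1+\ln k)$-approximation algorithm for $k$-HWP on simple connected graphs: an algorithm which, given the adjacency matrix of a connected simple graph $G$ on $n\ge k$ vertices, halts after a number of steps (of a random access machine with addition and subtraction at unit cost) bounded by a polynomial in $n$ that depends only on $k$, and outputs a feasible solution whose length is at most $2(1+\ln k)\,h_k(G)$. -/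

import Mathlib

namespace KHWP

/-! ### The walk problem for `k` agents -/

/-- A configuration of `k` agents on `G`: agent `i` sits on `C i`, distinct agents sit on distinct
vertices, and the occupied vertices induce a connected subgraph. -/
def IsConfiguration {V : Type*} (G : SimpleGraph V) {k : ℕ} (C : Fin k → V) : Prop :=
  Function.Injective C ∧ (G.induce (Set.range C)).Connected

/-- Adjacent placements: every agent stays where it is or moves along an edge. -/
def ConfigAdj {V : Type*} (G : SimpleGraph V) {k : ℕ} (C D : Fin k → V) : Prop :=
  ∀ i, C i = D i ∨ G.Adj (C i) (D i)

/-- `W 0, …, W l` is a feasible solution of length `l`: a sequence of `l + 1` configurations,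
consecutive ones adjacent, such that every vertex is occupied at some time. -/
structure IsSpanningWalk {V : Type*} (G : SimpleGraph V) {k l : ℕ}
    (W : Fin (l + 1) → Fin k → V) : Prop where
  config : ∀ t, IsConfiguration G (W t)
  adj : ∀ t : Fin l, ConfigAdj G (W t.castSucc) (W t.succ)
  cover : ∀ v, ∃ t i, W t i = v

/-- `h_k(G)`, the minimum length of a feasible solution. -/
noncomputable def minWalkLength {V : Type*} (G : SimpleGraph V) (k : ℕ) : ℕ :=
  sInf {l | ∃ W : Fin (l + 1) → Fin k → V, IsSpanningWalk G W}

/-! ### Random access machines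

Programs over registers and arrays of natural numbers. Each instruction and each evaluation of a
test costs one step. The only arithmetic is addition and (truncated) subtraction, so that numbers
have at most linearly many bits in the running time and unit cost is polynomially equivalent to
Turing machine time. A program is a finite term, so it names finitely many registers and arrays. -/

structure State where
  reg : ℕ → ℕ
  arr : ℕ → ℕ → ℕ

def State.setReg (s : State) (x v : ℕ) : State :=
  { s with reg := Function.update s.reg x v }

def State.setArr (s : State) (a j v : ℕ) : State :=
  { s with arr := Function.update s.arr a (Function.update (s.arr a) j v) }

/-- Atomic instructions; `x`, `y`, `z` name registers and `a` names an array. -/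
inductive Instr where
  /-- `x := c` -/
  | const (x c : ℕ)
  /-- `x := y` -/
  | copy (x y : ℕ)
  /-- `x := y + z` -/
  | add (x y z : ℕ)
  /-- `x := y - z`, truncated at zero -/
  | sub (x y z : ℕ)
  /-- `x := a[y]` -/
  | load (x a y : ℕ)
  /-- `a[x] := y` -/
  | store (a x y : ℕ)

def Instr.eval : Instr → State → State
  | .const x c, s => s.setReg x c
  | .copy x y, s => s.setReg x (s.reg y)
  | .add x y z, s => s.setReg x (s.reg y + s.reg z)
  | .sub x y z, s => s.setReg x (s.reg y - s.reg z)
  | .load x a y, s => s.setReg x (s.arr a (s.reg y))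
  | .store a x y, s => s.setArr a (s.reg x) (s.reg y)

/-- Comparisons of two registers. -/
inductive Cond where
  | lt (x y : ℕ)
  | eq (x y : ℕ)

def Cond.Holds : Cond → State → Prop
  | .lt x y, s => s.reg x < s.reg y
  | .eq x y, s => s.reg x = s.reg y

inductive Program where
  | skip
  | instr (i : Instr)
  | seq (P Q : Program)
  | ite (b : Cond) (P Q : Program)
  | while (b : Cond) (P : Program)

/-- `Exec P s T s'`: started in state `s`, the program `P` halts in state `s'` after `T` steps. -/
inductive Exec : Program → State → ℕ → State → Prop where
  | skip (s : State) : Exec .skip s 0 s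
  | instr (i : Instr) (s : State) : Exec (.instr i) s 1 (i.eval s)
  | seq {P Q : Program} {s s₁ s₂ : State} {T₁ T₂ : ℕ} :
      Exec P s T₁ s₁ → Exec Q s₁ T₂ s₂ → Exec (.seq P Q) s (T₁ + T₂) s₂
  | iteTrue {b : Cond} {P Q : Program} {s s₁ : State} {T : ℕ} :
      b.Holds s → Exec P s T s₁ → Exec (.ite b P Q) s (T + 1) s₁
  | iteFalse {b : Cond} {P Q : Program} {s s₁ : State} {T : ℕ} :
      ¬ b.Holds s → Exec Q s T s₁ → Exec (.ite b P Q) s (T + 1) s₁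
  | whileTrue {b : Cond} {P : Program} {s s₁ s₂ : State} {T₁ T₂ : ℕ} :
      b.Holds s → Exec P s T₁ s₁ → Exec (.while b P) s₁ T₂ s₂ →
        Exec (.while b P) s (T₁ + T₂ + 1) s₂
  | whileFalse {b : Cond} {P : Program} {s : State} :
      ¬ b.Holds s → Exec (.while b P) s 1 s

/-- A run of a program is determined by its initial state. -/
theorem Exec.deterministic {P : Program} {s s₁ s₂ : State} {T₁ T₂ : ℕ}
    (h₁ : Exec P s T₁ s₁) (h₂ : Exec P s T₂ s₂) : T₁ = T₂ ∧ s₁ = s₂ := by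
  induction h₁ generalizing T₂ s₂ with
  | skip s => cases h₂; exact ⟨rfl, rfl⟩
  | instr i s => cases h₂; exact ⟨rfl, rfl⟩
  | seq _ _ ih₁ ih₂ =>
    cases h₂ with
    | seq g₁ g₂ =>
      obtain ⟨rfl, rfl⟩ := ih₁ g₁
      obtain ⟨rfl, rfl⟩ := ih₂ g₂
      exact ⟨rfl, rfl⟩
  | iteTrue hb _ ih =>
    cases h₂ with
    | iteTrue _ g => obtain ⟨rfl, rfl⟩ := ih g; exact ⟨rfl, rfl⟩
    | iteFalse hn _ => exact absurd hb hn
  | iteFalse hb _ ih =>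
    cases h₂ with
    | iteTrue hn _ => exact absurd hn hb
    | iteFalse _ g => obtain ⟨rfl, rfl⟩ := ih g; exact ⟨rfl, rfl⟩
  | whileTrue hb _ _ ih₁ ih₂ =>
    cases h₂ with
    | whileTrue _ g₁ g₂ =>
      obtain ⟨rfl, rfl⟩ := ih₁ g₁
      obtain ⟨rfl, rfl⟩ := ih₂ g₂
      exact ⟨rfl, rfl⟩
    | whileFalse hn => exact absurd hb hn
  | whileFalse hb =>
    cases h₂ with
    | whileTrue hn _ _ => exact absurd hn hb
    | whileFalse _ => exact ⟨rfl, rfl⟩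

open Classical in
/-- The initial state on input `G`: register `0` holds the number `n` of vertices, array `0` holds
the adjacency matrix row by row, and everything else is zero. -/
noncomputable def inputState {n : ℕ} (G : SimpleGraph (Fin n)) : State where
  reg x := if x = 0 then n else 0
  arr a m := if a = 0 ∧ ∃ i j : Fin n, m = (i : ℕ) * n + j ∧ G.Adj i j then 1 else 0

/-- The output read off a final state: register `0` holds the length `l`, and cell `t * k + i` of
array `1` holds the vertex of agent `i` at time `t`. -/
def OutputsWalk {n k l : ℕ} (s : State) (W : Fin (l + 1) → Fin k → Fin n) : Prop :=
  s.reg 0 = l ∧ ∀ (t : Fin (l + 1)) (i : Fin k), s.arr 1 ((t : ℕ) * k + i) = (W t i : ℕ)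

/-- `P` is a polynomial-time `ρ`-approximation algorithm for the walk problem with `k` agents: on
every connected graph with `n ≥ k` vertices it halts within polynomially many steps (in `n`) and
outputs a feasible solution whose length is at most `ρ` times the minimum. -/
def IsPolyTimeApprox (k : ℕ) (ρ : ℝ) (P : Program) : Prop :=
  ∃ p : Polynomial ℕ, ∀ (n : ℕ) (G : SimpleGraph (Fin n)), G.Connected → k ≤ n →
    ∃ (T : ℕ) (s : State) (l : ℕ) (W : Fin (l + 1) → Fin k → Fin n),
      Exec P (inputState G) T s ∧ T ≤ p.eval n ∧ OutputsWalk s W ∧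
        IsSpanningWalk G W ∧ (l : ℝ) ≤ ρ * (minWalkLength G k : ℝ)

end KHWP

namespace KHWP

/-! ### Runs with a time bound -/

/-! Agents may be renamed along a walk, so only unlabelled configurations matter: two of them are
adjacent when some bijection moves every agent by at most one edge, and labels are restored at the
end (`relabel_spec`). In a connected set of k+1 vertices the empty place can be moved anywhere in a
single step (`Grow.slide`). Hence a configuration can take in any neighbouring vertex in one step,
configurations with a common vertex are within k steps (`Reach.of_mem`), a closed walk can be
spliced into another walk for its length plus 2(k+1), and a missing vertex can be visited for 2
steps (`join_spec`).

Let an optimal walk have L configurations; then n ≤ kL. Visiting the vertices one at a time takes at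
most 2(n-k) steps, which settles k = 1 and shows L ≤ 2n+1.

For k ≥ 3, cover greedily by walks of l+1 configurations, where l is a constant, until no such walk
gains l+1 new vertices. The optimal walk is cut into about L/(l+1) blocks, so the best gain is at
least the average one, and the potential argument of set cover (`pot_step`, `greedy_bound`) bounds
the total length of the chosen walks plus the number r ≤ L of leftover vertices by about L(1+ln k).
Every configuration shares a vertex with the optimal walk, so the time line of that walk yields a
tree through all ends of the chosen walks that costs L plus O(k) per end (`exchange`, `prim_spec`).
Pairing open ends along this tree turns the walks into loops (`closeUp_spec`). The leftovers cost 2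
each instead of the 1 already counted. In all this is about L(1+ln k) + L + L = L(3+ln k); the O(k)
per walk vanishes as l grows. Since ln k > 1, this lies below 2(1+ln k)L with room for the additive
errors on large graphs (`exists_approx_of_three_le`).

For k = 2 this fails, as ln 2 < 1. Instead the long walks are traversed there and back, which costs
2 per unit of the potential, and the slack needed for the additive errors comes from covering
leftovers at less than 2 per vertex: by doubled walks of six configurations with twelve new
vertices, and by detours of 3 steps for 2 new vertices or of 5 steps for 3. When none of these is
available, six consecutive configurations of the optimal walk with twelve distinct vertices form a
ladder with at most four uncovered vertices (`Rail.sum_le`), so few vertices remain when n is near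
2L; when n is smaller, the potential is smaller by a matching amount (`tourTwo_le`).

Polynomial time is established on the machine by a compositional class `PC` of functions on data
stored in a heap of immutable cells, closed under composition, branching and folds with polynomially
bounded values. All enumerations are polynomial because k and the lengths of the enumerated walks
are constants. The finitely many graphs too small for the estimates are answered from a table. -/

/-- Started in `s`, the program `P` halts within `B` steps in a state satisfying `Q`. -/
def Run (P : Program) (s : State) (B : ℕ) (Q : State → Prop) : Prop :=
  ∃ T s', Exec P s T s' ∧ T ≤ B ∧ Q s'

theorem Run.mono {P : Program} {s : State} {B B' : ℕ} {Q Q' : State → Prop}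
    (h : Run P s B Q) (hB : B ≤ B') (hQ : ∀ s', Q s' → Q' s') : Run P s B' Q' := by
  obtain ⟨T, s', h1, h2, h3⟩ := h
  exact ⟨T, s', h1, h2.trans hB, hQ _ h3⟩

theorem Run.seq {P P' : Program} {s : State} {B B' : ℕ} {Q Q' : State → Prop}
    (h : Run P s B Q) (h' : ∀ s', Q s' → Run P' s' B' Q') : Run (.seq P P') s (B + B') Q' := by
  obtain ⟨T, s', h1, h2, h3⟩ := h
  obtain ⟨T', s'', h1', h2', h3'⟩ := h' s' h3
  exact ⟨T + T', s'', .seq h1 h1', by omega, h3'⟩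

theorem Run.instr {i : Instr} {s : State} {Q : State → Prop} (h : Q (i.eval s)) :
    Run (.instr i) s 1 Q := ⟨1, _, .instr i s, le_rfl, h⟩

theorem Run.skip {s : State} {Q : State → Prop} (h : Q s) : Run .skip s 0 Q :=
  ⟨0, _, .skip s, le_rfl, h⟩

/-- Running one instruction before a program. -/
theorem Run.instr_seq {i : Instr} {P : Program} {s : State} {B : ℕ} {Q : State → Prop}
    (h : Run P (i.eval s) B Q) : Run (.seq (.instr i) P) s (B + 1) Q := by
  obtain ⟨T, s', h1, h2, h3⟩ := h
  exact ⟨1 + T, s', .seq (.instr i s) h1, by omega, h3⟩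

theorem Run.ite {b : Cond} {P P' : Program} {s : State} {B : ℕ} {Q : State → Prop}
    (h : b.Holds s → Run P s B Q) (h' : ¬ b.Holds s → Run P' s B Q) :
    Run (.ite b P P') s (B + 1) Q := by
  by_cases hb : b.Holds s
  · obtain ⟨T, s', h1, h2, h3⟩ := h hb
    exact ⟨T + 1, s', .iteTrue hb h1, by omega, h3⟩
  · obtain ⟨T, s', h1, h2, h3⟩ := h' hb
    exact ⟨T + 1, s', .iteFalse hb h1, by omega, h3⟩

theorem Run.while_false {b : Cond} {P : Program} {s : State} {Q : State → Prop}
    (hb : ¬ b.Holds s) (h : Q s) : Run (.while b P) s 1 Q :=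
  ⟨1, s, .whileFalse hb, le_rfl, h⟩

theorem Run.while_true {b : Cond} {P : Program} {s : State} {B B' : ℕ} {Q Q' : State → Prop}
    (hb : b.Holds s) (h : Run P s B Q) (h' : ∀ s', Q s' → Run (.while b P) s' B' Q') :
    Run (.while b P) s (B + B' + 1) Q' := by
  obtain ⟨T, s', h1, h2, h3⟩ := h
  obtain ⟨T', s'', h1', h2', h3'⟩ := h' s' h3
  exact ⟨T + T' + 1, s'', .whileTrue hb h1 h1', by omega, h3'⟩

@[simp] theorem State.setReg_reg_self (s : State) (x v : ℕ) : (s.setReg x v).reg x = v := by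
  simp [State.setReg]

theorem State.setReg_reg_ne (s : State) {x y : ℕ} (v : ℕ) (h : y ≠ x) :
    (s.setReg x v).reg y = s.reg y := by
  simp [State.setReg, Function.update_of_ne h]

@[simp] theorem State.setReg_arr (s : State) (x v : ℕ) : (s.setReg x v).arr = s.arr := rfl

@[simp] theorem State.setArr_reg (s : State) (a j v : ℕ) : (s.setArr a j v).reg = s.reg := rfl

theorem State.setArr_arr (s : State) (a j v a' j' : ℕ) :
    (s.setArr a j v).arr a' j' = if a' = a ∧ j' = j then v else s.arr a' j' := by
  simp only [State.setArr, Function.update_apply]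
  split_ifs <;> simp_all

/-! ### Data in a heap of pairs

Register `1` is the heap pointer; arrays `2` and `3` hold the first and second components of the
allocated cells. Cells are never changed once they are allocated. -/

/-- `s'` arises from `s` by allocating cells and changing registers from `b` on. -/
structure Frame (b : ℕ) (s s' : State) : Prop where
  hp : s.reg 1 ≤ s'.reg 1
  hd : ∀ p < s.reg 1, s'.arr 2 p = s.arr 2 p
  tl : ∀ p < s.reg 1, s'.arr 3 p = s.arr 3 p
  low : ∀ r < b, r ≠ 1 → s'.reg r = s.reg r
  arr0 : s'.arr 0 = s.arr 0
  arr1 : s'.arr 1 = s.arr 1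

theorem Frame.refl (b : ℕ) (s : State) : Frame b s s :=
  ⟨le_rfl, fun _ _ => rfl, fun _ _ => rfl, fun _ _ _ => rfl, rfl, rfl⟩

theorem Frame.trans {b : ℕ} {s s' s'' : State} (h : Frame b s s') (h' : Frame b s' s'') :
    Frame b s s'' where
  hp := h.hp.trans h'.hp
  hd p hp := (h'.hd p (hp.trans_le h.hp)).trans (h.hd p hp)
  tl p hp := (h'.tl p (hp.trans_le h.hp)).trans (h.tl p hp)
  low r hr h1 := (h'.low r hr h1).trans (h.low r hr h1)
  arr0 := h'.arr0.trans h.arr0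
  arr1 := h'.arr1.trans h.arr1

theorem Frame.weaken {b c : ℕ} {s s' : State} (h : Frame c s s') (hbc : b ≤ c) :
    Frame b s s' :=
  { h with low := fun r hr h1 => h.low r (hr.trans_le hbc) h1 }

theorem Frame.setReg {b r : ℕ} (s : State) (v : ℕ) (hb : 2 ≤ b) (h : b ≤ r) :
    Frame b s (s.setReg r v) where
  hp := by rw [State.setReg_reg_ne _ _ (by omega)]
  hd _ _ := rfl
  tl _ _ := rfl
  low x hx _ := State.setReg_reg_ne _ _ (by omega)
  arr0 := rfl
  arr1 := rfl

/-- Types whose elements are represented by words over the heap, with a size measure. -/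
class Data (α : Type) where
  size : α → ℕ
  rep : State → ℕ → α → Prop
  mono : ∀ {b s s' w x}, Frame b s s' → rep s w x → rep s' w x
  build : ∀ x : α, ∃ (P : ℕ → Program) (T : ℕ), ∀ b ≥ 2, ∀ s : State, 1 ≤ s.reg 1 →
    Run (P b) s T (fun s' => Frame b s s' ∧ rep s' (s'.reg b) x)

open Data (size rep)

/-- `d := (x, y)`, with `t` as a scratch register. -/
def alloc (d x y t : ℕ) : Program :=
  .seq (.instr (.store 2 1 x)) (.seq (.instr (.store 3 1 y)) (.seq (.instr (.copy d 1))
    (.seq (.instr (.const t 1)) (.instr (.add 1 1 t)))))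

theorem alloc_run {b d x y t : ℕ} (hb : 2 ≤ b) (hd : b ≤ d) (ht : b ≤ t) (hdt : d ≠ t)
    (s : State) :
    Run (alloc d x y t) s 5 (fun s' => Frame b s s' ∧ s'.reg d = s.reg 1 ∧
      s'.reg 1 = s.reg 1 + 1 ∧ s'.arr 2 (s.reg 1) = s.reg x ∧ s'.arr 3 (s.reg 1) = s.reg y ∧
      ∀ r, r ≠ d → r ≠ t → r ≠ 1 → s'.reg r = s.reg r) := by
  refine Run.instr_seq (Run.instr_seq (Run.instr_seq (Run.instr_seq (Run.instr ?_))))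
  have h1t : 1 ≠ t := by omega
  have h1d : 1 ≠ d := by omega
  have hd1 : d ≠ 1 := by omega
  refine ⟨⟨?_, ?_, ?_, ?_, ?_, ?_⟩, ?_, ?_, ?_, ?_, ?_⟩
  · simp [Instr.eval, State.setReg_reg_ne, *]
  · intro p hp
    simp [Instr.eval, State.setArr_arr]; omega
  · intro p hp
    simp [Instr.eval, State.setArr_arr]; omega
  · intro r hr hr1
    have h1 : r ≠ t := by omega
    have h2 : r ≠ d := by omega
    simp [Instr.eval, State.setReg_reg_ne, *]
  · funext p; simp [Instr.eval, State.setArr_arr]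
  · funext p; simp [Instr.eval, State.setArr_arr]
  · simp [Instr.eval, State.setReg_reg_ne, *]
  · simp [Instr.eval, State.setReg_reg_ne, *]
  · simp [Instr.eval, State.setArr_arr]
  · simp [Instr.eval, State.setArr_arr]
  · intro r h1 h2 h3
    simp [Instr.eval, State.setReg_reg_ne, *]

/-- The size of a number is its value, not its bit length. Vertices, counters and lengths are
polynomial in n anyway, and loops over `List.range m` become polynomial. -/
instance : Data ℕ where
  size n := n
  rep _ w n := w = n
  mono _ h := h
  build n := ⟨fun b => .instr (.const b n), 1, fun b hb s _ => Run.instr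
    ⟨Frame.setReg s n hb le_rfl, by simp [Instr.eval]⟩⟩

instance : Data Bool where
  size _ := 1
  rep _ w x := w = x.toNat
  mono _ h := h
  build x := ⟨fun b => .instr (.const b x.toNat), 1, fun b hb s _ => Run.instr
    ⟨Frame.setReg s _ hb le_rfl, by simp [Instr.eval]⟩⟩

/-- `w` is an allocated cell whose components satisfy `p` and `q`. -/
def IsCell (s : State) (w : ℕ) (p q : ℕ → Prop) : Prop :=
  0 < w ∧ w < s.reg 1 ∧ p (s.arr 2 w) ∧ q (s.arr 3 w)

theorem IsCell.mono {b : ℕ} {s s' : State} {w : ℕ} {p q p' q' : ℕ → Prop} (hf : Frame b s s')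
    (h : IsCell s w p q) (hp : ∀ v, p v → p' v) (hq : ∀ v, q v → q' v) :
    IsCell s' w p' q' := by
  obtain ⟨h0, h1, h2, h3⟩ := h
  refine ⟨h0, h1.trans_le hf.hp, ?_, ?_⟩
  · rw [hf.hd w h1]; exact hp _ h2
  · rw [hf.tl w h1]; exact hq _ h3

/-- Building two components and then a cell that holds them. -/
theorem build_cell {p q : State → ℕ → Prop}
    (hq : ∀ {b s s' w}, Frame b s s' → q s w → q s' w)
    (hp : ∀ {b s s' w}, Frame b s s' → p s w → p s' w)
    (hP : ∃ (P : ℕ → Program) (T : ℕ), ∀ b ≥ 2, ∀ s : State, 1 ≤ s.reg 1 →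
      Run (P b) s T (fun s' => Frame b s s' ∧ p s' (s'.reg b)))
    (hQ : ∃ (P : ℕ → Program) (T : ℕ), ∀ b ≥ 2, ∀ s : State, 1 ≤ s.reg 1 →
      Run (P b) s T (fun s' => Frame b s s' ∧ q s' (s'.reg b))) :
    ∃ (P : ℕ → Program) (T : ℕ), ∀ b ≥ 2, ∀ s : State, 1 ≤ s.reg 1 →
      Run (P b) s T (fun s' => Frame b s s' ∧ IsCell s' (s'.reg b) (p s') (q s')) := by
  obtain ⟨P, T, hP⟩ := hP
  obtain ⟨Q, U, hQ⟩ := hQ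
  refine ⟨fun b => .seq (P b) (.seq (Q (b + 1)) (alloc b b (b + 1) (b + 1))), T + (U + 5),
    fun b hb s hs => (hP b hb s hs).seq ?_⟩
  rintro s₁ ⟨f₁, r₁⟩
  refine (hQ (b + 1) (by omega) s₁ (hs.trans f₁.hp)).seq ?_
  rintro s₂ ⟨f₂, r₂⟩
  refine (alloc_run (b := b) hb le_rfl (by omega) (by omega) s₂).mono le_rfl ?_
  rintro s₃ ⟨f₃, h₁, h₂, h₃, h₄, -⟩
  have f₂' := f₂.weaken (show b ≤ b + 1 by omega)
  refine ⟨(f₁.trans f₂').trans f₃, ?_, ?_, ?_, ?_⟩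
  · rw [h₁]; have := f₂.hp; have := f₁.hp; omega
  · rw [h₁, h₂]; omega
  · rw [h₁, h₃, f₂.low b (by omega) (by omega)]
    exact hp f₃ (hp f₂ r₁)
  · rw [h₁, h₄]; exact hq f₃ r₂

instance {α β : Type} [Data α] [Data β] : Data (α × β) where
  size x := size x.1 + size x.2 + 1
  rep s w x := IsCell s w (fun v => rep s v x.1) (fun v => rep s v x.2)
  mono hf h := h.mono hf (fun _ => Data.mono hf) (fun _ => Data.mono hf)
  build x := build_cell (p := fun s w => rep s w x.1) (q := fun s w => rep s w x.2)
    Data.mono Data.mono (Data.build x.1) (Data.build x.2)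

/-- The representation of lists as chains of cells ended by `0`. -/
def listRep {α : Type} [Data α] (s : State) : ℕ → List α → Prop
  | w, [] => w = 0
  | w, x :: l => IsCell s w (fun v => rep s v x) (fun v => listRep s v l)

def listSize {α : Type} [Data α] : List α → ℕ
  | [] => 1
  | x :: l => size x + listSize l + 1

theorem listRep_mono {α : Type} [Data α] {b : ℕ} {s s' : State} (hf : Frame b s s') :
    ∀ (l : List α) {w : ℕ}, listRep s w l → listRep s' w l
  | [], _, h => h
  | _ :: l, _, h => h.mono hf (fun _ => Data.mono hf) (fun _ => listRep_mono hf l)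

instance {α : Type} [Data α] : Data (List α) where
  size := listSize
  rep := listRep
  mono hf h := listRep_mono hf _ h
  build l := by
    induction l with
    | nil => exact ⟨fun b => .instr (.const b 0), 1, fun b hb s _ => Run.instr
        ⟨Frame.setReg s _ hb le_rfl, by simp [Instr.eval, listRep]⟩⟩
    | cons x l ih =>
      exact build_cell (p := fun s w => rep s w x) (q := fun s w => listRep s w l)
        (fun hf h => listRep_mono hf _ h) Data.mono (Data.build x) ih

theorem size_nat (n : ℕ) : size n = n := rfl
theorem size_bool (x : Bool) : size x = 1 := rfl
theorem size_pair {α β : Type} [Data α] [Data β] (x : α × β) :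
    size x = size x.1 + size x.2 + 1 := rfl
theorem size_nil {α : Type} [Data α] : size ([] : List α) = 1 := rfl
theorem size_cons {α : Type} [Data α] (x : α) (l : List α) :
    size (x :: l) = size x + size l + 1 := rfl

theorem one_le_size_list {α : Type} [Data α] (l : List α) : 1 ≤ size l := by
  cases l with
  | nil => simp [size_nil]
  | cons x l => simp [size_cons]

theorem length_le_size {α : Type} [Data α] (l : List α) : l.length + 1 ≤ size l := by
  induction l with
  | nil => simp [size_nil]
  | cons x l ih => simp [size_cons]; omega

theorem size_le_of_mem {α : Type} [Data α] {x : α} {l : List α} (h : x ∈ l) :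
    size x + 1 ≤ size l := by
  induction l with
  | nil => simp at h
  | cons y l ih =>
    rw [size_cons]
    rcases List.mem_cons.1 h with rfl | h
    · omega
    · have := ih h; omega

theorem size_append {α : Type} [Data α] (l l' : List α) :
    size (l ++ l') + 1 = size l + size l' := by
  induction l with
  | nil => simp [size_nil]; omega
  | cons x l ih => simp only [List.cons_append, size_cons]; omega

theorem size_reverse {α : Type} [Data α] (l : List α) : size l.reverse = size l := by
  induction l with
  | nil => rfl
  | cons x l ih =>
    have := size_append l.reverse [x]
    simp only [List.reverse_cons, size_cons, size_nil] at this ⊢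
    omega

theorem size_list_le {α : Type} [Data α] (l : List α) (B : ℕ) (h : ∀ x ∈ l, size x ≤ B) :
    size l ≤ l.length * (B + 1) + 1 := by
  induction l with
  | nil => simp [size_nil]
  | cons x l ih =>
    have := ih fun y hy => h y (List.mem_cons_of_mem _ hy)
    have := h x (by simp)
    simp only [size_cons, List.length_cons, add_mul]; omega

/-! ### Polynomial-time functions on data -/

theorem eval_mono (p : Polynomial ℕ) {m m' : ℕ} (h : m ≤ m') : p.eval m ≤ p.eval m' := by
  rw [Polynomial.eval_eq_sum_range, Polynomial.eval_eq_sum_range]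
  exact Finset.sum_le_sum fun i _ => Nat.mul_le_mul_left _ (Nat.pow_le_pow_left h i)

/-- `f` is computed in polynomial time, for every register `b ≥ 2` by a program that takes its
argument from register `b`, leaves the value there and keeps the lower registers. -/
@[fun_prop]
def PC {α β : Type} [Data α] [Data β] (f : α → β) : Prop :=
  ∃ (P : ℕ → Program) (p : Polynomial ℕ), (∀ x, size (f x) ≤ p.eval (size x)) ∧
    ∀ b ≥ 2, ∀ (s : State) (x : α), 1 ≤ s.reg 1 → rep s (s.reg b) x →
      Run (P b) s (p.eval (size x)) (fun s' => Frame b s s' ∧ rep s' (s'.reg b) (f x))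

section
variable {α β γ δ : Type} [Data α] [Data β] [Data γ] [Data δ]

/-- Separate bounds for time and size suffice. -/
theorem PC.intro {f : α → β} (P : ℕ → Program) (p q : Polynomial ℕ)
    (hq : ∀ x, size (f x) ≤ q.eval (size x))
    (hp : ∀ b ≥ 2, ∀ (s : State) (x : α), 1 ≤ s.reg 1 → rep s (s.reg b) x →
      Run (P b) s (p.eval (size x)) (fun s' => Frame b s s' ∧ rep s' (s'.reg b) (f x))) :
    PC f :=
  ⟨P, p + q, fun x => by have := hq x; simp; omega,
    fun b hb s x h h' => (hp b hb s x h h').mono (by simp) fun _ h => h⟩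

@[fun_prop]
theorem PC.id : PC (fun x : α => x) :=
  .intro (fun _ => .skip) 0 Polynomial.X (fun x => by simp) fun b _ s x _ h =>
    (Run.skip ⟨Frame.refl b s, h⟩).mono (by simp) fun _ h => h

@[fun_prop]
theorem PC.const (y : β) : PC (fun _ : α => y) := by
  obtain ⟨P, T, h⟩ := Data.build y
  exact .intro P (Polynomial.C T) (Polynomial.C (size y)) (fun x => by simp) fun b hb s x h1 _ =>
    (h b hb s h1).mono (by simp) fun _ h => h

@[fun_prop]
theorem PC.comp {g : β → γ} {f : α → β} (hg : PC g) (hf : PC f) : PC (fun x => g (f x)) := by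
  obtain ⟨P, p, hp, hP⟩ := hf
  obtain ⟨Q, q, hq, hQ⟩ := hg
  refine .intro (fun b => .seq (P b) (Q b)) (p + q.comp p) (q.comp p) (fun x => ?_) ?_
  · rw [Polynomial.eval_comp]; exact (hq _).trans (eval_mono q (hp x))
  · intro b hb s x h1 hx
    rw [Polynomial.eval_add, Polynomial.eval_comp]
    refine (hP b hb s x h1 hx).seq ?_
    rintro s₁ ⟨f₁, r₁⟩
    refine (hQ b hb s₁ _ (h1.trans f₁.hp) r₁).mono (eval_mono q (hp x)) ?_
    rintro s₂ ⟨f₂, r₂⟩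
    exact ⟨f₁.trans f₂, r₂⟩

/-- A copied argument, for the evaluation of a second function in higher registers. -/
theorem Run.copy_eval {f : α → β} {P : ℕ → Program} {B b r d : ℕ} {s : State} {x : α}
    (hP : ∀ b ≥ 2, ∀ s : State, 1 ≤ s.reg 1 → rep s (s.reg b) x →
      Run (P b) s B (fun s' => Frame b s s' ∧ rep s' (s'.reg b) (f x)))
    (hb : 2 ≤ b) (hd : b ≤ d) (h1 : 1 ≤ s.reg 1) (hx : rep s (s.reg r) x) :
    Run (.seq (.instr (.copy d r)) (P d)) s (B + 1)
      (fun s' => Frame d s s' ∧ rep s' (s'.reg d) (f x)) := by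
  have f₀ := Frame.setReg s (s.reg r) (hb.trans hd) (le_refl d)
  refine Run.instr_seq ((hP d (hb.trans hd) (s.setReg d (s.reg r)) (h1.trans f₀.hp) ?_).mono
    le_rfl ?_)
  · simpa using Data.mono f₀ hx
  · rintro s' ⟨f₁, r₁⟩
    exact ⟨f₀.trans f₁, r₁⟩

@[fun_prop]
theorem PC.pair {f : α → β} {g : α → γ} (hf : PC f) (hg : PC g) :
    PC (fun x => (f x, g x)) := by
  obtain ⟨P, p, hp, hP⟩ := hf
  obtain ⟨Q, q, hq, hQ⟩ := hg
  -- Values are stacked upwards: `b` keeps the argument and `b + 1` the first component while the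
  -- second is computed at `b + 2`; a program leaves the registers below its own untouched, apart
  -- from the heap pointer.
  refine .intro (fun b => .seq (.seq (.instr (.copy (b + 1) b)) (P (b + 1)))
    (.seq (.seq (.instr (.copy (b + 2) b)) (Q (b + 2))) (alloc b (b + 1) (b + 2) (b + 1))))
    ((p + 1) + ((q + 1) + 5)) (p + q + 1) (fun x => ?_) ?_
  · have := hp x; have := hq x
    simp [size_pair]; omega
  · intro b hb s x h1 hx
    simp only [Polynomial.eval_add, Polynomial.eval_one, Polynomial.eval_ofNat]
    refine (Run.copy_eval (fun b hb s => hP b hb s x) hb (d := b + 1) (by omega) h1 hx).seq ?_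
    rintro s₁ ⟨f₁, r₁⟩
    refine (Run.copy_eval (fun b hb s => hQ b hb s x) hb (d := b + 2) (r := b) (by omega)
      (h1.trans f₁.hp) ?_).seq ?_
    · rw [f₁.low b (by omega) (by omega)]; exact Data.mono f₁ hx
    rintro s₂ ⟨f₂, r₂⟩
    refine (alloc_run (b := b) hb le_rfl (by omega) (by omega) s₂).mono le_rfl ?_
    rintro s₃ ⟨f₃, h₁, h₂, h₃, h₄, -⟩
    refine ⟨((f₁.weaken (by omega)).trans (f₂.weaken (by omega))).trans f₃, ?_, ?_, ?_, ?_⟩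
    · rw [h₁]; have := f₂.hp; have := f₁.hp; omega
    · rw [h₁, h₂]; omega
    · rw [h₁, h₃, f₂.low (b + 1) (by omega) (by omega)]
      exact Data.mono f₃ (Data.mono f₂ r₁)
    · rw [h₁, h₄]; exact Data.mono f₃ r₂
end
end KHWP


/-! ### Pairs, arithmetic, branching and folds in polynomial time -/

namespace KHWP
open Data (size rep)

/-- Case distinction on a list. -/
def listCase {β γ : Type} (l : List β) (y : γ) (f : β → List β → γ) : γ :=
  match l with
  | [] => y
  | x :: l => f x l

@[simp] theorem listCase_nil {β γ : Type} (y : γ) (f : β → List β → γ) :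
    listCase [] y f = y := rfl

@[simp] theorem listCase_cons {β γ : Type} (x : β) (l : List β) (y : γ) (f : β → List β → γ) :
    listCase (x :: l) y f = f x l := rfl

section
variable {α β γ δ : Type} [Data α] [Data β] [Data γ] [Data δ]

@[fun_prop]
theorem PC.fst {f : α → β × γ} (hf : PC f) : PC (fun x => (f x).1) := by
  refine PC.comp (g := fun y : β × γ => y.1) ?_ hf
  refine .intro (fun b => .instr (.load b 2 b)) 1 Polynomial.X
    (fun x => by simp [size_pair]; omega) fun b hb s x h1 hx => ?_
  simp only [Polynomial.eval_one]
  obtain ⟨_, _, h2, _⟩ := hx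
  have hfr := Frame.setReg s (s.arr 2 (s.reg b)) hb (le_refl b)
  exact Run.instr ⟨hfr, by simpa [Instr.eval] using Data.mono hfr h2⟩

@[fun_prop]
theorem PC.snd {f : α → β × γ} (hf : PC f) : PC (fun x => (f x).2) := by
  refine PC.comp (g := fun y : β × γ => y.2) ?_ hf
  refine .intro (fun b => .instr (.load b 3 b)) 1 Polynomial.X
    (fun x => by simp [size_pair]; omega) fun b hb s x h1 hx => ?_
  simp only [Polynomial.eval_one]
  obtain ⟨_, _, _, h3⟩ := hx
  have hfr := Frame.setReg s (s.arr 3 (s.reg b)) hb (le_refl b)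
  exact Run.instr ⟨hfr, by simpa [Instr.eval] using Data.mono hfr h3⟩

-- A nonempty list has the same representation and the same size as the pair of its head and tail,
-- so once the pair is built nothing is left to do.
@[fun_prop]
theorem PC.cons {f : α → β} {g : α → List β} (hf : PC f) (hg : PC g) :
    PC (fun x => f x :: g x) := by
  refine PC.comp (g := fun y : β × List β => y.1 :: y.2) (f := fun x => (f x, g x)) ?_
    (hf.pair hg)
  exact .intro (fun _ => .skip) 0 Polynomial.X (fun x => by simp [size_pair, size_cons])
    fun b _ s x _ h => (Run.skip ⟨Frame.refl b s, h⟩).mono (by simp) fun _ h => h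

/-- A binary arithmetic instruction, applied to the components of a pair. -/
theorem PC.arith (op : ℕ → ℕ → ℕ) (i : ℕ → ℕ → ℕ → Instr)
    (hi : ∀ x y z s, (i x y z).eval s = s.setReg x (op (s.reg y) (s.reg z)))
    (hop : ∀ m m', op m m' ≤ m + m') {f g : α → ℕ} (hf : PC f) (hg : PC g) :
    PC (fun x => op (f x) (g x)) := by
  refine PC.comp (g := fun y : ℕ × ℕ => op y.1 y.2) (f := fun x => (f x, g x)) ?_ (hf.pair hg)
  refine .intro (fun b => .seq (.instr (.load (b + 1) 2 b)) (.seq (.instr (.load (b + 2) 3 b))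
    (.instr (i b (b + 1) (b + 2))))) 3 Polynomial.X
    (fun x => by have := hop x.1 x.2; simp [size_pair, size_nat]; omega) fun b hb s x h1 hx => ?_
  obtain ⟨_, _, h2, h3⟩ := hx
  refine (Run.instr_seq (Run.instr_seq (Run.instr (Q := fun s' => Frame b s s' ∧
    rep s' (s'.reg b) (op x.1 x.2)) ?_))).mono (by simp) fun _ h => h
  have e1 : s.arr 2 (s.reg b) = x.1 := h2
  have e2 : s.arr 3 (s.reg b) = x.2 := h3
  rw [hi]
  refine ⟨((Frame.setReg s _ hb (by omega)).trans (Frame.setReg _ _ hb (by omega))).trans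
    (Frame.setReg _ _ hb le_rfl), ?_⟩
  show State.reg _ b = _
  simp [Instr.eval, State.setReg_reg_ne, e1, e2]

@[fun_prop]
theorem PC.add {f g : α → ℕ} (hf : PC f) (hg : PC g) : PC (fun x => f x + g x) :=
  .arith (· + ·) .add (fun _ _ _ _ => rfl) (fun _ _ => le_rfl) hf hg

@[fun_prop]
theorem PC.sub {f g : α → ℕ} (hf : PC f) (hg : PC g) : PC (fun x => f x - g x) :=
  .arith (· - ·) .sub (fun _ _ _ _ => rfl) (fun _ _ => by omega) hf hg

/-- A comparison of the components of a pair. -/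
theorem PC.compare (r : ℕ → ℕ → Bool) (c : ℕ → ℕ → Cond)
    (hc : ∀ x y s, (c x y).Holds s ↔ r (s.reg x) (s.reg y) = true)
    {f g : α → ℕ} (hf : PC f) (hg : PC g) : PC (fun x => r (f x) (g x)) := by
  refine PC.comp (g := fun y : ℕ × ℕ => r y.1 y.2) (f := fun x => (f x, g x)) ?_ (hf.pair hg)
  refine .intro (fun b => .seq (.instr (.load (b + 1) 2 b)) (.seq (.instr (.load (b + 2) 3 b))
    (.ite (c (b + 1) (b + 2)) (.instr (.const b 1)) (.instr (.const b 0))))) 4 1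
    (fun x => by simp [size_bool]) fun b hb s x h1 hx => ?_
  obtain ⟨_, _, h2, h3⟩ := hx
  have e1 : s.arr 2 (s.reg b) = x.1 := h2
  have e2 : s.arr 3 (s.reg b) = x.2 := h3
  refine (Run.instr_seq (Run.instr_seq (Run.ite (Q := fun s' => Frame b s s' ∧
    rep s' (s'.reg b) (r x.1 x.2)) (B := 1) (fun hh => Run.instr ?_)
    (fun hh => Run.instr ?_)))).mono (by simp) fun _ h => h
  all_goals
    refine ⟨((Frame.setReg s _ hb (by omega)).trans (Frame.setReg _ _ hb (by omega))).trans
      (Frame.setReg _ _ hb le_rfl), ?_⟩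
    rw [hc] at hh
    simp [Instr.eval, State.setReg_reg_ne, e1, e2] at hh
    show State.reg _ b = _
    simp [Instr.eval, hh]

@[fun_prop]
theorem PC.decide_lt {f g : α → ℕ} (hf : PC f) (hg : PC g) :
    PC (fun x => decide (f x < g x)) :=
  .compare (fun a b => decide (a < b)) .lt (fun _ _ _ => by simp [Cond.Holds]) hf hg

@[fun_prop]
theorem PC.decide_eq_nat {f g : α → ℕ} (hf : PC f) (hg : PC g) :
    PC (fun x => decide (f x = g x)) :=
  .compare (fun a b => decide (a = b)) .eq (fun _ _ _ => by simp [Cond.Holds]) hf hg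

@[fun_prop]
theorem PC.cond {c : α → Bool} {f g : α → β} (hc : PC c) (hf : PC f) (hg : PC g) :
    PC (fun x => bif c x then f x else g x) := by
  obtain ⟨R, r, hr, hR⟩ := hc
  obtain ⟨P, p, hp, hP⟩ := hf
  obtain ⟨Q, q, hq, hQ⟩ := hg
  refine .intro (fun b => .seq (.seq (.instr (.copy (b + 1) b)) (R (b + 1)))
    (.seq (.instr (.const (b + 2) 1)) (.ite (.eq (b + 1) (b + 2)) (P b) (Q b))))
    ((r + 1) + (p + q + 1 + 1)) (p + q) (fun x => ?_) ?_
  · have := hp x; have := hq x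
    cases c x <;> simp <;> omega
  · intro b hb s x h1 hx
    simp only [Polynomial.eval_add, Polynomial.eval_one]
    refine (Run.copy_eval (fun b hb s => hR b hb s x) hb (d := b + 1) (by omega) h1 hx).seq ?_
    rintro s₁ ⟨f₁, r₁⟩
    have f₁' := f₁.weaken (show b ≤ b + 1 by omega)
    have f₂ := Frame.setReg (b := b) (r := b + 2) s₁ 1 hb (by omega)
    have hx' : rep (s₁.setReg (b + 2) 1) ((s₁.setReg (b + 2) 1).reg b) x := by
      rw [State.setReg_reg_ne _ _ (by omega), f₁.low b (by omega) (by omega)]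
      exact Data.mono f₂ (Data.mono f₁ hx)
    have h1' : 1 ≤ (s₁.setReg (b + 2) 1).reg 1 := (h1.trans f₁.hp).trans f₂.hp
    have r₁' : s₁.reg (b + 1) = (c x).toNat := r₁
    refine Run.instr_seq (Run.ite (fun hh => ?_) (fun hh => ?_))
    · have : c x = true := by
        simp [Cond.Holds, Instr.eval, State.setReg_reg_ne, r₁'] at hh
        simpa using hh
      rw [this]
      refine (hP b hb _ x h1' hx').mono (by omega) ?_
      rintro s' ⟨f₃, r₃⟩
      exact ⟨(f₁'.trans f₂).trans f₃, r₃⟩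
    · have : c x = false := by
        simp [Cond.Holds, Instr.eval, State.setReg_reg_ne, r₁'] at hh
        simpa using hh
      rw [this]
      refine (hQ b hb _ x h1' hx').mono (by omega) ?_
      rintro s' ⟨f₃, r₃⟩
      exact ⟨(f₁'.trans f₂).trans f₃, r₃⟩

-- Allocated cells have positive addresses, so a comparison with 0 detects the empty list; otherwise
-- the cell of the list is also the pair of head and tail, and one more cell makes it the argument
-- of `g`.
@[fun_prop]
theorem PC.listCase {l : α → List β} {f : α → γ} {g : α → β → List β → γ}
    (hl : PC l) (hf : PC f) (hg : PC (fun p : α × β × List β => g p.1 p.2.1 p.2.2)) :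
    PC (fun x => listCase (l x) (f x) (g x)) := by
  obtain ⟨R, r, hr, hR⟩ := hl
  obtain ⟨P, p, hp, hP⟩ := hf
  obtain ⟨Q, q, hq, hQ⟩ := hg
  have hq' : ∀ (x : α) (y : β) (t : List β), l x = y :: t →
      size ((x, y, t) : α × β × List β) ≤ (Polynomial.X + r + 1).eval (size x) := by
    intro x y t h
    have := hr x
    rw [h, size_cons] at this
    simp [size_pair]; omega
  refine .intro (fun b => .seq (.seq (.instr (.copy (b + 1) b)) (R (b + 1)))
    (.seq (.instr (.const (b + 2) 0)) (.ite (.eq (b + 1) (b + 2)) (P b)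
      (.seq (alloc b b (b + 1) (b + 2)) (Q b)))))
    ((r + 1) + (p + (5 + q.comp (Polynomial.X + r + 1)) + 1 + 1))
    (p + q.comp (Polynomial.X + r + 1)) (fun x => ?_) ?_
  · have h1 := hp x
    rw [Polynomial.eval_add, Polynomial.eval_comp]
    rcases h : l x with _ | ⟨y, t⟩
    · simp only [listCase_nil]; omega
    · exact ((hq (x, y, t)).trans (eval_mono q (hq' x y t h))).trans (by omega)
  · intro b hb s x h1 hx
    simp only [Polynomial.eval_add, Polynomial.eval_comp, Polynomial.eval_one,
      Polynomial.eval_ofNat]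
    refine (Run.copy_eval (fun b hb s => hR b hb s x) hb (d := b + 1) (by omega) h1 hx).seq ?_
    rintro s₁ ⟨f₁, r₁⟩
    have f₁' := f₁.weaken (show b ≤ b + 1 by omega)
    have f₂ := Frame.setReg (b := b) (r := b + 2) s₁ 0 hb (by omega)
    have hx' : rep (s₁.setReg (b + 2) 0) ((s₁.setReg (b + 2) 0).reg b) x := by
      rw [State.setReg_reg_ne _ _ (by omega), f₁.low b (by omega) (by omega)]
      exact Data.mono f₂ (Data.mono f₁ hx)
    have h1' : 1 ≤ (s₁.setReg (b + 2) 0).reg 1 := (h1.trans f₁.hp).trans f₂.hp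
    refine Run.instr_seq (Run.ite (fun hh => ?_) (fun hh => ?_))
    · have h0 : s₁.reg (b + 1) = 0 := by
        simpa [Cond.Holds, Instr.eval, State.setReg_reg_ne] using hh
      rcases h : l x with _ | ⟨y, t⟩
      · refine (hP b hb _ x h1' hx').mono (by omega) ?_
        rintro s' ⟨f₃, r₃⟩
        exact ⟨(f₁'.trans f₂).trans f₃, r₃⟩
      · rw [h] at r₁
        obtain ⟨h3, -⟩ := r₁
        omega
    · have h0 : s₁.reg (b + 1) ≠ 0 := by
        simpa [Cond.Holds, Instr.eval, State.setReg_reg_ne] using hh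
      rcases h : l x with _ | ⟨y, t⟩
      · rw [h] at r₁; exact absurd r₁ h0
      · rw [h] at r₁
        have r₁' : rep s₁ (s₁.reg (b + 1)) (y, t) := r₁
        refine Run.mono (B := 5 + q.eval (size ((x, y, t) : α × β × List β)))
          (Run.seq (alloc_run (b := b) hb le_rfl (by omega) (by omega) _) ?_)
          ?_ (fun _ h => h)
        · rintro s₃ ⟨f₃, h₁, h₂, h₃, h₄, -⟩
          refine (hQ b hb s₃ (x, y, t) (h1'.trans f₃.hp) ⟨?_, ?_, ?_, ?_⟩).mono le_rfl ?_
          · rw [h₁]; exact h1'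
          · rw [h₁, h₂]; exact Nat.lt_succ_self _
          · rw [h₁, h₃]; exact Data.mono f₃ hx'
          · rw [h₁, h₄]
            simp only [Instr.eval]
            rw [State.setReg_reg_ne _ _ (by omega)]
            exact Data.mono (α := β × List β) f₃ (Data.mono (α := β × List β) f₂ r₁')
          · rintro s' ⟨f₄, r₄⟩
            exact ⟨((f₁'.trans f₂).trans f₃).trans f₄, r₄⟩
        · have := eval_mono q (hq' x y t h)
          simp only [Polynomial.eval_add, Polynomial.eval_one] at this
          omega

/-- Counting down from `m` and consing each value produces the increasing list without a reversal.
-/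
theorem PC.range_nat : PC (fun m : ℕ => List.range m) := by
  refine .intro (fun b => .seq (.instr (.const (b + 1) 0)) (.seq (.instr (.const (b + 2) 0))
    (.seq (.instr (.const (b + 3) 1)) (.seq (.while (.lt (b + 2) b)
      (.seq (.instr (.sub b b (b + 3))) (alloc (b + 1) b (b + 1) (b + 4))))
      (.instr (.copy b (b + 1)))))))
    (7 * Polynomial.X + 1 + 1 + 3) (Polynomial.X * (Polynomial.X + 1) + 1) (fun m => ?_) ?_
  · simpa [size_nat] using size_list_le (List.range m) m (fun x hx => by
      simpa [size_nat] using (List.mem_range.1 hx).le)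
  · intro b hb s m h1 hm
    have key : ∀ (j : ℕ) (l : List ℕ) (s : State), 1 ≤ s.reg 1 → s.reg b = j →
        s.reg (b + 2) = 0 → s.reg (b + 3) = 1 → rep s (s.reg (b + 1)) l →
        Run (.while (.lt (b + 2) b)
          (.seq (.instr (.sub b b (b + 3))) (alloc (b + 1) b (b + 1) (b + 4)))) s (7 * j + 1)
          (fun s' => Frame b s s' ∧ rep s' (s'.reg (b + 1)) (List.range j ++ l)) := by
      intro j
      induction j with
      | zero =>
        intro l s h1 hj h0 _ hl
        exact Run.while_false (by simp [Cond.Holds, hj, h0]) ⟨Frame.refl _ _, by simpa using hl⟩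
      | succ j ih =>
        intro l s h1 hj h0 h3 hl
        have f₀ := Frame.setReg (b := b) (r := b) s (s.reg b - s.reg (b + 3)) hb le_rfl
        refine Run.mono (Run.while_true (B' := 7 * j + 1)
          (by simp [Cond.Holds, hj, h0]) (Run.instr_seq (alloc_run
          (b := b) hb (by omega) (by omega) (by omega) _)) ?_) (by omega) (fun _ h => h)
        rintro s₁ ⟨f₁, h₁, h₂, h₃, h₄, h₅⟩
        have f₂ : Frame b s s₁ := f₀.trans f₁
        have hr : ∀ r, r ≠ b → r ≠ b + 1 → r ≠ b + 4 → r ≠ 1 → s₁.reg r = s.reg r := by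
          intro r a1 a2 a3 a4
          rw [h₅ r a2 a3 a4]
          exact State.setReg_reg_ne _ _ a1
        refine (ih (j :: l) s₁ (h1.trans f₂.hp) ?_ ?_ ?_ ?_).mono le_rfl ?_
        · rw [h₅ b (by omega) (by omega) (by omega)]
          simp [Instr.eval, hj, h3]
        · rw [hr _ (by omega) (by omega) (by omega) (by omega), h0]
        · rw [hr _ (by omega) (by omega) (by omega) (by omega), h3]
        · refine ⟨?_, ?_, ?_, ?_⟩
          · rw [h₁]; exact h1.trans f₀.hp
          · rw [h₁, h₂]; exact Nat.lt_succ_self _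
          · rw [h₁, h₃]
            simp only [Instr.eval, State.setReg_reg_self, hj, h3]
            rfl
          · rw [h₁, h₄]
            simp only [Instr.eval]
            rw [State.setReg_reg_ne _ _ (by omega)]
            exact Data.mono (α := List ℕ) f₂ hl
        · rintro s' ⟨f₃, r₃⟩
          exact ⟨f₂.trans f₃, by simpa [List.range_succ] using r₃⟩
    have hm' : s.reg b = m := hm
    set t := (Instr.const (b + 3) 1).eval ((Instr.const (b + 2) 0).eval
      ((Instr.const (b + 1) 0).eval s)) with ht
    have ft : Frame b s t := ((Frame.setReg s _ hb (by omega)).trans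
      (Frame.setReg _ _ hb (by omega))).trans (Frame.setReg _ _ hb (by omega))
    refine Run.mono (Run.instr_seq (Run.instr_seq (Run.instr_seq (Run.seq
      (key m [] t (h1.trans ft.hp) ?_ ?_ ?_ ?_) (B' := 1) (Q' := fun s' => Frame b s s' ∧
        rep s' (s'.reg b) (List.range m)) ?_)))) (by simp [size_nat]; omega) (fun _ h => h)
    · simp [ht, Instr.eval, State.setReg_reg_ne, hm']
    · simp [ht, Instr.eval, State.setReg_reg_ne]
    · simp [ht, Instr.eval]
    · simp [ht, Instr.eval, State.setReg_reg_ne]; rfl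
    · rintro s' ⟨f₁, r₁⟩
      have f₂ := Frame.setReg (b := b) (r := b) s' (s'.reg (b + 1)) hb le_rfl
      refine Run.instr ⟨(ft.trans f₁).trans f₂, ?_⟩
      simpa [Instr.eval] using Data.mono f₂ r₁

@[fun_prop]
theorem PC.range {f : α → ℕ} (hf : PC f) : PC (fun x => List.range (f x)) :=
  PC.range_nat.comp hf

/-- Left folds with polynomially bounded intermediate values. -/
theorem PC.foldl_of_bound {l : α → List β} {i : α → γ} {g : α → γ → β → γ}
    (hl : PC l) (hi : PC i) (hg : PC (fun p : α × γ × β => g p.1 p.2.1 p.2.2))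
    (r : Polynomial ℕ)
    (hr : ∀ x l₁ l₂, l x = l₁ ++ l₂ → size (l₁.foldl (g x) (i x)) ≤ r.eval (size x)) :
    PC (fun x => (l x).foldl (g x) (i x)) := by
  obtain ⟨L, p, hp, hL⟩ := hl
  obtain ⟨I, q, hq, hI⟩ := hi
  obtain ⟨P, t, ht, hP⟩ := hg
  -- Bounds the size of the triple passed to the step function: argument, accumulator, list element,
  -- and two pair cells.
  let u : Polynomial ℕ := Polynomial.X + r + p + 2
  refine .intro (fun b => .seq (.seq (.instr (.copy (b + 1) b)) (I (b + 1)))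
    (.seq (.seq (.instr (.copy (b + 2) b)) (L (b + 2)))
      (.seq (.instr (.const (b + 3) 0)) (.seq (.while (.lt (b + 3) (b + 2))
        (.seq (.instr (.load (b + 4) 2 (b + 2))) (.seq (.instr (.load (b + 2) 3 (b + 2)))
          (.seq (alloc (b + 4) (b + 1) (b + 4) (b + 5)) (.seq (alloc (b + 4) b (b + 4) (b + 5))
            (.seq (P (b + 4)) (.instr (.copy (b + 1) (b + 4)))))))))
        (.instr (.copy b (b + 1)))))))
    ((q + 1) + ((p + 1) + (p * (t.comp u + 14) + 1 + 1 + 1))) r (fun x => ?_) ?_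
  · exact hr x (l x) [] (by simp)
  · intro b hb s x h1 hx
    have key : ∀ (l₂ l₁ : List β) (s : State), l x = l₁ ++ l₂ → 1 ≤ s.reg 1 →
        rep s (s.reg b) x → s.reg (b + 3) = 0 → rep s (s.reg (b + 2)) l₂ →
        rep s (s.reg (b + 1)) (l₁.foldl (g x) (i x)) →
        Run (.while (.lt (b + 3) (b + 2))
        (.seq (.instr (.load (b + 4) 2 (b + 2))) (.seq (.instr (.load (b + 2) 3 (b + 2)))
          (.seq (alloc (b + 4) (b + 1) (b + 4) (b + 5)) (.seq (alloc (b + 4) b (b + 4) (b + 5))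
            (.seq (P (b + 4)) (.instr (.copy (b + 1) (b + 4)))))))))
          s (l₂.length * ((t.comp u).eval (size x) + 14) + 1)
          (fun s' => Frame (b + 1) s s' ∧ rep s' (s'.reg (b + 1)) ((l x).foldl (g x) (i x))) := by
      intro l₂
      induction l₂ with
      | nil =>
        intro l₁ s hl _ _ h3 h2 hacc
        have h2' : s.reg (b + 2) = 0 := h2
        refine (Run.while_false (by simp [Cond.Holds, h2', h3]) ⟨Frame.refl _ _, ?_⟩).mono
          (by simp) fun _ h => h
        rw [hl]; simpa using hacc
      | cons y l₂ ih =>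
        intro l₁ s hl h1 hx h3 h2 hacc
        obtain ⟨c1, c2, c3, c4⟩ := h2
        set s₁ := (Instr.load (b + 2) 3 (b + 2)).eval ((Instr.load (b + 4) 2 (b + 2)).eval s)
          with hs₁
        have f₁ : Frame (b + 1) s s₁ := (Frame.setReg s _ (by omega) (by omega)).trans
          (Frame.setReg _ _ (by omega) (by omega))
        have e4 : s₁.reg (b + 4) = s.arr 2 (s.reg (b + 2)) := by
          simp [hs₁, Instr.eval, State.setReg_reg_ne]
        have e2 : s₁.reg (b + 2) = s.arr 3 (s.reg (b + 2)) := by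
          simp [hs₁, Instr.eval, State.setReg_reg_ne]
        have e : ∀ r, r ≠ b + 4 → r ≠ b + 2 → s₁.reg r = s.reg r := by
          intro r a1 a2
          simp [hs₁, Instr.eval, State.setReg_reg_ne, a1, a2]
        have hsz : (t.eval (size ((x, l₁.foldl (g x) (i x), y) : α × γ × β))) ≤
            (t.comp u).eval (size x) := by
          rw [Polynomial.eval_comp]
          refine eval_mono t ?_
          have a1 := hr x l₁ _ hl
          have a2 := hp x
          have a3 := size_le_of_mem (show y ∈ l x by rw [hl]; simp)
          simp [u, size_pair]; omega
        refine Run.mono (Run.while_true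
          (B := 1 + ((t.comp u).eval (size x)) + 5 + 5 + 1 + 1)
          (B' := l₂.length * ((t.comp u).eval (size x) + 14) + 1)
          (Q := fun s' => Frame (b + 1) s s' ∧ s'.reg (b + 3) = 0 ∧
            s'.reg (b + 2) = s.arr 3 (s.reg (b + 2)) ∧
            rep s' (s'.reg (b + 1)) ((l₁ ++ [y]).foldl (g x) (i x))) ?_ ?_ ?_) ?_ (fun _ h => h)
        · simp only [Cond.Holds]; rw [h3]; exact c1
        · refine Run.instr_seq (Run.instr_seq (Run.mono (Run.seq (alloc_run
            (b := b + 4) (by omega) (by omega) (by omega) (by omega) s₁) (B' := 5 +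
              ((t.comp u).eval (size x) + 1)) ?_)
            (by omega) (fun _ h => h)))
          rintro s₂ ⟨f₂, h₁, h₂, h₃, h₄, h₅⟩
          refine Run.seq (alloc_run
            (b := b + 4) (by omega) (by omega) (by omega) (by omega) s₂) ?_
          rintro s₃ ⟨f₃, k₁, k₂, k₃, k₄, k₅⟩
          have f₁₂ : Frame (b + 1) s s₂ := f₁.trans (f₂.weaken (by omega))
          have f₁₃ : Frame (b + 1) s s₃ := f₁₂.trans (f₃.weaken (by omega))
          refine Run.seq ((hP (b + 4) (by omega) s₃ (x, l₁.foldl (g x) (i x), y)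
            (h1.trans f₁₃.hp) ⟨?_, ?_, ?_, ?_, ?_, ?_, ?_⟩).mono hsz (fun _ h => h)) ?_
          · rw [k₁]; exact h1.trans f₁₂.hp
          · rw [k₁, k₂]; exact Nat.lt_succ_self _
          · rw [k₁, k₃, f₂.low b (by omega) (by omega), e b (by omega) (by omega)]
            exact Data.mono f₁₃ hx
          · rw [k₁, k₄, h₁]; exact h1.trans f₁.hp
          · rw [k₁, k₄, h₁]
            have := f₃.hp
            have := f₂.hp
            omega
          · rw [k₁, k₄, h₁, f₃.hd _ (by omega), h₃, e (b + 1) (by omega) (by omega)]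
            exact Data.mono f₁₃ hacc
          · rw [k₁, k₄, h₁, f₃.tl _ (by omega), h₄, e4]
            exact Data.mono f₁₃ c3
          · rintro s₄ ⟨f₄, r₄⟩
            have f₅ := Frame.setReg (b := b + 1) (r := b + 1) s₄ (s₄.reg (b + 4)) (by omega)
              le_rfl
            have g₅ : ∀ r, r = b + 2 ∨ r = b + 3 →
                (s₄.setReg (b + 1) (s₄.reg (b + 4))).reg r = s₁.reg r := by
              intro r hr
              rw [State.setReg_reg_ne _ _ (by omega), f₄.low r (by omega) (by omega),
                f₃.low r (by omega) (by omega), f₂.low r (by omega) (by omega)]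
            refine Run.instr ⟨(f₁₃.trans (f₄.weaken (by omega))).trans f₅, ?_, ?_, ?_⟩
            · show (s₄.setReg (b + 1) (s₄.reg (b + 4))).reg (b + 3) = 0
              rw [g₅ _ (Or.inr rfl), e _ (by omega) (by omega), h3]
            · show (s₄.setReg (b + 1) (s₄.reg (b + 4))).reg (b + 2) = _
              rw [g₅ _ (Or.inl rfl), e2]
            · simpa [Instr.eval] using Data.mono f₅ r₄
        · rintro s' ⟨f', z3, z2, z1⟩
          refine (ih (l₁ ++ [y]) s' (by simp [hl]) (h1.trans f'.hp) ?_ z3 ?_ z1).mono le_rfl ?_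
          · rw [f'.low b (by omega) (by omega)]; exact Data.mono f' hx
          · rw [z2]; exact Data.mono (α := List β) f' c4
          · rintro s'' ⟨f'', z⟩
            exact ⟨f'.trans f'', z⟩
        · simp only [List.length_cons, add_mul]
          omega
    rw [Polynomial.eval_add, Polynomial.eval_add]
    refine Run.mono (Run.seq (Run.copy_eval (fun b hb s => hI b hb s x) hb (d := b + 1)
      (by omega) h1 hx) (B' := (p.eval (size x) + 1) +
        (p.eval (size x) * ((t.comp u).eval (size x) + 14) + 1 + 1 + 1)) ?_) (by simp)
        (fun _ h => h)
    rintro s₁ ⟨f₁, r₁⟩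
    have hx₁ : rep s₁ (s₁.reg b) x := by
      rw [f₁.low b (by omega) (by omega)]; exact Data.mono f₁ hx
    refine Run.seq (Run.copy_eval (fun b hb s => hL b hb s x) hb (d := b + 2) (r := b)
      (by omega) (h1.trans f₁.hp) hx₁) ?_
    rintro s₂ ⟨f₂, r₂⟩
    have f₃ := Frame.setReg (b := b + 3) (r := b + 3) s₂ 0 (by omega) le_rfl
    have f₁₂ : Frame (b + 1) s s₂ := f₁.trans (f₂.weaken (by omega))
    have f₁₃ : Frame (b + 1) s (s₂.setReg (b + 3) 0) := f₁₂.trans (f₃.weaken (by omega))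
    refine Run.instr_seq ?_
    refine Run.mono (Run.seq (key (l x) [] (s₂.setReg (b + 3) 0) (by simp) (h1.trans f₁₃.hp)
      ?_ (by simp) ?_ ?_) (B' := 1) (Q' := fun s' => Frame b s s' ∧
        rep s' (s'.reg b) ((l x).foldl (g x) (i x))) ?_) ?_ (fun _ h => h)
    · rw [f₁₃.low b (by omega) (by omega)]; exact Data.mono f₁₃ hx
    · rw [f₃.low _ (by omega) (by omega)]; exact Data.mono f₃ r₂
    · rw [f₃.low _ (by omega) (by omega), f₂.low _ (by omega) (by omega)]
      exact Data.mono f₃ (Data.mono f₂ r₁)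
    · rintro s' ⟨f₄, r₄⟩
      have f₅ := Frame.setReg (b := b) (r := b) s' (s'.reg (b + 1)) hb le_rfl
      refine Run.instr ⟨((f₁₃.trans f₄).weaken (by omega)).trans f₅, ?_⟩
      simpa [Instr.eval] using Data.mono f₅ r₄
    · have := (length_le_size (l x)).trans (hp x)
      have := Nat.mul_le_mul_right ((t.comp u).eval (size x) + 14)
        (show (l x).length ≤ p.eval (size x) by omega)
      omega

end
end KHWP


/-! ### List operations and bounded iteration, built from folds -/

namespace KHWP
open Data (size rep)

section
variable {α β γ δ : Type} [Data α] [Data β] [Data γ] [Data δ]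

theorem PC.size_bound {f : α → β} (hf : PC f) :
    ∃ p : Polynomial ℕ, ∀ x, size (f x) ≤ p.eval (size x) := by
  obtain ⟨_, p, hp, _⟩ := hf
  exact ⟨p, hp⟩

/-- Left folds in which every step adds a polynomially bounded amount to the size. -/
theorem PC.foldl {l : α → List β} {i : α → γ} {g : α → γ → β → γ}
    (hl : PC l) (hi : PC i) (hg : PC (fun p : α × γ × β => g p.1 p.2.1 p.2.2))
    (r : Polynomial ℕ)
    (hr : ∀ x c, ∀ y ∈ l x, size (g x c y) ≤ size c + r.eval (size x + size y)) :
    PC (fun x => (l x).foldl (g x) (i x)) := by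
  obtain ⟨p, hp⟩ := hl.size_bound
  obtain ⟨q, hq⟩ := hi.size_bound
  -- There are at most `p` steps, and every element has size at most `p`, so each step adds at most
  -- `r` evaluated at `X + p`.
  refine .foldl_of_bound hl hi hg (q + p * r.comp (Polynomial.X + p)) fun x l₁ l₂ h => ?_
  have key : ∀ (l' : List β) (c : γ), (∀ y ∈ l', y ∈ l x) →
      size (l'.foldl (g x) c) ≤ size c + l'.length * r.eval (size x + p.eval (size x)) := by
    intro l'
    induction l' with
    | nil => intro c _; simp
    | cons y l' ih =>
      intro c hy
      have h1 := ih (g x c y) fun z hz => hy z (by simp [hz])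
      have h2 := hr x c y (hy y (by simp))
      have h3 := eval_mono r (show size x + size y ≤ size x + p.eval (size x) by
        have := size_le_of_mem (hy y (by simp)); have := hp x; omega)
      simp only [List.foldl_cons, List.length_cons, add_mul]
      omega
  have h1 := key l₁ (i x) fun y hy => by simp [h, hy]
  have h2 : l₁.length ≤ p.eval (size x) := by
    have h3 := length_le_size (l x)
    have h4 := hp x
    have h5 : (l x).length = l₁.length + l₂.length := by rw [h, List.length_append]
    omega
  have h3 := Nat.mul_le_mul_right (r.eval (size x + p.eval (size x))) h2
  have h4 := hq x
  simp only [Polynomial.eval_add, Polynomial.eval_mul, Polynomial.eval_comp, Polynomial.eval_X]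
  omega

@[fun_prop]
theorem PC.reverse {l : α → List β} (hl : PC l) : PC (fun x => (l x).reverse) := by
  have : PC (fun x => (l x).foldl (fun c y => y :: c) []) :=
    PC.foldl (g := fun _ c y => y :: c) hl (.const _) (by fun_prop) (Polynomial.X + 1)
      (fun x c y _ => by simp [size_cons]; omega)
  have e : (fun x => (l x).reverse) = fun x => (l x).foldl (fun c y => y :: c) [] := by
    funext x; simp
  rw [e]; exact this

theorem PC.foldr_of_bound {l : α → List β} {i : α → γ} {g : α → β → γ → γ}
    (hl : PC l) (hi : PC i) (hg : PC (fun p : α × β × γ => g p.1 p.2.1 p.2.2))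
    (r : Polynomial ℕ)
    (hr : ∀ x l₁ l₂, l x = l₁ ++ l₂ → size (l₂.foldr (g x) (i x)) ≤ r.eval (size x)) :
    PC (fun x => (l x).foldr (g x) (i x)) := by
  have : PC (fun x => (l x).reverse.foldl (fun c y => g x y c) (i x)) := by
    refine .foldl_of_bound (g := fun x c y => g x y c) hl.reverse hi
      (hg.comp (f := fun p : α × γ × β => (p.1, p.2.2, p.2.1)) (by fun_prop)) r fun x l₁ l₂ h => ?_
    have h' : l x = l₂.reverse ++ l₁.reverse := by
      rw [← List.reverse_append, ← h, List.reverse_reverse]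
    simpa using hr x _ _ h'
  simpa using this

theorem PC.foldr {l : α → List β} {i : α → γ} {g : α → β → γ → γ}
    (hl : PC l) (hi : PC i) (hg : PC (fun p : α × β × γ => g p.1 p.2.1 p.2.2))
    (r : Polynomial ℕ)
    (hr : ∀ x c, ∀ y ∈ l x, size (g x y c) ≤ size c + r.eval (size x + size y)) :
    PC (fun x => (l x).foldr (g x) (i x)) := by
  have : PC (fun x => (l x).reverse.foldl (fun c y => g x y c) (i x)) :=
    .foldl (g := fun x c y => g x y c) hl.reverse hi
      (hg.comp (f := fun p : α × γ × β => (p.1, p.2.2, p.2.1)) (by fun_prop)) r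
      fun x c y hy => hr x c y (by simpa using hy)
  simpa using this

@[fun_prop]
theorem PC.append {l l' : α → List β} (hl : PC l) (hl' : PC l') :
    PC (fun x => l x ++ l' x) := by
  have : PC (fun x => (l x).foldr (fun y c => y :: c) (l' x)) :=
    PC.foldr (g := fun _ y c => y :: c) hl hl' (by fun_prop) (Polynomial.X + 1)
      (fun x c y _ => by simp [size_cons]; omega)
  simpa using this

@[fun_prop]
theorem PC.map {l : α → List β} {g : α → β → γ} (hl : PC l)
    (hg : PC (fun p : α × β => g p.1 p.2)) : PC (fun x => (l x).map (g x)) := by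
  obtain ⟨p, hp⟩ := hg.size_bound
  have : PC (fun x => (l x).foldr (fun y c => g x y :: c) []) := by
    refine PC.foldr (g := fun x y c => g x y :: c) hl (.const _) ?_
      (p.comp (Polynomial.X + 1) + 1) (fun x c y _ => ?_)
    · exact PC.cons (hg.comp (f := fun p : α × β × List γ => (p.1, p.2.1)) (by fun_prop))
        (by fun_prop)
    · have := hp (x, y)
      simp [size_cons, size_pair] at this ⊢; omega
  have e : (fun x => (l x).map (g x)) = fun x => (l x).foldr (fun y c => g x y :: c) [] := by
    funext x; induction l x <;> simp_all
  rw [e]; exact this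

@[fun_prop]
theorem PC.flatMap {l : α → List β} {g : α → β → List γ} (hl : PC l)
    (hg : PC (fun p : α × β => g p.1 p.2)) : PC (fun x => (l x).flatMap (g x)) := by
  obtain ⟨p, hp⟩ := hg.size_bound
  have : PC (fun x => (l x).foldr (fun y c => g x y ++ c) []) := by
    refine PC.foldr (g := fun x y c => g x y ++ c) hl (.const _) ?_
      (p.comp (Polynomial.X + 1)) (fun x c y _ => ?_)
    · exact PC.append (hg.comp (f := fun p : α × β × List γ => (p.1, p.2.1)) (by fun_prop))
        (by fun_prop)
    · have := hp (x, y)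
      have := size_append (g x y) c
      simp [size_pair] at *; omega
  have e : (fun x => (l x).flatMap (g x)) =
      fun x => (l x).foldr (fun y c => g x y ++ c) [] := by
    funext x; induction l x <;> simp_all
  rw [e]; exact this

@[fun_prop]
theorem PC.filter {l : α → List β} {g : α → β → Bool} (hl : PC l)
    (hg : PC (fun p : α × β => g p.1 p.2)) : PC (fun x => (l x).filter (g x)) := by
  have : PC (fun x => (l x).foldr (fun y c => bif g x y then y :: c else c) []) := by
    refine PC.foldr (g := fun x y c => bif g x y then y :: c else c) hl (.const _) ?_
      (Polynomial.X + 1) (fun x c y _ => ?_)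
    · exact PC.cond (hg.comp (f := fun p : α × β × List β => (p.1, p.2.1)) (by fun_prop))
        (by fun_prop) (by fun_prop)
    · cases g x y <;> simp [size_cons]; omega
  have e : (fun x => (l x).filter (g x)) =
      fun x => (l x).foldr (fun y c => bif g x y then y :: c else c) [] := by
    funext x
    induction l x with
    | nil => rfl
    | cons y t ih => simp only [List.foldr_cons, List.filter_cons, ih]; cases g x y <;> rfl
  rw [e]; exact this

@[fun_prop]
theorem PC.length {l : α → List β} (hl : PC l) : PC (fun x => (l x).length) := by
  have : PC (fun x => (l x).foldr (fun _ c => c + 1) 0) :=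
    PC.foldr (g := fun _ _ c => c + 1) hl (.const _) (by fun_prop) 1
      (fun x c y _ => by simp [size_nat])
  have e : (fun x => (l x).length) = fun x => (l x).foldr (fun _ c => c + 1) 0 := by
    funext x; induction l x <;> simp_all
  rw [e]; exact this

@[fun_prop]
theorem PC.and {f g : α → Bool} (hf : PC f) (hg : PC g) : PC (fun x => f x && g x) := by
  have : PC (fun x => bif f x then g x else false) := by fun_prop
  simpa [Bool.cond_false_right] using this

@[fun_prop]
theorem PC.or {f g : α → Bool} (hf : PC f) (hg : PC g) : PC (fun x => f x || g x) := by
  have : PC (fun x => bif f x then true else g x) := by fun_prop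
  simpa [Bool.cond_true_left] using this

@[fun_prop]
theorem PC.not {f : α → Bool} (hf : PC f) : PC (fun x => !f x) := by
  have : PC (fun x => bif f x then false else true) := by fun_prop
  simpa using this

@[fun_prop]
theorem PC.any {l : α → List β} {g : α → β → Bool} (hl : PC l)
    (hg : PC (fun p : α × β => g p.1 p.2)) : PC (fun x => (l x).any (g x)) := by
  have : PC (fun x => (l x).foldr (fun y c => g x y || c) false) := by
    refine PC.foldr (g := fun x y c => g x y || c) hl (.const _) ?_ 1
      (fun x c y _ => by simp [size_bool])
    exact PC.or (hg.comp (f := fun p : α × β × Bool => (p.1, p.2.1)) (by fun_prop))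
        (by fun_prop)
  have e : (fun x => (l x).any (g x)) = fun x => (l x).foldr (fun y c => g x y || c) false := by
    funext x; induction l x <;> simp_all
  rw [e]; exact this

@[fun_prop]
theorem PC.all {l : α → List β} {g : α → β → Bool} (hl : PC l)
    (hg : PC (fun p : α × β => g p.1 p.2)) : PC (fun x => (l x).all (g x)) := by
  have e : (fun x => (l x).all (g x)) = fun x => !(l x).any (fun y => !g x y) := by
    funext x; simp [List.not_any_eq_all_not]
  rw [e]
  exact (PC.any (g := fun x y => !g x y) hl hg.not).not

@[fun_prop]
theorem PC.decide_le {f g : α → ℕ} (hf : PC f) (hg : PC g) :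
    PC (fun x => decide (f x ≤ g x)) := by
  have e : (fun x => decide (f x ≤ g x)) = fun x => !decide (g x < f x) := by
    funext x; rw [← decide_not]; exact decide_eq_decide.2 (not_lt (α := ℕ)).symm
  rw [e]; fun_prop

/-- Types with polynomial-time equality. -/
class DataEq (α : Type) [Data α] [DecidableEq α] : Prop where
  pc_eq : PC (fun p : α × α => decide (p.1 = p.2))

@[fun_prop]
theorem PC.decide_eq [DecidableEq β] [DataEq β] {f g : α → β} (hf : PC f) (hg : PC g) :
    PC (fun x => decide (f x = g x)) :=
  (DataEq.pc_eq (α := β)).comp (hf.pair hg)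

instance : DataEq ℕ := ⟨by fun_prop⟩

instance [DecidableEq α] [DecidableEq β] [DataEq α] [DataEq β] : DataEq (α × β) where
  pc_eq := by
    have e : (fun p : (α × β) × (α × β) => decide (p.1 = p.2)) =
        fun p => decide (p.1.1 = p.2.1) && decide (p.1.2 = p.2.2) := by
      funext p; simp [Prod.ext_iff]
    rw [e]; fun_prop

/-- A fold along one list consumes the other one and keeps a flag for agreement so far; the lists
are equal when the flag survives and nothing of the second list remains. -/
instance [DecidableEq α] [DataEq α] : DataEq (List α) where
  pc_eq := by
    let f : Bool × List α → α → Bool × List α := fun c y =>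
      listCase c.2 (false, []) (fun z t => (c.1 && decide (y = z), t))
    have key : ∀ (l l' : List α) (c : Bool),
        (listCase (l.foldl f (c, l')).2 (l.foldl f (c, l')).1 (fun _ _ => false)) =
          (c && decide (l = l')) := by
      intro l
      induction l with
      | nil =>
        intro l' c
        cases l' <;> simp
      | cons y l ih =>
        intro l' c
        cases l' with
        | nil =>
          have : f (c, []) y = (false, []) := rfl
          rw [List.foldl_cons, this, ih]; simp
        | cons z l' =>
          have : f (c, z :: l') y = (c && decide (y = z), l') := rfl
          rw [List.foldl_cons, this, ih]
          by_cases h : y = z <;> by_cases h' : l = l' <;> simp [h, h']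
    have hfold : PC (fun p : List α × List α => p.1.foldl f (true, p.2)) := by
      refine PC.foldl (g := fun _ c y => f c y) (by fun_prop) (by fun_prop) ?_ 1 ?_
      · show PC (fun p : (List α × List α) × (Bool × List α) × α =>
          listCase p.2.1.2 (false, []) (fun z t => (p.2.1.1 && decide (p.2.2 = z), t)))
        fun_prop
      · rintro x ⟨c, t⟩ y _
        cases t <;> simp [f, size_pair, size_bool, size_nil, size_cons]
        omega
    have e : (fun p : List α × List α => decide (p.1 = p.2)) = fun p =>
        listCase (p.1.foldl f (true, p.2)).2 (p.1.foldl f (true, p.2)).1 (fun _ _ => false) := by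
      funext p; rw [key]; simp
    rw [e]
    exact PC.listCase (g := fun _ _ _ => false) hfold.snd hfold.fst (.const _)

/-- Membership as a Boolean. -/
def memB {α : Type} [DecidableEq α] (x : α) (l : List α) : Bool := l.any fun y => decide (x = y)

@[simp] theorem memB_iff {α : Type} [DecidableEq α] {x : α} {l : List α} :
    memB x l = true ↔ x ∈ l := by simp [memB]

@[fun_prop]
theorem PC.memB [DecidableEq β] [DataEq β] {f : α → β} {l : α → List β} (hf : PC f)
    (hl : PC l) : PC (fun x => memB (f x) (l x)) := by
  unfold KHWP.memB; fun_prop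

/-- All ways to write a list as `l₁ ++ x :: l₂`. -/
def splits {α : Type} : List α → List (List α × α × List α)
  | [] => []
  | x :: l => ([], x, l) :: (splits l).map fun t => (x :: t.1, t.2)

theorem mem_splits {α : Type} {l l₁ l₂ : List α} {x : α} :
    (l₁, x, l₂) ∈ splits l ↔ l = l₁ ++ x :: l₂ := by
  induction l generalizing l₁ with
  | nil => simp [splits]
  | cons y l ih =>
    cases l₁ with
    | nil => simp [splits]; tauto
    | cons z l₁ => simp [splits, ih]; tauto

theorem size_splits (l : List α) :
    size (splits l) ≤ (Polynomial.X * (Polynomial.X + 4) : Polynomial ℕ).eval (size l) := by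
  have h1 : (splits l).length = l.length := by
    induction l with
    | nil => rfl
    | cons x l ih => simp [splits, ih]
  have h2 := size_list_le (splits l) (size l + 2) (by
    rintro ⟨a, x, b⟩ h
    have := size_append a (x :: b)
    rw [mem_splits] at h
    rw [← h] at this
    simp only [size_pair, size_cons] at this ⊢
    omega)
  have h3 := length_le_size l
  rw [h1] at h2
  have h4 := Nat.mul_le_mul_right (size l + 2 + 1) (show l.length + 1 ≤ size l from h3)
  simp only [Polynomial.eval_mul, Polynomial.eval_X, Polynomial.eval_add, Polynomial.eval_ofNat]
  nlinarith

@[fun_prop]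
theorem PC.splits {l : α → List β} (hl : PC l) : PC (fun x => splits (l x)) := by
  refine PC.comp (g := fun l : List β => KHWP.splits l) ?_ hl
  -- The fold carries the current suffix next to its splits, because the new split at the front
  -- needs that suffix.
  let g : β → List β × List (List β × β × List β) → List β × List (List β × β × List β) :=
    fun x c => (x :: c.1, ([], x, c.1) :: c.2.map fun t => (x :: t.1, t.2))
  have key : ∀ l : List β, l.foldr g ([], []) = (l, KHWP.splits l) := by
    intro l
    induction l with
    | nil => rfl
    | cons x l ih => rw [List.foldr_cons, ih]; rfl
  have : PC (fun l : List β => l.foldr g ([], [])) := by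
    refine PC.foldr_of_bound (g := fun _ => g) (by fun_prop) (by fun_prop) ?_
      (Polynomial.X + Polynomial.X * (Polynomial.X + 4) + 1) ?_
    · show PC (fun p : List β × β × (List β × List (List β × β × List β)) =>
        (p.2.1 :: p.2.2.1, ([], p.2.1, p.2.2.1) :: p.2.2.2.map fun t => (p.2.1 :: t.1, t.2)))
      fun_prop
    · intro x l₁ l₂ h
      subst h
      have h1 := size_append l₁ l₂
      have h3 := one_le_size_list l₁
      have h2 := (size_splits l₂).trans (eval_mono _ (show size l₂ ≤ size (l₁ ++ l₂) by omega))
      rw [key, size_pair, Polynomial.eval_add, Polynomial.eval_add, Polynomial.eval_one,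
        Polynomial.eval_X]
      dsimp only
      omega
  have e : (fun l : List β => KHWP.splits l) = fun l => (l.foldr g ([], [])).2 := by
    funext l; rw [key]
  rw [e]; fun_prop

/-- The first element of a list, with a default value. -/
def headOr {α : Type} (l : List α) (d : α) : α := listCase l d fun x _ => x

@[simp] theorem headOr_cons {α : Type} (x : α) (l : List α) (d : α) : headOr (x :: l) d = x := rfl
@[simp] theorem headOr_nil {α : Type} (d : α) : headOr [] d = d := rfl

@[fun_prop]
theorem PC.headOr {l : α → List β} {d : α → β} (hl : PC l) (hd : PC d) :
    PC (fun x => headOr (l x) (d x)) := by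
  unfold KHWP.headOr; fun_prop

theorem headOr_mem {α : Type} {l : List α} (d : α) (h : l ≠ []) : headOr l d ∈ l := by
  cases l with
  | nil => exact absurd rfl h
  | cons x l => simp

/-- The function that takes given values at finitely many places. -/
theorem PC.table [DecidableEq α] [DataEq α] (t : List (α × β)) {f : α → β} (hf : PC f) :
    PC (fun x => KHWP.headOr ((t.filter fun e => decide (e.1 = x)).map fun e => e.2) (f x)) := by
  fun_prop

/-- Iterating a map `m` times while the size grows by a bounded amount in every step. -/
theorem PC.repeatN {m : α → ℕ} {i : α → γ} {g : α → γ → γ} (hm : PC m) (hi : PC i)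
    (hg : PC (fun p : α × γ => g p.1 p.2)) (r : Polynomial ℕ)
    (hr : ∀ x c, size (g x c) ≤ size c + r.eval (size x)) :
    PC (fun x => (g x)^[m x] (i x)) := by
  have h : PC (fun x => (List.range (m x)).foldl (fun c _ => g x c) (i x)) :=
    PC.foldl (g := fun x c _ => g x c) hm.range hi
      (hg.comp (f := fun p : α × γ × ℕ => (p.1, p.2.1)) (by fun_prop)) r fun x c y _ =>
        (hr x c).trans (Nat.add_le_add_left (eval_mono r (by omega)) _)
  have e : ∀ (m : ℕ) (g : γ → γ) (i : γ), (List.range m).foldl (fun c _ => g c) i = g^[m] i := by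
    intro m g i
    induction m with
    | zero => rfl
    | succ m ih => rw [List.range_succ, List.foldl_append, ih, Function.iterate_succ_apply']; rfl
  simpa only [e] using h

end
end KHWP


namespace KHWP
open Data (size rep)

/-! ### Reading the input and writing the output -/

/-- One row of the list of edges of an adjacency matrix `a`. -/
def addRow (a : ℕ → ℕ → Bool) (i : ℕ) (js : List ℕ) (E : List (ℕ × ℕ)) : List (ℕ × ℕ) :=
  js.foldl (fun E j => bif a i j then (i, j) :: E else E) E

/-- The list of edges of an adjacency matrix `a`. -/
def edgeList (a : ℕ → ℕ → Bool) (n : ℕ) : List (ℕ × ℕ) :=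
  (List.range n).foldl (fun E i => addRow a i (List.range n) E) []

theorem mem_addRow {a : ℕ → ℕ → Bool} {i : ℕ} {js : List ℕ} {E : List (ℕ × ℕ)} {e : ℕ × ℕ} :
    e ∈ addRow a i js E ↔ e ∈ E ∨ (e.1 = i ∧ e.2 ∈ js ∧ a i e.2 = true) := by
  unfold addRow
  induction js generalizing E with
  | nil => simp
  | cons j js ih =>
    rw [List.foldl_cons, ih]
    rcases e with ⟨u, v⟩
    by_cases h : a i j = true
    · simp only [h, cond_true, List.mem_cons, Prod.mk.injEq]
      constructor
      · rintro ((⟨rfl, rfl⟩ | h1) | h1)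
        · exact Or.inr ⟨rfl, Or.inl rfl, h⟩
        · exact Or.inl h1
        · exact Or.inr ⟨h1.1, Or.inr h1.2.1, h1.2.2⟩
      · rintro (h1 | ⟨h1, h2 | h2, h3⟩)
        · exact Or.inl (Or.inr h1)
        · exact Or.inl (Or.inl ⟨h1, h2⟩)
        · exact Or.inr ⟨h1, h2, h3⟩
    · have h' : a i j = false := by simpa using h
      simp only [h', cond_false, List.mem_cons]
      constructor
      · rintro (h1 | h1)
        · exact Or.inl h1
        · exact Or.inr ⟨h1.1, Or.inr h1.2.1, h1.2.2⟩
      · rintro (h1 | ⟨h1, rfl | h2, h3⟩)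
        · exact Or.inl h1
        · exact absurd h3 h
        · exact Or.inr ⟨h1, h2, h3⟩

theorem mem_edgeList {a : ℕ → ℕ → Bool} {n : ℕ} {e : ℕ × ℕ} :
    e ∈ edgeList a n ↔ e.1 < n ∧ e.2 < n ∧ a e.1 e.2 = true := by
  have key : ∀ (is : List ℕ) (E : List (ℕ × ℕ)),
      e ∈ is.foldl (fun E i => addRow a i (List.range n) E) E ↔
        e ∈ E ∨ (e.1 ∈ is ∧ e.2 < n ∧ a e.1 e.2 = true) := by
    intro is
    induction is with
    | nil => simp
    | cons i is ih =>
      intro E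
      rw [List.foldl_cons, ih, mem_addRow, List.mem_range, List.mem_cons]
      constructor
      · rintro ((h | ⟨h, h2, h3⟩) | h)
        · exact Or.inl h
        · exact Or.inr ⟨Or.inl h, h2, h ▸ h3⟩
        · exact Or.inr ⟨Or.inr h.1, h.2⟩
      · rintro (h | ⟨h | h, h2, h3⟩)
        · exact Or.inl (Or.inl h)
        · exact Or.inl (Or.inr ⟨h, h2, h ▸ h3⟩)
        · exact Or.inr ⟨h, h2, h3⟩
  simpa [edgeList] using key (List.range n) []

theorem length_addRow (a : ℕ → ℕ → Bool) (i : ℕ) (js : List ℕ) (E : List (ℕ × ℕ)) :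
    (addRow a i js E).length ≤ E.length + js.length := by
  unfold addRow
  induction js generalizing E with
  | nil => simp
  | cons j js ih =>
    rw [List.foldl_cons]
    refine (ih _).trans ?_
    cases a i j <;> simp
    omega

theorem length_edgeList (a : ℕ → ℕ → Bool) (n : ℕ) : (edgeList a n).length ≤ n * n := by
  have key : ∀ (is : List ℕ) (E : List (ℕ × ℕ)),
      (is.foldl (fun E i => addRow a i (List.range n) E) E).length ≤ E.length + is.length * n := by
    intro is
    induction is with
    | nil => simp
    | cons i is ih =>
      intro E
      rw [List.foldl_cons]
      refine (ih _).trans ?_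
      have := length_addRow a i (List.range n) E
      simp only [List.length_range, List.length_cons, add_mul] at this ⊢
      omega
  simpa [edgeList] using key (List.range n) []

theorem size_edgeList (a : ℕ → ℕ → Bool) (n : ℕ) :
    size (n, edgeList a n) ≤
      (Polynomial.X + (Polynomial.X * Polynomial.X * (2 * Polynomial.X + 2) + 1) + 1 :
        Polynomial ℕ).eval n := by
  have h1 := size_list_le (edgeList a n) (2 * n + 1) (by
    rintro ⟨u, v⟩ h
    obtain ⟨h1, h2, _⟩ := mem_edgeList.1 h
    simp only [size_pair, size_nat] at h1 h2 ⊢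
    omega)
  have h2 := Nat.mul_le_mul_right (2 * n + 2) (length_edgeList a n)
  simp only [size_pair, size_nat, Polynomial.eval_add, Polynomial.eval_mul, Polynomial.eval_X,
    Polynomial.eval_one, Polynomial.eval_ofNat]
  rw [show 2 * n + 1 + 1 = 2 * n + 2 from rfl] at h1
  omega

/-- Reads one row of the matrix in array `0`. -/
def rowLoop : Program :=
  .while (.lt 6 0) (.seq (.instr (.load 7 0 4))
    (.seq (.ite (.eq 7 5) (.seq (alloc 7 3 6 8) (alloc 2 7 2 8)) .skip)
      (.seq (.instr (.add 4 4 5)) (.instr (.add 6 6 5)))))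

def matrixLoop : Program :=
  .while (.lt 3 0) (.seq (.instr (.const 6 0)) (.seq rowLoop (.instr (.add 3 3 5))))

/-- The facts about registers that hold while the input is read. -/
structure Reading (A : ℕ → ℕ) (n : ℕ) (i idx : ℕ) (E : List (ℕ × ℕ)) (s : State) : Prop where
  arr : s.arr 0 = A
  r0 : s.reg 0 = n
  r1 : 1 ≤ s.reg 1
  r2 : rep s (s.reg 2) E
  r3 : s.reg 3 = i
  r4 : s.reg 4 = idx
  r5 : s.reg 5 = 1

theorem rowLoop_run (A : ℕ → ℕ) (a : ℕ → ℕ → Bool) (n i : ℕ)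
    (ha : ∀ j < n, a i j = decide (A (i * n + j) = 1)) :
    ∀ (m j : ℕ) (E : List (ℕ × ℕ)) (s : State), j + m = n → s.reg 6 = j →
      Reading A n i (i * n + j) E s →
      Run rowLoop s (m * 15 + 1)
        (Reading A n i (i * n + n) (addRow a i (List.range' j m) E)) := by
  intro m
  induction m with
  | zero =>
    intro j E s hj h6 hs
    refine Run.mono (Run.while_false ?_ ?_) (by omega) (fun _ h => h)
    · simp [Cond.Holds, h6, hs.r0]; omega
    · have : j = n := by omega
      subst this
      simpa [addRow] using hs
  | succ m ih =>
    intro j E s hj h6 hs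
    have hbody : Run (.seq (.instr (.load 7 0 4))
        (.seq (.ite (.eq 7 5) (.seq (alloc 7 3 6 8) (alloc 2 7 2 8)) .skip)
        (.seq (.instr (.add 4 4 5)) (.instr (.add 6 6 5))))) s 14
        (fun s' => s'.reg 6 = j + 1 ∧ Reading A n i (i * n + (j + 1))
          (bif a i j then (i, j) :: E else E) s') := by
      refine Run.mono (Run.instr_seq (Run.seq (B := 11) (B' := 2) (Q := fun s' => s'.reg 6 = j ∧
        Reading A n i (i * n + j) (bif a i j then (i, j) :: E else E) s') ?_ ?_)) (by omega)
        (fun _ h => h)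
      · set t := (Instr.load 7 0 4).eval s with ht
        have f₀ : Frame 2 s t := Frame.setReg s _ le_rfl (by omega)
        have h7 : t.reg 7 = A (i * n + j) := by simp [ht, Instr.eval, hs.arr, hs.r4]
        have hr : ∀ r, r ≠ 7 → t.reg r = s.reg r := fun r h =>
          State.setReg_reg_ne _ _ h
        have hE : rep t (t.reg 2) E := by rw [hr 2 (by omega)]; exact Data.mono f₀ hs.r2
        refine Run.ite (fun hc => ?_) (fun hc => ?_)
        · have h1 : a i j = true := by
            rw [ha j (by omega), decide_eq_true_eq, ← h7]
            simpa [Cond.Holds, hr 5, hs.r5] using hc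
          refine Run.seq (B := 5) (B' := 5) (alloc_run (b := 2) le_rfl (by omega) (by omega)
            (by omega) t) ?_
          rintro s₁ ⟨f₁, h₁, h₂, h₃, h₄, h₅⟩
          refine (alloc_run (b := 2) le_rfl (by omega) (by omega)
            (by omega) s₁).mono le_rfl ?_
          rintro s₂ ⟨f₂, k₁, k₂, k₃, k₄, k₅⟩
          have hq : ∀ r, r = 0 ∨ r = 3 ∨ r = 4 ∨ r = 5 ∨ r = 6 → s₂.reg r = s.reg r := by
            intro r hr'
            rw [k₅ r (by omega) (by omega) (by omega), h₅ r (by omega) (by omega) (by omega),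
              hr r (by omega)]
          have hp1 := hs.r1
          have hp2 := f₀.hp
          have hp3 := f₁.hp
          have hp4 := f₂.hp
          refine ⟨by rw [hq 6 (by omega), h6], ?_, ?_, ?_, ?_, ?_, ?_, ?_⟩
          · rw [f₂.arr0, f₁.arr0, f₀.arr0, hs.arr]
          · rw [hq 0 (by omega), hs.r0]
          · omega
          · rw [h1]
            refine ⟨by omega, by omega, ?_, ?_⟩
            · rw [k₁, k₃, h₁]
              refine ⟨by omega, by omega, ?_, ?_⟩
              · rw [f₂.hd _ (by omega), h₃, hr 3 (by omega), hs.r3]; rfl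
              · rw [f₂.tl _ (by omega), h₄, hr 6 (by omega), h6]; rfl
            · rw [k₁, k₄, h₅ 2 (by omega) (by omega) (by omega)]
              exact Data.mono (α := List (ℕ × ℕ)) f₂ (Data.mono f₁ hE)
          · rw [hq 3 (by omega), hs.r3]
          · rw [hq 4 (by omega), hs.r4]
          · rw [hq 5 (by omega), hs.r5]
        · have h1 : a i j = false := by
            rw [ha j (by omega), decide_eq_false_iff_not, ← h7]
            simpa [Cond.Holds, hr 5, hs.r5] using hc
          refine Run.mono (Run.skip ?_) (by omega) (fun _ h => h)
          rw [h1]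
          exact ⟨by rw [hr 6 (by omega), h6], hs.arr, by rw [hr 0 (by omega), hs.r0],
            by rw [hr 1 (by omega)]; exact hs.r1, hE, by rw [hr 3 (by omega), hs.r3],
            by rw [hr 4 (by omega), hs.r4], by rw [hr 5 (by omega), hs.r5]⟩
      · rintro s₁ ⟨h6, h⟩
        have f₀ : Frame 2 s₁ ((Instr.add 6 6 5).eval ((Instr.add 4 4 5).eval s₁)) :=
          (Frame.setReg _ _ le_rfl (by omega)).trans (Frame.setReg _ _ le_rfl (by omega))
        refine Run.instr_seq (Run.instr ⟨?_, ?_, ?_, ?_, ?_, ?_, ?_, ?_⟩)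
        · simp [Instr.eval, State.setReg_reg_ne, h6, h.r5]
        · exact h.arr
        · simp [Instr.eval, State.setReg_reg_ne, h.r0]
        · simpa [Instr.eval, State.setReg_reg_ne] using h.r1
        · have := Data.mono f₀ h.r2
          simpa [Instr.eval, State.setReg_reg_ne] using this
        · simp [Instr.eval, State.setReg_reg_ne, h.r3]
        · simp [Instr.eval, State.setReg_reg_ne, h.r4, h.r5]; ring
        · simp [Instr.eval, State.setReg_reg_ne, h.r5]
    refine Run.mono (Run.while_true (B' := m * 15 + 1) ?_ hbody ?_) (by omega) (fun _ h => h)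
    · simp [Cond.Holds, h6, hs.r0]; omega
    · rintro s' ⟨h6', h'⟩
      refine (ih (j + 1) _ s' (by omega) h6' h').mono le_rfl fun s'' h'' => ?_
      simpa [addRow, List.range'_succ] using h''

theorem matrixLoop_run (A : ℕ → ℕ) (a : ℕ → ℕ → Bool) (n : ℕ)
    (ha : ∀ i < n, ∀ j < n, a i j = decide (A (i * n + j) = 1)) :
    ∀ (m i : ℕ) (E : List (ℕ × ℕ)) (s : State), i + m = n → Reading A n i (i * n) E s →
      Run matrixLoop s (m * (n * 15 + 4) + 1)
        (Reading A n n (n * n)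
          ((List.range' i m).foldl (fun E i => addRow a i (List.range n) E) E)) := by
  intro m
  induction m with
  | zero =>
    intro i E s hi hs
    refine Run.mono (Run.while_false ?_ ?_) (by omega) (fun _ h => h)
    · simp [Cond.Holds, hs.r3, hs.r0]; omega
    · have : i = n := by omega
      subst this
      simpa using hs
  | succ m ih =>
    intro i E s hi hs
    have f₀ : Frame 2 s ((Instr.const 6 0).eval s) := Frame.setReg _ _ le_rfl (by omega)
    refine Run.mono (Run.while_true (B' := m * (n * 15 + 4) + 1) ?_
      (Run.instr_seq (Run.seq (rowLoop_run A a n i (ha i (by omega)) n 0 E _ (by omega) ?_ ?_)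
      (B' := 1) (Q' := Reading A n (i + 1) ((i + 1) * n) (addRow a i (List.range n) E)) ?_)) ?_)
      (by simp only [add_mul]; omega) (fun _ h => h)
    · simp [Cond.Holds, hs.r3, hs.r0]; omega
    · simp [Instr.eval]
    · refine ⟨hs.arr, ?_, ?_, ?_, ?_, ?_, ?_⟩
      · simp [Instr.eval, State.setReg_reg_ne, hs.r0]
      · simpa [Instr.eval, State.setReg_reg_ne] using hs.r1
      · have := Data.mono f₀ hs.r2
        simpa [Instr.eval, State.setReg_reg_ne] using this
      · simp [Instr.eval, State.setReg_reg_ne, hs.r3]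
      · simp [Instr.eval, State.setReg_reg_ne, hs.r4]
      · simp [Instr.eval, State.setReg_reg_ne, hs.r5]
    · intro s₁ h
      have f₁ : Frame 2 s₁ ((Instr.add 3 3 5).eval s₁) := Frame.setReg _ _ le_rfl (by omega)
      rw [← List.range_eq_range'] at h
      refine Run.instr ⟨h.arr, ?_, ?_, ?_, ?_, ?_, ?_⟩
      · simp [Instr.eval, State.setReg_reg_ne, h.r0]
      · simpa [Instr.eval, State.setReg_reg_ne] using h.r1
      · have := Data.mono f₁ h.r2
        simpa [Instr.eval, State.setReg_reg_ne] using this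
      · simp [Instr.eval, h.r3, h.r5]
      · simp [Instr.eval, State.setReg_reg_ne, h.r4]; ring
      · simp [Instr.eval, State.setReg_reg_ne, h.r5]
    · intro s' h'
      refine (ih (i + 1) _ s' (by omega) h').mono le_rfl fun s'' h'' => ?_
      simpa [List.range'_succ] using h''

/-- Copies the list in register `3` into array `1`. -/
def writeLoop : Program :=
  .while (.lt 6 3) (.seq (.instr (.load 7 2 3)) (.seq (.instr (.store 1 4 7))
    (.seq (.instr (.load 3 3 3)) (.instr (.add 4 4 5)))))

theorem listRep_congr {s s' : State} (h1 : s'.reg 1 = s.reg 1) (h2 : s'.arr 2 = s.arr 2)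
    (h3 : s'.arr 3 = s.arr 3) : ∀ (l : List ℕ) {w : ℕ}, listRep s w l → listRep s' w l
  | [], _, h => h
  | _ :: l, w, ⟨c1, c2, c3, c4⟩ =>
    ⟨c1, by rwa [h1], by rw [h2]; exact c3, by rw [h3]; exact listRep_congr h1 h2 h3 l c4⟩

theorem writeLoop_run : ∀ (l : List ℕ) (j : ℕ) (s : State), listRep s (s.reg 3) l →
    s.reg 4 = j → s.reg 5 = 1 → s.reg 6 = 0 →
    Run writeLoop s (l.length * 5 + 1) (fun s' => s'.reg 0 = s.reg 0 ∧
      (∀ i < j, s'.arr 1 i = s.arr 1 i) ∧ ∀ i (h : i < l.length), s'.arr 1 (j + i) = l[i])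
  | [], j, s, hl, _, _, h6 => by
    have h3 : s.reg 3 = 0 := hl
    exact Run.mono (Run.while_false (by simp [Cond.Holds, h3, h6])
      ⟨rfl, fun _ _ => rfl, fun i h => by simp at h⟩) (by simp) (fun _ h => h)
  | x :: l, j, s, ⟨c1, c2, c3, c4⟩, h4, h5, h6 => by
    refine Run.mono (Run.while_true (B := 4) (B' := l.length * 5 + 1)
      (Q := fun s' => listRep s' (s'.reg 3) l ∧ s'.reg 4 = j + 1 ∧ s'.reg 5 = 1 ∧ s'.reg 6 = 0 ∧
        s'.reg 0 = s.reg 0 ∧ (∀ i < j, s'.arr 1 i = s.arr 1 i) ∧ s'.arr 1 j = x)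
      (by simp [Cond.Holds, h6]; exact c1)
      (Run.instr_seq (Run.instr_seq (Run.instr_seq (Run.instr ?_)))) ?_)
      (by simp only [List.length_cons, add_mul]; omega) (fun _ h => h)
    · have c3' : s.arr 2 (s.reg 3) = x := c3
      refine ⟨?_, ?_, ?_, ?_, ?_, ?_, ?_⟩
      · refine listRep_congr (s := s) ?_ ?_ ?_ l ?_
        · simp [Instr.eval, State.setReg_reg_ne]
        · funext p; simp [Instr.eval, State.setArr_arr]
        · funext p; simp [Instr.eval, State.setArr_arr]
        · simpa [Instr.eval, State.setReg_reg_ne, State.setArr_arr] using c4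
      · simp [Instr.eval, State.setReg_reg_ne, h4, h5]
      · simp [Instr.eval, State.setReg_reg_ne, h5]
      · simp [Instr.eval, State.setReg_reg_ne, h6]
      · simp [Instr.eval, State.setReg_reg_ne]
      · intro i hi
        simp [Instr.eval, State.setReg_reg_ne, State.setArr_arr, h4]; omega
      · simp [Instr.eval, State.setReg_reg_ne, State.setArr_arr, h4, c3']
    · rintro s' ⟨a1, a2, a3, a4, a5, a6, a7⟩
      refine (writeLoop_run l (j + 1) s' a1 a2 a3 a4).mono le_rfl ?_
      rintro s'' ⟨b1, b2, b3⟩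
      refine ⟨b1.trans a5, fun i hi => (b2 i (by omega)).trans (a6 i hi), fun i hi => ?_⟩
      rcases i with _ | i
      · simpa using (b2 j (by omega)).trans a7
      · have := b3 i (by simpa using hi)
        rw [show j + (i + 1) = j + 1 + i by omega]
        simpa using this

/-- A graph on `Fin n` as a list of pairs of numbers. -/
noncomputable def encode {n : ℕ} (G : SimpleGraph (Fin n)) : ℕ × List (ℕ × ℕ) :=
  (n, edgeList (fun u v => @decide (∃ i j : Fin n, u = i ∧ v = j ∧ G.Adj i j)
    (Classical.propDecidable _)) n)

theorem mem_encode {n : ℕ} {G : SimpleGraph (Fin n)} {u v : ℕ} :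
    (u, v) ∈ (encode G).2 ↔ ∃ i j : Fin n, u = i ∧ v = j ∧ G.Adj i j := by
  unfold encode
  rw [mem_edgeList]
  simp only [decide_eq_true_eq]
  constructor
  · exact fun h => h.2.2
  · rintro ⟨i, j, rfl, rfl, h⟩
    exact ⟨i.2, j.2, i, j, rfl, rfl, h⟩

/-- The index `u * n + v` with `v < n` determines `u` and `v` by division with remainder. -/
theorem inputState_arr {n : ℕ} (G : SimpleGraph (Fin n)) {u v : ℕ} (hv : v < n) :
    (inputState G).arr 0 (u * n + v) = 1 ↔ ∃ i j : Fin n, u = i ∧ v = j ∧ G.Adj i j := by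
  unfold inputState
  simp only [true_and, ite_eq_left_iff, zero_ne_one, imp_false, not_not]
  constructor
  · rintro ⟨i, j, h, hij⟩
    have hn : 0 < n := by omega
    refine ⟨i, j, ?_, ?_, hij⟩
    · have := congrArg (· / n) h
      simpa [Nat.add_div_of_dvd_right, Nat.mul_div_cancel _ hn, Nat.div_eq_of_lt hv,
        Nat.div_eq_of_lt j.2, Nat.add_comm, Nat.add_mul_div_right _ _ hn] using this
    · have := congrArg (· % n) h
      simpa [Nat.mod_eq_of_lt hv, Nat.mod_eq_of_lt j.2] using this
  · rintro ⟨i, j, rfl, rfl, h⟩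
    exact ⟨i, j, rfl, h⟩

/-- A polynomial-time function from edge lists to output lists yields a program. -/
theorem exists_program {f : ℕ × List (ℕ × ℕ) → ℕ × List ℕ} (hf : PC f) :
    ∃ (P : Program) (p : Polynomial ℕ), ∀ (n : ℕ) (G : SimpleGraph (Fin n)),
      Run P (inputState G) (p.eval n) (fun s => s.reg 0 = (f (encode G)).1 ∧
        ∀ i (h : i < (f (encode G)).2.length), s.arr 1 i = (f (encode G)).2[i]) := by
  obtain ⟨F, p, hp, hF⟩ := hf
  let e : Polynomial ℕ :=
    Polynomial.X + (Polynomial.X * Polynomial.X * (2 * Polynomial.X + 2) + 1) + 1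
  -- The heap pointer in register 1 starts at 1, so that address 0 is free to mean the empty list;
  -- register 5 holds the constant 1.
  refine ⟨.seq (.instr (.const 1 1)) (.seq (.instr (.const 5 1)) (.seq matrixLoop
    (.seq (alloc 2 0 2 3) (.seq (F 2) (.seq (.instr (.load 0 2 2)) (.seq (.instr (.load 3 3 2))
      (.seq (.instr (.const 4 0)) (.seq (.instr (.const 5 1)) (.seq (.instr (.const 6 0))
        writeLoop))))))))),
    (Polynomial.X * (Polynomial.X * 15 + 4) + 1) + (5 + (p.comp e + (p.comp e * 5 + 1 + 5))) + 2,
    fun n G => ?_⟩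
  have he : size (encode G) ≤ e.eval n := size_edgeList _ n
  simp only [Polynomial.eval_add, Polynomial.eval_mul, Polynomial.eval_X, Polynomial.eval_one,
    Polynomial.eval_ofNat, Polynomial.eval_comp]
  refine Run.instr_seq (Run.instr_seq (Run.seq (matrixLoop_run ((inputState G).arr 0)
    (fun u v => @decide (∃ i j : Fin n, u = i ∧ v = j ∧ G.Adj i j) (Classical.propDecidable _))
    n ?_ n 0 [] _ (by omega) ?_) ?_))
  · intro i hi j hj
    rw [decide_eq_decide]
    exact (inputState_arr G hj).symm
  · refine ⟨rfl, ?_, ?_, ?_, ?_, ?_, ?_⟩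
    · simp [Instr.eval, State.setReg_reg_ne, inputState]
    · simp [Instr.eval, State.setReg_reg_ne]
    · simp [Instr.eval, State.setReg_reg_ne, inputState]; rfl
    · simp [Instr.eval, State.setReg_reg_ne, inputState]
    · simp [Instr.eval, State.setReg_reg_ne, inputState]
    · simp [Instr.eval]
  intro s₁ h₁
  rw [← List.range_eq_range'] at h₁
  refine Run.seq (alloc_run (b := 2) le_rfl le_rfl (by omega) (by omega) s₁) ?_
  rintro s₂ ⟨f₂, k₁, k₂, k₃, k₄, -⟩
  refine Run.seq ((hF 2 le_rfl s₂ (encode G) (h₁.r1.trans f₂.hp) ⟨?_, ?_, ?_, ?_⟩).mono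
    (eval_mono p he) (fun _ h => h)) ?_
  · rw [k₁]; exact h₁.r1
  · rw [k₁, k₂]; exact Nat.lt_succ_self _
  · rw [k₁, k₃, h₁.r0]; rfl
  · rw [k₁, k₄]; exact Data.mono (α := List (ℕ × ℕ)) f₂ h₁.r2
  rintro s₃ ⟨f₃, c1, c2, c3, c4⟩
  refine Run.instr_seq (Run.instr_seq (Run.instr_seq (Run.instr_seq (Run.instr_seq
    ((writeLoop_run (f (encode G)).2 0 _ ?_ ?_ ?_ ?_).mono ?_ ?_)))))
  · refine listRep_congr (s := s₃) ?_ ?_ ?_ _ ?_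
    · simp [Instr.eval, State.setReg_reg_ne]
    · rfl
    · rfl
    · have c4' : listRep s₃ (s₃.arr 3 (s₃.reg 2)) (f (encode G)).2 := c4
      simpa [Instr.eval, State.setReg_reg_ne] using c4'
  · simp [Instr.eval, State.setReg_reg_ne]
  · simp [Instr.eval, State.setReg_reg_ne]
  · simp [Instr.eval]
  · have h1 := length_le_size (f (encode G)).2
    have h2 := (hp (encode G)).trans (eval_mono p he)
    rw [size_pair] at h2
    have h3 := Nat.mul_le_mul_right 5 (show (f (encode G)).2.length ≤ p.eval (e.eval n) by omega)
    omega
  · rintro s' ⟨d1, -, d3⟩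
    refine ⟨d1.trans ?_, fun i hi => by simpa using d3 i hi⟩
    have c3' : s₃.arr 2 (s₃.reg 2) = (f (encode G)).1 := c3
    simp [Instr.eval, State.setReg_reg_ne, c3']

end KHWP


namespace KHWP
open Data (size rep)

/-! ### The algorithm -/

/-- A graph: the number of vertices and the list of edges. -/
abbrev Inp := ℕ × List (ℕ × ℕ)

/-- A configuration as a list of vertices. -/
abbrev Cfg := List ℕ

def adjB (I : Inp) (u v : ℕ) : Bool := memB (u, v) I.2

def stepB (I : Inp) (u v : ℕ) : Bool := decide (u = v) || adjB I u v

/-- All lists of `j + 1` distinct vertices in which every vertex but the last is adjacent to a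
later one. -/
def cfgs (I : Inp) : ℕ → List Cfg
  | 0 => (List.range I.1).map fun v => [v]
  | j + 1 => (cfgs I j).flatMap fun C => ((List.range I.1).filter fun v =>
      !memB v C && C.any fun u => adjB I u v).map fun v => v :: C

/-- The orders of `D` in which the `j` agents of `C` can move to `D`. -/
def aligns (I : Inp) : ℕ → Cfg → Cfg → List Cfg
  | 0, _, _ => [[]]
  | j + 1, C, D => listCase C [] fun c C' => (D.filter fun d => stepB I c d).flatMap fun d =>
      (aligns I j C' (D.filter fun e => !decide (e = d))).map fun D' => d :: D'

/-- Adjacency of configurations up to a permutation of the agents. -/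
def uadj (I : Inp) (k : ℕ) (C D : Cfg) : Bool := !decide (aligns I k C D = [])

/-- A connected set occurs once for each of its growing orders; these copies are mutually adjacent,
being permutations of each other. For constant `k` there are polynomially many. -/
def nodes (I : Inp) (k : ℕ) : List Cfg := cfgs I (k - 1)

/-- All walks of `j + 1` configurations. -/
def walks (I : Inp) (k : ℕ) : ℕ → List (List Cfg)
  | 0 => (nodes I k).map fun C => [C]
  | j + 1 => (walks I k j).flatMap fun w =>
      ((nodes I k).filter fun D => uadj I k D (headOr w [])).map fun D => D :: w

def lastOr {α : Type} (l : List α) (d : α) : α := headOr l.reverse d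

def covB (W : List Cfg) (v : ℕ) : Bool := W.any fun C => memB v C

def covF (F : List (List Cfg)) (v : ℕ) : Bool := F.any fun W => covB W v

/-! ### Greedy covering by short walks -/

/-- The number of vertices that `w` covers and `F` does not. -/
def gain (I : Inp) (F : List (List Cfg)) (w : List Cfg) : ℕ :=
  ((List.range I.1).filter fun v => covB w v && !covF F v).length

/-- The walks of `l` configurations with the largest gain, if that is at least `t`. -/
def bestWalks (I : Inp) (k l t : ℕ) (F : List (List Cfg)) : List (List Cfg) :=
  (walks I k l).filter fun w => decide (t ≤ gain I F w) &&
    (walks I k l).all fun w' => decide (gain I F w' ≤ gain I F w)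

def greedyStep (I : Inp) (k l t : ℕ) (F : List (List Cfg)) : List (List Cfg) :=
  listCase (bestWalks I k l t F) F fun w _ => w :: F

/-- As many rounds as vertices suffice for `t ≥ 1`: a round either covers something new or leaves
`F` unchanged for good. -/
def greedy (I : Inp) (k l t : ℕ) (F : List (List Cfg)) : List (List Cfg) :=
  (greedyStep I k l t)^[I.1] F

/-! ### Cheap detours -/

/-- The ways to insert into `F` a closed walk of `j` steps with gain at least `g`. -/
def detours (I : Inp) (k j g : ℕ) (F : List (List Cfg)) : List (List (List Cfg)) :=
  (splits F).flatMap fun S => (splits S.2.1).flatMap fun R =>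
    ((walks I k j).filter fun w => decide (headOr w [] = R.2.1) && decide (lastOr w [] = R.2.1) &&
      decide (g ≤ gain I F w)).map fun w => S.1 ++ (R.1 ++ (w ++ R.2.2)) :: S.2.2

/-- The prices are 3/2 and 5/3 steps per new vertex, against 2 for a single visit. -/
def gadgetStep (I : Inp) (k : ℕ) (F : List (List Cfg)) : List (List Cfg) :=
  headOr (detours I k 3 2 F ++ detours I k 5 3 F) F

def gadgets (I : Inp) (k : ℕ) (F : List (List Cfg)) : List (List Cfg) :=
  (gadgetStep I k)^[I.1] F

/-! ### Joining loops and single visits into one walk -/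

/-- Insertions into `W` of a closed walk of `F` through an uncovered vertex. -/
def splices (I : Inp) (k : ℕ) (F : List (List Cfg)) (W : List Cfg) : List (List Cfg) :=
  (splits W).flatMap fun S => ((List.range I.1).filter fun v =>
    !covB W v && S.2.1.any fun u => adjB I u v).flatMap fun v =>
      F.flatMap fun Z => ((splits Z).filter fun R => memB v R.2.1).flatMap fun R =>
        ((walks I k (k + 1)).filter fun w =>
          decide (headOr w [] = S.2.1) && decide (lastOr w [] = R.2.1)).map fun w =>
            S.1 ++ (w ++ (R.2.2 ++ (R.1 ++ (w.reverse ++ S.2.2))))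

/-- Insertions into `W` of a step to an uncovered vertex and back. -/
def visits (I : Inp) (k : ℕ) (F : List (List Cfg)) (W : List Cfg) : List (List Cfg) :=
  (splits W).flatMap fun S => ((List.range I.1).filter fun v =>
    !covB W v && !covF F v).flatMap fun v =>
      ((walks I k 2).filter fun w => decide (headOr w [] = S.2.1) &&
        decide (lastOr w [] = S.2.1) && covB w v).map fun w => S.1 ++ (w ++ S.2.2)

def joinStep (I : Inp) (k : ℕ) (F : List (List Cfg)) (W : List Cfg) : List Cfg :=
  headOr (splices I k F W ++ visits I k F W) W

def join (I : Inp) (k : ℕ) (F : List (List Cfg)) : List Cfg :=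
  (joinStep I k F)^[I.1] [headOr (nodes I k) []]

/-! ### A tree through the ends of the walks -/

/-- The first element of a list, as a list. -/
def firstOf {α : Type} (l : List α) : List α := listCase l [] fun x _ => [x]

/-- The number of steps is not constant here, so listing all walks would be exponential; keeping one
walk per starting configuration bounds the table. -/
def tabStep (I : Inp) (k : ℕ) (T : List (List Cfg)) : List (List Cfg) :=
  (nodes I k).flatMap fun D => firstOf ((T.filter fun w => uadj I k D (headOr w [])).map
    fun w => D :: w)

/-- Walks with `i` steps to `C`, one from each configuration that has such a walk. -/
def tab (I : Inp) (k : ℕ) (C : Cfg) (i : ℕ) : List (List Cfg) := (tabStep I k)^[i] [[C]]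

/-- Shortest walks from a configuration in `T` to one that is already reached. -/
def links (I : Inp) (k : ℕ) (T : List Cfg) (st : List (List Cfg)) : List (List Cfg) :=
  (List.range (I.1 + I.1 + (2 * k + 10))).flatMap fun i =>
    (T.filter fun C => memB C (st.map fun w => headOr w [])).flatMap fun C =>
      (tab I k C i).filter fun w =>
        memB (headOr w []) T && !memB (headOr w []) (st.map fun w => headOr w [])

/-- `links` is ordered by increasing length, so its first entry is a shortest link, as in Prim's
algorithm. -/
def primStep (I : Inp) (k : ℕ) (T : List Cfg) (st : List (List Cfg)) : List (List Cfg) :=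
  listCase (links I k T st) st fun w _ => w :: st

/-- A spanning tree of the configurations in `T`, as a list of walks to the parents. -/
def prim (I : Inp) (k : ℕ) (T : List Cfg) : List (List Cfg) :=
  (primStep I k T)^[T.length] [[headOr T []]]

/-- The first component is the open walk waiting for a partner, or `[]` if there is none. In use
both walks end at the same configuration, hence the reversal. -/
def pairUp (c : List Cfg × List (List Cfg)) (w : List Cfg) : List Cfg × List (List Cfg) :=
  listCase c.1 (w, c.2) fun _ _ => ([], (c.1 ++ w.reverse) :: c.2)

/-- Joins open walks in pairs at the configuration `y`; one may be left over. -/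
def absorb (y : Cfg) (c : List Cfg × List (List Cfg)) (w : List Cfg) :
    List Cfg × List (List Cfg) :=
  bif decide (headOr w [] = lastOr w []) then (c.1, w :: c.2)
  else bif decide (lastOr w [] = y) then pairUp c w
  else bif decide (headOr w [] = y) then pairUp c w.reverse
  else (c.1, w :: c.2)

/-- Moves the ends of open walks from the start of `p` to its end. -/
def closeStep (O : List (List Cfg)) (p : List Cfg) : List (List Cfg) :=
  listCase (O.foldl (absorb (headOr p [])) ([], [])).1
    (O.foldl (absorb (headOr p [])) ([], [])).2
    fun _ _ => ((O.foldl (absorb (headOr p [])) ([], [])).1 ++ p) ::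
      (O.foldl (absorb (headOr p [])) ([], [])).2

/-- The ends of the walks in `F`. -/
def ends (F : List (List Cfg)) : List Cfg := F.flatMap fun w => [headOr w [], lastOr w []]

def closeUp (I : Inp) (k : ℕ) (F : List (List Cfg)) : List (List Cfg) :=
  (prim I k (ends F)).foldl closeStep F

/-- The default `D` never occurs along a walk, where an alignment exists. -/
def relabelStep (I : Inp) (k : ℕ) (acc : List Cfg) (D : Cfg) : List Cfg :=
  listCase acc [D] fun C _ => headOr (aligns I k C D) D :: acc

/-- Labels the agents along a walk; the result is in reverse order. -/
def relabel (I : Inp) (k : ℕ) (W : List Cfg) : List Cfg := W.foldl (relabelStep I k) []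

def output (I : Inp) (k : ℕ) (W : List Cfg) : ℕ × List ℕ :=
  (W.length - 1, (relabel I k W).reverse.flatMap fun C => C)

/-! ### The algorithm runs in polynomial time -/

section
variable {α β γ : Type} [Data α] [Data β] [Data γ]

@[fun_prop]
theorem PC.adjB {I : α → Inp} {u v : α → ℕ} (hI : PC I) (hu : PC u) (hv : PC v) :
    PC (fun x => adjB (I x) (u x) (v x)) := by unfold KHWP.adjB; fun_prop

@[fun_prop]
theorem PC.stepB {I : α → Inp} {u v : α → ℕ} (hI : PC I) (hu : PC u) (hv : PC v) :
    PC (fun x => stepB (I x) (u x) (v x)) := by unfold KHWP.stepB; fun_prop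

@[fun_prop]
theorem PC.cfgs {I : α → Inp} (j : ℕ) (hI : PC I) : PC (fun x => cfgs (I x) j) := by
  induction j with
  | zero => unfold KHWP.cfgs; fun_prop
  | succ j ih => unfold KHWP.cfgs; fun_prop

@[fun_prop]
theorem PC.nodes {I : α → Inp} (k : ℕ) (hI : PC I) : PC (fun x => nodes (I x) k) := by
  unfold KHWP.nodes; fun_prop

@[fun_prop]
theorem PC.aligns {α : Type} [Data α] {I : α → Inp} {C D : α → Cfg} (j : ℕ)
    (hI : PC I) (hC : PC C) (hD : PC D) : PC (fun x => aligns (I x) j (C x) (D x)) := by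
  induction j generalizing α with
  | zero => unfold KHWP.aligns; fun_prop
  | succ j ih =>
    have := ih (α := ((α × ℕ × Cfg) × ℕ)) (I := fun p => I p.1.1) (C := fun p => p.1.2.2)
      (D := fun p => (D p.1.1).filter fun e => !decide (e = p.2)) (by fun_prop) (by fun_prop)
      (by fun_prop)
    unfold KHWP.aligns; fun_prop

@[fun_prop]
theorem PC.uadj {I : α → Inp} {C D : α → Cfg} (k : ℕ) (hI : PC I) (hC : PC C) (hD : PC D) :
    PC (fun x => uadj (I x) k (C x) (D x)) := by unfold KHWP.uadj; fun_prop

@[fun_prop]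
theorem PC.walks {I : α → Inp} (k j : ℕ) (hI : PC I) : PC (fun x => walks (I x) k j) := by
  induction j with
  | zero => unfold KHWP.walks; fun_prop
  | succ j ih => unfold KHWP.walks; fun_prop

@[fun_prop]
theorem PC.lastOr {l : α → List β} {d : α → β} (hl : PC l) (hd : PC d) :
    PC (fun x => lastOr (l x) (d x)) := by unfold KHWP.lastOr; fun_prop

@[fun_prop]
theorem PC.covB {W : α → List Cfg} {v : α → ℕ} (hW : PC W) (hv : PC v) :
    PC (fun x => covB (W x) (v x)) := by unfold KHWP.covB; fun_prop

@[fun_prop]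
theorem PC.covF {F : α → List (List Cfg)} {v : α → ℕ} (hF : PC F) (hv : PC v) :
    PC (fun x => covF (F x) (v x)) := by unfold KHWP.covF; fun_prop

@[fun_prop]
theorem PC.gain {I : α → Inp} {F : α → List (List Cfg)} {w : α → List Cfg}
    (hI : PC I) (hF : PC F) (hw : PC w) : PC (fun x => gain (I x) (F x) (w x)) := by
  unfold KHWP.gain; fun_prop

@[fun_prop]
theorem PC.bestWalks {I : α → Inp} {F : α → List (List Cfg)} (k l t : ℕ) (hI : PC I)
    (hF : PC F) : PC (fun x => bestWalks (I x) k l t (F x)) := by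
  unfold KHWP.bestWalks; fun_prop

theorem mem_of_mem_bestWalks {I : Inp} {k l t : ℕ} {F : List (List Cfg)} {w : List Cfg}
    (h : w ∈ bestWalks I k l t F) : w ∈ walks I k l := (List.mem_filter.1 h).1

-- Each round adds one member of the fixed list `walks`, so the size grows by a bounded amount.
@[fun_prop]
theorem PC.greedy {I : α → Inp} {F : α → List (List Cfg)} (k l t : ℕ) (hI : PC I)
    (hF : PC F) : PC (fun x => greedy (I x) k l t (F x)) := by
  obtain ⟨p, hp⟩ := (PC.walks k l hI).size_bound
  refine PC.repeatN (g := fun x F => KHWP.greedyStep (I x) k l t F) hI.fst hF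
    (by unfold KHWP.greedyStep; fun_prop) (p + 1) fun x c => ?_
  unfold KHWP.greedyStep
  rcases h : KHWP.bestWalks (I x) k l t c with _ | ⟨w, ws⟩
  · simp
  · have h1 := size_le_of_mem (mem_of_mem_bestWalks (w := w) (by rw [h]; simp))
    have h2 := hp x
    simp only [listCase_cons, size_cons, Polynomial.eval_add, Polynomial.eval_one]
    omega

theorem headOr_cases {α : Type} (l : List α) (d : α) : headOr l d = d ∨ headOr l d ∈ l := by
  cases l <;> simp

@[fun_prop]
theorem PC.detours {I : α → Inp} {F : α → List (List Cfg)} (k j g : ℕ) (hI : PC I)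
    (hF : PC F) : PC (fun x => detours (I x) k j g (F x)) := by
  unfold KHWP.detours; fun_prop

theorem mem_detours {I : Inp} {k j g : ℕ} {F F' : List (List Cfg)} :
    F' ∈ detours I k j g F ↔ ∃ F₁ F₂ W₁ C W₂ w, F = F₁ ++ (W₁ ++ C :: W₂) :: F₂ ∧
      w ∈ walks I k j ∧ headOr w [] = C ∧ lastOr w [] = C ∧ g ≤ gain I F w ∧
      F' = F₁ ++ (W₁ ++ (w ++ W₂)) :: F₂ := by
  simp only [detours, List.mem_flatMap, List.mem_map, List.mem_filter, Bool.and_eq_true,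
    decide_eq_true_eq, Prod.exists, mem_splits]
  constructor
  · rintro ⟨F₁, W, F₂, rfl, W₁, C, W₂, rfl, w, ⟨h1, ⟨h2, h3⟩, h4⟩, rfl⟩
    exact ⟨F₁, F₂, W₁, C, W₂, w, rfl, h1, h2, h3, h4, rfl⟩
  · rintro ⟨F₁, F₂, W₁, C, W₂, w, rfl, h1, h2, h3, h4, rfl⟩
    exact ⟨F₁, _, F₂, rfl, W₁, C, W₂, rfl, w, ⟨h1, ⟨h2, h3⟩, h4⟩, rfl⟩

theorem size_of_mem_detours {I : Inp} {k j g : ℕ} {F F' : List (List Cfg)}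
    (h : F' ∈ detours I k j g F) : size F' ≤ size F + size (walks I k j) := by
  obtain ⟨F₁, F₂, W₁, C, W₂, w, rfl, hw, -, -, -, rfl⟩ := mem_detours.1 h
  have h1 := size_le_of_mem hw
  have h2 := size_append F₁ ((W₁ ++ C :: W₂) :: F₂)
  have h3 := size_append F₁ ((W₁ ++ (w ++ W₂)) :: F₂)
  have h4 := size_append W₁ (C :: W₂)
  have h5 := size_append W₁ (w ++ W₂)
  have h6 := size_append w W₂
  simp only [size_cons] at h2 h3 h4 h5 h6
  omega

@[fun_prop]
theorem PC.gadgets {I : α → Inp} {F : α → List (List Cfg)} (k : ℕ) (hI : PC I)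
    (hF : PC F) : PC (fun x => gadgets (I x) k (F x)) := by
  obtain ⟨p, hp⟩ := (PC.walks k 3 hI).size_bound
  obtain ⟨q, hq⟩ := (PC.walks k 5 hI).size_bound
  refine PC.repeatN (g := fun x F => KHWP.gadgetStep (I x) k F) hI.fst hF
    (by unfold KHWP.gadgetStep; fun_prop) (p + q) fun x c => ?_
  have h1 := hp x
  have h2 := hq x
  rw [Polynomial.eval_add]
  rcases headOr_cases (KHWP.detours (I x) k 3 2 c ++ KHWP.detours (I x) k 5 3 c) c with h | h
  · unfold KHWP.gadgetStep; rw [h]; omega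
  · rcases List.mem_append.1 h with h | h <;>
    · have := size_of_mem_detours h
      unfold KHWP.gadgetStep; omega

@[fun_prop]
theorem PC.splices {I : α → Inp} {F : α → List (List Cfg)} {W : α → List Cfg} (k : ℕ)
    (hI : PC I) (hF : PC F) (hW : PC W) : PC (fun x => splices (I x) k (F x) (W x)) := by
  unfold KHWP.splices; fun_prop

theorem mem_splices {I : Inp} {k : ℕ} {F : List (List Cfg)} {W W' : List Cfg} :
    W' ∈ splices I k F W ↔ ∃ W₁ C W₂ v Z₁ D Z₂ w u, W = W₁ ++ C :: W₂ ∧ v < I.1 ∧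
      covB W v = false ∧ u ∈ C ∧ adjB I u v = true ∧ (Z₁ ++ D :: Z₂) ∈ F ∧ v ∈ D ∧
      w ∈ walks I k (k + 1) ∧ headOr w [] = C ∧ lastOr w [] = D ∧
      W' = W₁ ++ (w ++ (Z₂ ++ (Z₁ ++ (w.reverse ++ W₂)))) := by
  simp only [splices, List.mem_flatMap, List.mem_map, List.mem_filter, Bool.and_eq_true,
    decide_eq_true_eq, Prod.exists, mem_splits, memB_iff, List.mem_range, List.any_eq_true,
    Bool.not_eq_true']
  constructor
  · rintro ⟨W₁, C, W₂, rfl, v, ⟨h1, h2, u, h3, h4⟩, Z, h5, Z₁, D, Z₂, ⟨rfl, h6⟩, w,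
      ⟨h7, h8, h9⟩, rfl⟩
    exact ⟨W₁, C, W₂, v, Z₁, D, Z₂, w, u, rfl, h1, h2, h3, h4, h5, h6, h7, h8, h9, rfl⟩
  · rintro ⟨W₁, C, W₂, v, Z₁, D, Z₂, w, u, rfl, h1, h2, h3, h4, h5, h6, h7, h8, h9, rfl⟩
    exact ⟨W₁, C, W₂, rfl, v, ⟨h1, h2, u, h3, h4⟩, _, h5, Z₁, D, Z₂, ⟨rfl, h6⟩, w,
      ⟨h7, h8, h9⟩, rfl⟩

@[fun_prop]
theorem PC.visits {I : α → Inp} {F : α → List (List Cfg)} {W : α → List Cfg} (k : ℕ)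
    (hI : PC I) (hF : PC F) (hW : PC W) : PC (fun x => visits (I x) k (F x) (W x)) := by
  unfold KHWP.visits; fun_prop

theorem mem_visits {I : Inp} {k : ℕ} {F : List (List Cfg)} {W W' : List Cfg} :
    W' ∈ visits I k F W ↔ ∃ W₁ D W₂ v w, W = W₁ ++ D :: W₂ ∧ v < I.1 ∧
      covB W v = false ∧ covF F v = false ∧ w ∈ walks I k 2 ∧ headOr w [] = D ∧
      lastOr w [] = D ∧ covB w v = true ∧ W' = W₁ ++ (w ++ W₂) := by
  simp only [visits, List.mem_flatMap, List.mem_map, List.mem_filter, Bool.and_eq_true,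
    Prod.exists, mem_splits, List.mem_range, Bool.not_eq_true', decide_eq_true_eq]
  constructor
  · rintro ⟨W₁, D, W₂, rfl, v, ⟨h1, h2, h3⟩, w, ⟨h4, ⟨h5, h6⟩, h7⟩, rfl⟩
    exact ⟨W₁, D, W₂, v, w, rfl, h1, h2, h3, h4, h5, h6, h7, rfl⟩
  · rintro ⟨W₁, D, W₂, v, w, rfl, h1, h2, h3, h4, h5, h6, h7, rfl⟩
    exact ⟨W₁, D, W₂, rfl, v, ⟨h1, h2, h3⟩, w, ⟨h4, ⟨h5, h6⟩, h7⟩, rfl⟩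

@[fun_prop]
theorem PC.join {I : α → Inp} {F : α → List (List Cfg)} (k : ℕ) (hI : PC I)
    (hF : PC F) : PC (fun x => join (I x) k (F x)) := by
  obtain ⟨p, hp⟩ := (PC.walks k (k + 1) hI).size_bound
  obtain ⟨q, hq⟩ := hF.size_bound
  obtain ⟨r, hr⟩ := (PC.walks k 2 hI).size_bound
  refine PC.repeatN (g := fun x W => KHWP.joinStep (I x) k (F x) W) hI.fst (by fun_prop)
    (by unfold KHWP.joinStep; fun_prop) (2 * p + q + r) fun x W => ?_
  have h1 := hp x
  have h2 := hq x
  have h3 := hr x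
  simp only [Polynomial.eval_add, Polynomial.eval_mul, Polynomial.eval_ofNat]
  rcases headOr_cases (KHWP.splices (I x) k (F x) W ++ KHWP.visits (I x) k (F x) W) W with h | h
  · unfold KHWP.joinStep; rw [h]; omega
  · unfold KHWP.joinStep
    rcases List.mem_append.1 h with h' | h'
    · obtain ⟨W₁, C, W₂, v, Z₁, D, Z₂, w, u, rfl, -, -, -, -, hZ, -, hw, -, -, e⟩ :=
        mem_splices.1 h'
      rw [e]
      have e1 := size_le_of_mem hw
      have e2 := size_le_of_mem hZ
      have e3 := size_append W₁ (C :: W₂)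
      have e4 := size_append W₁ (w ++ (Z₂ ++ (Z₁ ++ (w.reverse ++ W₂))))
      have e5 := size_append w (Z₂ ++ (Z₁ ++ (w.reverse ++ W₂)))
      have e6 := size_append Z₂ (Z₁ ++ (w.reverse ++ W₂))
      have e7 := size_append Z₁ (w.reverse ++ W₂)
      have e8 := size_append w.reverse W₂
      have e9 := size_reverse w
      have e10 := size_append Z₁ (D :: Z₂)
      simp only [size_cons] at e3 e10
      omega
    · obtain ⟨W₁, C, W₂, v, w, rfl, -, -, -, hw, -, -, -, e⟩ := mem_visits.1 h'
      rw [e]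
      have e1 := size_le_of_mem hw
      have e3 := size_append W₁ (C :: W₂)
      have e4 := size_append W₁ (w ++ W₂)
      have e5 := size_append w W₂
      simp only [size_cons] at e3
      omega

/-- Iterating a map while the size stays polynomially bounded. -/
theorem PC.repeatN_of_bound {m : α → ℕ} {i : α → γ} {g : α → γ → γ} (hm : PC m) (hi : PC i)
    (hg : PC (fun p : α × γ => g p.1 p.2)) (r : Polynomial ℕ)
    (hr : ∀ x, ∀ j ≤ m x, size ((g x)^[j] (i x)) ≤ r.eval (size x)) :
    PC (fun x => (g x)^[m x] (i x)) := by
  have e : ∀ (l : List ℕ) (g : γ → γ) (i : γ), l.foldl (fun c _ => g c) i = g^[l.length] i := by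
    intro l g i
    induction l generalizing i with
    | nil => rfl
    | cons a l ih => rw [List.foldl_cons, ih]; rfl
  have h : PC (fun x => (List.range (m x)).foldl (fun c _ => g x c) (i x)) := by
    refine PC.foldl_of_bound (g := fun x c _ => g x c) hm.range hi
      (hg.comp (f := fun p : α × γ × ℕ => (p.1, p.2.1)) (by fun_prop)) r fun x l₁ l₂ h => ?_
    rw [e]
    refine hr x _ ?_
    have := congrArg List.length h
    simp at this; omega
  simpa only [e, List.length_range] using h

@[fun_prop]
theorem PC.firstOf {l : α → List β} (hl : PC l) : PC (fun x => firstOf (l x)) := by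
  unfold KHWP.firstOf; fun_prop

theorem mem_of_mem_firstOf {α : Type} {l : List α} {x : α} (h : x ∈ firstOf l) : x ∈ l := by
  cases l with
  | nil => simp [firstOf] at h
  | cons y l => simp [firstOf] at h; simp [h]

theorem length_firstOf {α : Type} (l : List α) : (firstOf l).length ≤ 1 := by
  cases l <;> simp [firstOf]

theorem mem_tabStep {I : Inp} {k : ℕ} {T : List (List Cfg)} {w : List Cfg}
    (h : w ∈ tabStep I k T) : ∃ D ∈ nodes I k, ∃ w' ∈ T, uadj I k D (headOr w' []) = true ∧
      w = D :: w' := by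
  obtain ⟨D, hD, h⟩ := List.mem_flatMap.1 h
  obtain ⟨w', hw', rfl⟩ := List.mem_map.1 (mem_of_mem_firstOf h)
  obtain ⟨h1, h2⟩ := List.mem_filter.1 hw'
  exact ⟨D, hD, w', h1, h2, rfl⟩

theorem length_tab (I : Inp) (k : ℕ) (C : Cfg) (i : ℕ) :
    (tab I k C i).length ≤ size (nodes I k) + 1 := by
  cases i with
  | zero => simp [tab]
  | succ i =>
    rw [tab, Function.iterate_succ_apply', tabStep, List.length_flatMap]
    refine (List.sum_le_card_nsmul _ 1 ?_).trans ?_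
    · intro a ha
      obtain ⟨D, -, rfl⟩ := List.mem_map.1 ha
      exact length_firstOf _
    · have := length_le_size (nodes I k)
      simp; omega

/-- The table holds at most one walk per configuration, each with `i + 1` configurations. -/
theorem size_tab (I : Inp) (k : ℕ) (C : Cfg) (i : ℕ) :
    size (tab I k C i) ≤ (size (nodes I k) + 1) *
      ((i + 1) * (size (nodes I k) + size C + 1) + 2) + 1 := by
  have h2 : ∀ w ∈ tab I k C i, size w ≤ (i + 1) * (size (nodes I k) + size C + 1) + 1 := by
    induction i with
    | zero =>
      intro w hw
      simp [tab] at hw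
      subst hw
      simp [size_cons, size_nil]
    | succ i ih =>
      intro w hw
      rw [tab, Function.iterate_succ_apply'] at hw
      obtain ⟨D, hD, w', hw', -, rfl⟩ := mem_tabStep hw
      have := ih w' hw'
      have := size_le_of_mem hD
      rw [size_cons, add_mul _ 1]
      omega
  have h3 := size_list_le _ _ h2
  have h4 := Nat.mul_le_mul_right ((i + 1) * (size (nodes I k) + size C + 1) + 1 + 1)
    (length_tab I k C i)
  exact h3.trans (by simpa using h4)

@[fun_prop]
theorem PC.tab {I : α → Inp} {C : α → Cfg} {i : α → ℕ} (k : ℕ) (hI : PC I) (hC : PC C)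
    (hi : PC i) : PC (fun x => tab (I x) k (C x) (i x)) := by
  obtain ⟨p, hp⟩ := (PC.nodes k hI).size_bound
  obtain ⟨q, hq⟩ := hC.size_bound
  obtain ⟨r, hr⟩ := hi.size_bound
  refine PC.repeatN_of_bound (g := fun x T => KHWP.tabStep (I x) k T) hi (by fun_prop)
    (by unfold KHWP.tabStep; fun_prop)
    ((p + 1) * ((r + 1) * (p + q + 1) + 2) + 1) fun x j hj => ?_
  refine (size_tab (I x) k (C x) j).trans ?_
  simp only [Polynomial.eval_add, Polynomial.eval_mul, Polynomial.eval_one, Polynomial.eval_ofNat]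
  have := hp x
  have := hq x
  have h3 : j ≤ r.eval (size x) := hj.trans (hr x)
  gcongr

@[fun_prop]
theorem PC.links {I : α → Inp} {T : α → List Cfg} {st : α → List (List Cfg)} (k : ℕ)
    (hI : PC I) (hT : PC T) (hst : PC st) : PC (fun x => links (I x) k (T x) (st x)) := by
  unfold KHWP.links; fun_prop

theorem mem_links {I : Inp} {k : ℕ} {T : List Cfg} {st : List (List Cfg)} {w : List Cfg} :
    w ∈ links I k T st ↔ ∃ i < I.1 + I.1 + (2 * k + 10), ∃ C ∈ T,
      C ∈ st.map (fun w => headOr w []) ∧ w ∈ tab I k C i ∧ headOr w [] ∈ T ∧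
      headOr w [] ∉ st.map (fun w => headOr w []) := by
  simp only [links, List.mem_flatMap, List.mem_filter, List.mem_range, Bool.and_eq_true, memB_iff,
    Bool.not_eq_true', ← Bool.not_eq_true]
  constructor
  · rintro ⟨i, hi, C, ⟨h1, h2⟩, h3, h4, h5⟩
    exact ⟨i, hi, C, h1, h2, h3, h4, h5⟩
  · rintro ⟨i, hi, C, h1, h2, h3, h4, h5⟩
    exact ⟨i, hi, C, ⟨h1, h2⟩, h3, h4, h5⟩

@[fun_prop]
theorem PC.prim {I : α → Inp} {T : α → List Cfg} (k : ℕ) (hI : PC I) (hT : PC T) :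
    PC (fun x => prim (I x) k (T x)) := by
  -- Every link that can ever be chosen lies in this list, which does not depend on the tree built
  -- so far; hence each step adds a bounded amount.
  have hall : PC (fun x => (List.range ((I x).1 + (I x).1 + (2 * k + 10))).flatMap fun i =>
      (T x).flatMap fun C => KHWP.tab (I x) k C i) := by fun_prop
  obtain ⟨p, hp⟩ := hall.size_bound
  refine PC.repeatN (g := fun x st => KHWP.primStep (I x) k (T x) st) hT.length (by fun_prop)
    (by unfold KHWP.primStep; fun_prop) (p + 1) fun x st => ?_
  unfold KHWP.primStep
  rcases h : KHWP.links (I x) k (T x) st with _ | ⟨w, ws⟩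
  · simp
  · have h1 : w ∈ KHWP.links (I x) k (T x) st := by rw [h]; simp
    obtain ⟨i, hi, C, hC, -, hw, -⟩ := mem_links.1 h1
    have hm : w ∈ (List.range ((I x).1 + (I x).1 + (2 * k + 10))).flatMap fun i =>
        (T x).flatMap fun C => KHWP.tab (I x) k C i :=
      List.mem_flatMap.2 ⟨i, List.mem_range.2 hi, List.mem_flatMap.2 ⟨C, hC, hw⟩⟩
    have h2 := size_le_of_mem hm
    have h3 := hp x
    simp only [listCase_cons, size_cons, Polynomial.eval_add, Polynomial.eval_one]
    omega

@[fun_prop]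
theorem PC.pairUp {c : α → List Cfg × List (List Cfg)} {w : α → List Cfg} (hc : PC c)
    (hw : PC w) : PC (fun x => pairUp (c x) (w x)) := by
  unfold KHWP.pairUp; fun_prop

@[fun_prop]
theorem PC.absorb {y : α → Cfg} {c : α → List Cfg × List (List Cfg)} {w : α → List Cfg}
    (hy : PC y) (hc : PC c) (hw : PC w) : PC (fun x => absorb (y x) (c x) (w x)) := by
  unfold KHWP.absorb; fun_prop

theorem size_pairUp (c : List Cfg × List (List Cfg)) (w : List Cfg) :
    size (pairUp c w) ≤ size c + size w + 1 := by
  rcases c with ⟨u, O⟩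
  cases u with
  | nil => simp [pairUp, size_pair, size_nil]; omega
  | cons C u =>
    have h1 := size_append (C :: u) w.reverse
    have h2 := size_reverse w
    simp only [pairUp, listCase_cons, size_pair, size_nil, size_cons] at h1 ⊢
    simp only [List.cons_append, size_cons] at h1 ⊢
    omega

theorem size_absorb (y : Cfg) (c : List Cfg × List (List Cfg)) (w : List Cfg) :
    size (absorb y c w) ≤ size c + size w + 1 := by
  unfold absorb
  have h1 := size_pairUp c w
  have h2 := size_pairUp c w.reverse
  rw [size_reverse] at h2
  simp only [cond_eq_ite]
  split_ifs <;> simp only [size_pair, size_cons] at * <;> omega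

theorem size_foldl_absorb (y : Cfg) (O : List (List Cfg)) (c : List Cfg × List (List Cfg)) :
    size (O.foldl (absorb y) c) + 1 ≤ size c + size O := by
  induction O generalizing c with
  | nil => simp [size_nil]
  | cons w O ih =>
    have h1 := ih (absorb y c w)
    have h2 := size_absorb y c w
    rw [List.foldl_cons, size_cons]
    omega

@[fun_prop]
theorem PC.closeStep {O : α → List (List Cfg)} {p : α → List Cfg} (hO : PC O) (hp : PC p) :
    PC (fun x => closeStep (O x) (p x)) := by
  have h : PC (fun x => (O x).foldl (KHWP.absorb (KHWP.headOr (p x) [])) ([], [])) :=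
    PC.foldl (g := fun x c w => KHWP.absorb (KHWP.headOr (p x) []) c w) hO (by fun_prop)
      (by fun_prop) (Polynomial.X + 1) fun x c w _ => by
        have := size_absorb (KHWP.headOr (p x) []) c w
        simp; omega
  unfold KHWP.closeStep
  exact PC.listCase (g := fun x _ _ =>
    (((O x).foldl (KHWP.absorb (KHWP.headOr (p x) [])) ([], [])).1 ++ p x) ::
      ((O x).foldl (KHWP.absorb (KHWP.headOr (p x) [])) ([], [])).2) h.fst h.snd
    (((h.fst.append hp).cons h.snd).comp PC.id.fst)

theorem size_closeStep (O : List (List Cfg)) (p : List Cfg) :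
    size (closeStep O p) ≤ size O + size p + 1 := by
  have h := size_foldl_absorb (headOr p []) O ([], [])
  unfold closeStep
  rcases hc : O.foldl (absorb (headOr p [])) ([], []) with ⟨u, O'⟩
  rw [hc] at h
  cases u with
  | nil => simp only [size_pair, size_nil, listCase_nil] at h ⊢; omega
  | cons C u =>
    have := size_append (C :: u) p
    simp only [size_pair, size_nil, size_cons, List.cons_append, listCase_cons] at *
    omega

@[fun_prop]
theorem PC.closeUp {I : α → Inp} {F : α → List (List Cfg)} (k : ℕ) (hI : PC I) (hF : PC F) :
    PC (fun x => closeUp (I x) k (F x)) := by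
  unfold KHWP.closeUp KHWP.ends
  refine PC.foldl (g := fun _ O p => KHWP.closeStep O p) (by fun_prop) (by fun_prop)
    (by fun_prop) (Polynomial.X + 1) fun x O p _ => ?_
  have := size_closeStep O p
  simp; omega

/-- Each entry of `D` is deleted once it is used, so the entries of an alignment are charged to
different entries of `D`. -/
theorem size_of_mem_aligns {I : Inp} {j : ℕ} {C D D' : Cfg} (h : D' ∈ aligns I j C D) :
    size D' ≤ size D := by
  induction j generalizing C D D' with
  | zero =>
    simp [aligns] at h
    subst h
    simpa [size_nil] using one_le_size_list D
  | succ j ih =>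
    cases C with
    | nil => simp [aligns] at h
    | cons c C =>
      simp only [aligns, listCase_cons, List.mem_flatMap, List.mem_filter, List.mem_map] at h
      obtain ⟨d, ⟨hd, -⟩, D'', h1, rfl⟩ := h
      have h2 := ih h1
      have h3 : ∀ l : List ℕ, size (l.filter fun e => !decide (e = d)) ≤ size l := by
        intro l
        induction l with
        | nil => simp
        | cons a l ih => rw [List.filter_cons]; split_ifs <;> simp only [size_cons] <;> omega
      have h4 : ∀ l : List ℕ, d ∈ l →
          size (l.filter fun e => !decide (e = d)) + size d + 1 ≤ size l := by
        intro l
        induction l with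
        | nil => simp
        | cons a l ih =>
          intro hm
          by_cases hda : a = d
          · subst hda
            have := h3 l
            simp [size_cons] at this ⊢; omega
          · have := ih (by simpa [Ne.symm hda] using hm)
            simp [hda, size_cons] at this ⊢; omega
      have := h4 D hd
      rw [size_cons]; omega

@[fun_prop]
theorem PC.output {I : α → Inp} {W : α → List Cfg} (k : ℕ) (hI : PC I) (hW : PC W) :
    PC (fun x => output (I x) k (W x)) := by
  have h : PC (fun x => relabel (I x) k (W x)) := by
    unfold relabel
    refine PC.foldl (g := fun x acc D => relabelStep (I x) k acc D) hW (by fun_prop)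
      (by unfold relabelStep; fun_prop) (Polynomial.X + 1) fun x acc D _ => ?_
    unfold relabelStep
    cases acc with
    | nil => simp [size_cons, size_nil]; omega
    | cons C acc =>
      have : size (KHWP.headOr (KHWP.aligns (I x) k C D) D) ≤ size D := by
        rcases headOr_cases (KHWP.aligns (I x) k C D) D with h | h
        · rw [h]
        · exact size_of_mem_aligns h
      simp only [listCase_cons, size_cons, Polynomial.eval_add, Polynomial.eval_X,
        Polynomial.eval_one]
      omega
  unfold KHWP.output; fun_prop

end
end KHWP


namespace KHWP
open Data (size rep)

/-! ### Configurations as lists -/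

/-- The input describes a connected simple graph. -/
structure IsGraph (I : Inp) : Prop where
  symm : ∀ {u v}, adjB I u v = true → adjB I v u = true
  irrefl : ∀ {u v}, adjB I u v = true → u ≠ v
  lt : ∀ {u v}, adjB I u v = true → v < I.1
  cut : ∀ S : ℕ → Prop, (∃ u < I.1, S u) → (∃ v < I.1, ¬ S v) →
    ∃ u v, S u ∧ ¬ S v ∧ adjB I u v = true

/-- `Grow I C`: distinct vertices, each adjacent to a later one. -/
inductive Grow (I : Inp) : Cfg → Prop
  | single {v : ℕ} : v < I.1 → Grow I [v]
  | cons {C : Cfg} {u v : ℕ} : Grow I C → v < I.1 → v ∉ C → u ∈ C → adjB I u v = true →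
      Grow I (v :: C)

variable {I : Inp} {k : ℕ}

theorem Grow.ne_nil {C : Cfg} (h : Grow I C) : C ≠ [] := by cases h <;> simp

theorem Grow.nodup {C : Cfg} (h : Grow I C) : C.Nodup := by
  induction h with
  | single => simp
  | cons _ _ h _ _ ih => exact List.nodup_cons.2 ⟨h, ih⟩

theorem Grow.lt {C : Cfg} (h : Grow I C) : ∀ v ∈ C, v < I.1 := by
  induction h with
  | single h => simpa using h
  | cons _ h _ _ _ ih => simpa [h] using ih

theorem Grow.tail {v : ℕ} {C : Cfg} (h : Grow I (v :: C)) (hC : C ≠ []) : Grow I C := by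
  cases h with
  | single => exact absurd rfl hC
  | cons h => exact h

theorem Grow.suffix {B C : Cfg} (h : Grow I C) (hB : B ≠ []) (hs : B <:+ C) : Grow I B := by
  induction h with
  | single h =>
    rcases List.suffix_cons_iff.1 hs with rfl | hs
    · exact .single h
    · exact absurd (List.suffix_nil.1 hs) hB
  | cons h h1 h2 h3 h4 ih =>
    rcases List.suffix_cons_iff.1 hs with rfl | hs
    · exact .cons h h1 h2 h3 h4
    · exact ih hs

theorem mem_cfgs {j : ℕ} {C : Cfg} : C ∈ cfgs I j ↔ Grow I C ∧ C.length = j + 1 := by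
  induction j generalizing C with
  | zero =>
    simp only [cfgs, List.mem_map, List.mem_range]
    constructor
    · rintro ⟨v, h, rfl⟩; exact ⟨.single h, rfl⟩
    · rintro ⟨h, hl⟩
      cases h with
      | single h => exact ⟨_, h, rfl⟩
      | cons h => simp [h.ne_nil] at hl
  | succ j ih =>
    simp only [cfgs, List.mem_flatMap, List.mem_map, List.mem_filter, List.mem_range,
      Bool.and_eq_true, Bool.not_eq_true', List.any_eq_true, ← Bool.not_eq_true, memB_iff, ih]
    constructor
    · rintro ⟨C, ⟨h1, h2⟩, v, ⟨h3, h4, u, h5, h6⟩, rfl⟩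
      exact ⟨.cons h1 h3 h4 h5 h6, by simp [h2]⟩
    · rintro ⟨h, hl⟩
      cases h with
      | single h => simp at hl
      | cons h1 h3 h4 h5 h6 => exact ⟨_, ⟨h1, by simpa using hl⟩, _, ⟨h3, h4, _, h5, h6⟩, rfl⟩

/-- A connected set of vertices, in terms of cuts. -/
def ConnSet (I : Inp) (X : Finset ℕ) : Prop :=
  ∀ S : ℕ → Prop, (∃ u ∈ X, S u) → (∃ v ∈ X, ¬ S v) →
    ∃ u ∈ X, ∃ v ∈ X, S u ∧ ¬ S v ∧ adjB I u v = true

/-- A cut of `v :: C` either already cuts `C`, or has all of `C` on one side and `v` on the other,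
and then the edge `uv` crosses it. -/
theorem Grow.connSet (hI : IsGraph I) {C : Cfg} (h : Grow I C) : ConnSet I C.toFinset := by
  intro S
  simp only [List.mem_toFinset]
  induction h with
  | single => simp; grind
  | @cons C u v h1 h2 h3 h4 h5 ih =>
    have := hI.symm h5
    intro hu hv
    by_cases h6 : ∃ u ∈ C, S u
    · by_cases h7 : ∃ u ∈ C, ¬ S u
      · obtain ⟨a, ha, b, hb, h⟩ := ih h6 h7
        exact ⟨a, by simp [ha], b, by simp [hb], h⟩
      · push Not at h7
        exact ⟨u, by simp [h4], v, by simp, h7 u h4, by grind, h5⟩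
    · push Not at h6
      exact ⟨v, by simp, u, by simp [h4], by grind, h6 u h4, this⟩

/-- As long as `B` misses part of `X`, connectivity gives an edge inside `X` leaving `B`; its outer
end is put in front, so `B` stays a suffix. Thus a connected set can be listed with any chosen
growing part at the end. -/
theorem Grow.exists_extension {X : Finset ℕ} (hX : ConnSet I X) (hlt : ∀ v ∈ X, v < I.1)
    {B : Cfg} (hB : Grow I B) (hBX : B.toFinset ⊆ X) :
    ∃ D, Grow I D ∧ B <:+ D ∧ D.toFinset = X := by
  induction hn : (X \ B.toFinset).card generalizing B with
  | zero =>
    refine ⟨B, hB, List.suffix_rfl, hBX.antisymm ?_⟩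
    simpa [Finset.sdiff_eq_empty_iff_subset] using hn
  | succ n ih =>
    obtain ⟨v, hv⟩ : (X \ B.toFinset).Nonempty := by
      rw [← Finset.card_pos]; omega
    rw [Finset.mem_sdiff, List.mem_toFinset] at hv
    obtain ⟨b, hb⟩ := List.exists_mem_of_ne_nil B hB.ne_nil
    obtain ⟨x, hx, y, hy, h1, h2, h3⟩ := hX (· ∈ B) ⟨b, hBX (by simpa using hb), hb⟩ ⟨v, hv⟩
    have hsub : (y :: B).toFinset ⊆ X := by
      intro z hz
      rw [List.mem_toFinset, List.mem_cons] at hz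
      rcases hz with rfl | hz
      · exact hy
      · exact hBX (by simpa using hz)
    obtain ⟨D, hD, h4, h5⟩ := ih (.cons hB (hlt y hy) h2 h1 h3) hsub (by
      have : X \ (y :: B).toFinset = (X \ B.toFinset).erase y := by
        ext z; simp; tauto
      rw [this, Finset.card_erase_of_mem (by simp [hy, h2]), hn]; rfl)
    exact ⟨D, hD, (List.suffix_cons y B).trans h4, h5⟩

/-- Each agent stays or moves along an edge. -/
def Step (I : Inp) (u v : ℕ) : Prop := stepB I u v = true

theorem step_iff {u v : ℕ} : Step I u v ↔ u = v ∨ adjB I u v = true := by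
  simp [Step, stepB]

theorem Step.refl (u : ℕ) : Step I u u := step_iff.2 (Or.inl rfl)

theorem Step.symm (hI : IsGraph I) {u v : ℕ} (h : Step I u v) : Step I v u := by
  rw [step_iff] at *; exact h.imp Eq.symm hI.symm

/-- Adjacency of configurations up to the order of the agents. -/
def UAdj (I : Inp) (C D : Cfg) : Prop := Multiset.Rel (Step I) (C : Multiset ℕ) D

theorem uadj_of_forall₂ {C D : Cfg} (h : List.Forall₂ (Step I) C D) : UAdj I C D := by
  induction h with
  | nil => exact Multiset.Rel.zero
  | cons h _ ih => exact Multiset.Rel.cons h ih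

theorem UAdj.exists_perm {C D : Cfg} (h : UAdj I C D) :
    ∃ D', D'.Perm D ∧ List.Forall₂ (Step I) C D' := by
  induction C generalizing D with
  | nil =>
    have := Multiset.rel_zero_left.1 h
    simp at this
    exact ⟨[], by simp [this], .nil⟩
  | cons c C ih =>
    obtain ⟨d, D₁, h1, h2, h3⟩ := Multiset.rel_cons_left.1 (show Multiset.Rel (Step I) (c ::ₘ (C : Multiset ℕ)) D from h)
    induction D₁ using Quotient.inductionOn with
    | h D₁ =>
      obtain ⟨D', h4, h5⟩ := ih h2
      have h6 : D.Perm (d :: D₁) := Multiset.coe_eq_coe.1 h3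
      exact ⟨d :: D', (h4.cons d).trans h6.symm, .cons h1 h5⟩

theorem UAdj.of_perm {C D : Cfg} (h : C.Perm D) : UAdj I C D := by
  have : (C : Multiset ℕ) = D := Multiset.coe_eq_coe.2 h
  rw [UAdj, this]
  exact Multiset.rel_refl_of_refl_on fun x _ => .refl x

theorem UAdj.refl (C : Cfg) : UAdj I C C := .of_perm (List.Perm.refl C)

theorem UAdj.symm (hI : IsGraph I) {C D : Cfg} (h : UAdj I C D) : UAdj I D C := by
  have : flip (Step I) = Step I := by
    funext u v; exact propext ⟨Step.symm hI, Step.symm hI⟩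
  rw [UAdj, ← this]
  exact Multiset.rel_flip.2 h

theorem UAdj.perm_left {C C' D : Cfg} (h : UAdj I C D) (hC : C.Perm C') : UAdj I C' D := by
  rwa [UAdj, ← Multiset.coe_eq_coe.2 hC]

theorem UAdj.perm_right {C D D' : Cfg} (h : UAdj I C D) (hD : D.Perm D') : UAdj I C D' := by
  rwa [UAdj, ← Multiset.coe_eq_coe.2 hD]

theorem UAdj.cons {C D : Cfg} {c d : ℕ} (h : UAdj I C D) (hc : Step I c d) :
    UAdj I (c :: C) (d :: D) := Multiset.Rel.cons hc h

/-- Within a connected set, the empty place can be moved anywhere in one step. -/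
theorem Grow.slide {C : Cfg} (h : Grow I C) {z : ℕ} (hz : [z] <:+ C) {b : ℕ} (hb : b ∈ C) :
    UAdj I (C.erase b) (C.erase z) := by
  induction h generalizing b with
  | single =>
    have hz := hz.subset (List.mem_singleton_self z)
    rw [List.mem_singleton] at hb hz
    subst hb; subst hz; exact .refl _
  | @cons C u v h1 h2 h3 h4 h5 ih =>
    have hz' : [z] <:+ C := by
      rcases List.suffix_cons_iff.1 hz with h | h
      · simp at h; exact absurd h.2 h1.ne_nil
      · exact h
    have hzC := hz'.subset (List.mem_singleton_self z)
    have hvz : v ≠ z := fun h => h3 (h ▸ hzC)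
    rw [List.erase_cons_tail (a := z) (b := v) (by simpa using hvz)]
    -- If the empty place is at `v`, the agent at `u` moves to `v` and the empty place at `u` is
    -- passed on by induction. The moves happen simultaneously along a chain of later neighbours
    -- ending at `z`.
    by_cases hbv : b = v
    · subst hbv
      rw [List.erase_cons_head]
      exact ((ih hz' h4).cons (step_iff.2 (Or.inr h5))).perm_left (List.perm_cons_erase h4).symm
    · rw [List.erase_cons_tail (a := b) (b := v) (by simpa using Ne.symm hbv)]
      exact (ih hz' (by simpa [hbv] using hb)).cons (.refl v)

/-- A configuration of `k` agents, listed so that it grows. -/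
def IsNode (I : Inp) (k : ℕ) (C : Cfg) : Prop := Grow I C ∧ C.length = k

theorem mem_nodes (hk : 1 ≤ k) {C : Cfg} : C ∈ nodes I k ↔ IsNode I k C := by
  rw [nodes, mem_cfgs, IsNode, Nat.sub_add_cancel hk]

theorem Grow.perm_of_subset {B C : Cfg} (hB : Grow I B) (h : B ⊆ C)
    (hl : C.length ≤ B.length) : B.Perm C :=
  (List.subperm_of_subset hB.nodup h).perm_of_length_le hl

/-- Moving to a configuration with a new vertex `v`, while some vertices stay occupied. -/
theorem IsNode.exists_move (hI : IsGraph I) {C : Cfg} (hC : IsNode I k C) {u v : ℕ} (hu : u ∈ C)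
    (huv : adjB I u v = true) (hv : v ∉ C) {B : Cfg} (hB : Grow I B) (hBC : B ⊆ v :: C)
    (hBk : B.length ≤ k) :
    ∃ D z, IsNode I k D ∧ B <:+ D ∧ (z :: D).Perm (v :: C) ∧ UAdj I C D := by
  have hX : Grow I (v :: C) := .cons hC.1 (hI.lt huv) hv hu huv
  obtain ⟨E, hE, h1, h2⟩ := Grow.exists_extension (hX.connSet hI)
    (fun x hx => hX.lt x (by simpa using hx)) hB (fun x hx => by
      rw [List.mem_toFinset] at *; exact hBC hx)
  have hp : E.Perm (v :: C) := List.perm_of_nodup_nodup_toFinset_eq hE.nodup hX.nodup h2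
  -- The first vertex `z` of a growing list can be vacated: what remains still grows, and it keeps
  -- `B`, since `B` is too short to be all of `E`.
  cases E with
  | nil => exact absurd rfl hE.ne_nil
  | cons z D =>
    have hlen : D.length = k := by simpa [hC.2] using hp.length_eq
    have h3 : B <:+ D := by
      rcases List.suffix_cons_iff.1 h1 with rfl | h
      · simp at hBk; omega
      · exact h
    have hD : Grow I D := hE.tail fun h => hB.ne_nil (List.suffix_nil.1 (h ▸ h3))
    refine ⟨D, z, ⟨hD, hlen⟩, h3, hp, ?_⟩
    -- The same set is listed again with `z` at the end, as `Grow.slide` requires to move the empty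
    -- place from `v` to `z`.
    obtain ⟨F, hF, h4, h5⟩ := Grow.exists_extension (hX.connSet hI)
      (fun x hx => hX.lt x (by simpa using hx)) (.single (hE.lt z (by simp)))
      (B := [z]) (fun x hx => by
        rw [List.mem_toFinset] at *
        exact hp.subset (by simp at hx; simp [hx]))
    have hFp : F.Perm (v :: C) := List.perm_of_nodup_nodup_toFinset_eq hF.nodup hX.nodup h5
    refine (hF.slide h4 (hFp.symm.subset List.mem_cons_self)).perm_left ?_ |>.perm_right ?_
    · simpa using hFp.erase v
    · have := (hFp.trans hp.symm).erase z
      simpa using this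

/-- List all vertices growing from `v`, which comes last; the final `k` entries are a configuration.
-/
theorem exists_node (hI : IsGraph I) (hk : 1 ≤ k) (hn : k ≤ I.1) {v : ℕ} (hv : v < I.1) :
    ∃ C, IsNode I k C ∧ v ∈ C := by
  obtain ⟨D, hD, h1, h2⟩ := Grow.exists_extension (X := Finset.range I.1) (I := I) (B := [v])
    (fun S ⟨u, hu, hSu⟩ ⟨w, hw, hSw⟩ => by
      obtain ⟨a, b, h1, h2, h3⟩ := hI.cut S ⟨u, by simpa using hu, hSu⟩ ⟨w, by simpa using hw, hSw⟩
      exact ⟨a, by simpa using hI.lt (hI.symm h3), b, by simpa using hI.lt h3, h1, h2, h3⟩)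
    (by simp) (.single hv) (by simpa using hv)
  have hl : D.length = I.1 := by
    rw [← List.toFinset_card_of_nodup hD.nodup, h2, Finset.card_range]
  have hs := List.drop_suffix (D.length - k) D
  have hlen : (D.drop (D.length - k)).length = k := by simp; omega
  refine ⟨D.drop (D.length - k), ⟨hD.suffix ?_ hs, hlen⟩, ?_⟩
  · intro h; rw [h] at hlen; simp at hlen; omega
  · have := List.suffix_of_suffix_length_le h1 hs (by simp; omega)
    exact this.subset (by simp)

/-! ### Alignment of configurations -/

theorem mem_aligns {j : ℕ} {C D D' : Cfg} (hC : C.length = j) (hD : D.Nodup)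
    (hl : D.length = j) : D' ∈ aligns I j C D ↔ D'.Perm D ∧ List.Forall₂ (Step I) C D' := by
  induction j generalizing C D D' with
  | zero =>
    simp only [List.length_eq_zero_iff] at hC hl
    subst hC; subst hl
    simp [aligns]
  | succ j ih =>
    cases C with
    | nil => simp at hC
    | cons c C =>
      simp only [aligns, listCase_cons, List.mem_flatMap, List.mem_filter, List.mem_map]
      have key : ∀ d ∈ D, D.filter (fun e => !decide (e = d)) = D.erase d := fun d _ => by
        rw [hD.erase_eq_filter]; congr 1
      constructor
      · rintro ⟨d, ⟨hd, hs⟩, D'', h1, rfl⟩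
        rw [key d hd, ih (by simpa using hC) (hD.erase d)
          (by rw [List.length_erase_of_mem hd, hl]; rfl)] at h1
        exact ⟨(h1.1.cons d).trans (List.perm_cons_erase hd).symm, .cons hs h1.2⟩
      · rintro ⟨h1, h2⟩
        cases h2 with
        | @cons _ d _ D'' hs h2 =>
          have hd : d ∈ D := h1.subset List.mem_cons_self
          refine ⟨d, ⟨hd, hs⟩, D'', ?_, rfl⟩
          rw [key d hd, ih (by simpa using hC) (hD.erase d)
            (by rw [List.length_erase_of_mem hd, hl]; rfl)]
          exact ⟨by simpa using h1.erase d, h2⟩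

theorem uadj_iff {C D : Cfg} (hC : IsNode I k C) (hD : IsNode I k D) :
    uadj I k C D = true ↔ UAdj I C D := by
  have hm := fun D' => mem_aligns (I := I) (D' := D') hC.2 hD.1.nodup hD.2
  rw [uadj, Bool.not_eq_true', decide_eq_false_iff_not]
  constructor
  · intro h
    obtain ⟨D', hD'⟩ := List.exists_mem_of_ne_nil _ h
    obtain ⟨h1, h2⟩ := (hm D').1 hD'
    exact (uadj_of_forall₂ h2).perm_right h1
  · intro h h0
    obtain ⟨D', h1⟩ := h.exists_perm
    have := (hm D').2 h1
    simp [h0] at this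

/-! ### Walks -/

structure IsWalk (I : Inp) (k : ℕ) (w : List Cfg) : Prop where
  ne_nil : w ≠ []
  node : ∀ C ∈ w, IsNode I k C
  chain : w.IsChain (UAdj I)

@[simp] theorem lastOr_nil {α : Type} (d : α) : lastOr [] d = d := rfl

@[simp] theorem lastOr_concat {α : Type} (l : List α) (x d : α) : lastOr (l ++ [x]) d = x := by
  simp [lastOr]

@[simp] theorem lastOr_singleton {α : Type} (x d : α) : lastOr [x] d = x := rfl

@[simp] theorem lastOr_cons_cons {α : Type} (x y : α) (l : List α) (d : α) :
    lastOr (x :: y :: l) d = lastOr (y :: l) d := by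
  rcases List.eq_nil_or_concat' (y :: l) with h | ⟨l', z, h⟩
  · simp at h
  · rw [h, ← List.cons_append, lastOr_concat, lastOr_concat]

@[simp] theorem lastOr_reverse {α : Type} (l : List α) (d : α) :
    lastOr l.reverse d = headOr l d := by simp [lastOr]

@[simp] theorem headOr_reverse {α : Type} (l : List α) (d : α) :
    headOr l.reverse d = lastOr l d := rfl

theorem headOr_append {α : Type} {l : List α} (h : l ≠ []) (l' : List α) (d : α) :
    headOr (l ++ l') d = headOr l d := by
  cases l with
  | nil => exact absurd rfl h
  | cons => rfl

theorem lastOr_append {α : Type} (l : List α) {l' : List α} (h : l' ≠ []) (d : α) :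
    lastOr (l ++ l') d = lastOr l' d := by
  rw [lastOr, List.reverse_append, headOr_append (by simpa using h), lastOr]

theorem lastOr_mem {α : Type} {l : List α} (d : α) (h : l ≠ []) : lastOr l d ∈ l := by
  have := headOr_mem (l := l.reverse) d (by simpa using h)
  rwa [List.mem_reverse] at this

theorem eq_headOr_cons {α : Type} {l : List α} (h : l ≠ []) (d : α) :
    ∃ t, l = headOr l d :: t := by
  cases l with
  | nil => exact absurd rfl h
  | cons x t => exact ⟨t, rfl⟩

theorem eq_concat_lastOr {α : Type} {l : List α} (h : l ≠ []) (d : α) :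
    ∃ t, l = t ++ [lastOr l d] := by
  rcases List.eq_nil_or_concat' l with h' | ⟨t, x, rfl⟩
  · exact absurd h' h
  · exact ⟨t, by simp⟩

theorem mem_walks (hk : 1 ≤ k) {j : ℕ} {w : List Cfg} :
    w ∈ walks I k j ↔ IsWalk I k w ∧ w.length = j + 1 := by
  induction j generalizing w with
  | zero =>
    simp only [walks, List.mem_map, mem_nodes hk]
    constructor
    · rintro ⟨C, h, rfl⟩; exact ⟨⟨by simp, by simpa using h, by simp⟩, rfl⟩
    · rintro ⟨h, hl⟩
      obtain ⟨C, rfl⟩ := List.length_eq_one_iff.1 hl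
      exact ⟨C, h.node C (by simp), rfl⟩
  | succ j ih =>
    simp only [walks, List.mem_flatMap, List.mem_map, List.mem_filter, ih, mem_nodes hk]
    constructor
    · rintro ⟨w, ⟨h1, h2⟩, D, ⟨h3, h4⟩, rfl⟩
      cases w with
      | nil => exact absurd rfl h1.ne_nil
      | cons C w =>
        rw [headOr_cons, uadj_iff h3 (h1.node C (by simp))] at h4
        exact ⟨⟨by simp, by simpa [h3] using h1.node, List.isChain_cons_cons.2 ⟨h4, h1.chain⟩⟩,
          by simp [← h2]⟩
    · rintro ⟨h, hl⟩
      match w, hl with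
      | D :: C :: w, hl =>
        have hc := List.isChain_cons_cons.1 h.chain
        have hD := h.node D (by simp)
        have hC := h.node C (by simp)
        exact ⟨C :: w, ⟨⟨by simp, fun E hE => h.node E (by simp [hE]), hc.2⟩, by simpa using hl⟩,
          D, ⟨hD, by rw [headOr_cons, uadj_iff hD hC]; exact hc.1⟩, rfl⟩

theorem IsWalk.single {C : Cfg} (h : IsNode I k C) : IsWalk I k [C] :=
  ⟨by simp, by simpa using h, by simp⟩

theorem IsWalk.reverse (hI : IsGraph I) {w : List Cfg} (h : IsWalk I k w) :
    IsWalk I k w.reverse :=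
  ⟨by simpa using h.ne_nil, by simpa using h.node,
    List.isChain_reverse.2 (h.chain.imp fun _ _ h => h.symm hI)⟩

theorem IsWalk.append {w w' : List Cfg} (h : IsWalk I k w) (h' : IsWalk I k w')
    (hj : UAdj I (lastOr w []) (headOr w' [])) : IsWalk I k (w ++ w') := by
  refine ⟨by simp [h.ne_nil], fun C hC => ?_, ?_⟩
  · rcases List.mem_append.1 hC with hC | hC
    exacts [h.node C hC, h'.node C hC]
  · obtain ⟨t, ht⟩ := eq_concat_lastOr h.ne_nil []
    obtain ⟨t', ht'⟩ := eq_headOr_cons h'.ne_nil []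
    rw [List.isChain_append]
    refine ⟨h.chain, h'.chain, fun x hx y hy => ?_⟩
    rw [ht] at hx; rw [ht'] at hy
    simp at hx hy
    subst hx; subst hy; exact hj

theorem IsWalk.left {w w' : List Cfg} (h : IsWalk I k (w ++ w')) (hw : w ≠ []) :
    IsWalk I k w :=
  ⟨hw, fun C hC => h.node C (by simp [hC]), (List.isChain_append.1 h.chain).1⟩

theorem IsWalk.right {w w' : List Cfg} (h : IsWalk I k (w ++ w')) (hw : w' ≠ []) :
    IsWalk I k w' :=
  ⟨hw, fun C hC => h.node C (by simp [hC]), (List.isChain_append.1 h.chain).2.1⟩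

theorem IsWalk.uadj {w w' : List Cfg} (h : IsWalk I k (w ++ w')) (hw : w ≠ [])
    (hw' : w' ≠ []) : UAdj I (lastOr w []) (headOr w' []) := by
  obtain ⟨t, ht⟩ := eq_concat_lastOr hw []
  obtain ⟨t', ht'⟩ := eq_headOr_cons hw' []
  refine (List.isChain_append.1 h.chain).2.2 _ ?_ _ ?_
  · rw [ht]; simp
  · rw [ht']; simp

/-- Inserting a closed walk. -/
theorem IsWalk.insert {W₁ W₂ w : List Cfg} {C : Cfg} (h : IsWalk I k (W₁ ++ C :: W₂))
    (hw : IsWalk I k w) (h1 : headOr w [] = C) (h2 : lastOr w [] = C) :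
    IsWalk I k (W₁ ++ (w ++ W₂)) := by
  have hr : IsWalk I k (w ++ W₂) := by
    rcases eq_or_ne W₂ [] with rfl | hW
    · simpa using hw
    · have := h.right (List.cons_ne_nil _ _)
      refine hw.append (IsWalk.right (w := [C]) this hW) ?_
      rw [h2]; simpa using IsWalk.uadj (w := [C]) this (by simp) hW
  rcases eq_or_ne W₁ [] with rfl | hW
  · simpa using hr
  · refine (h.left hW).append hr ?_
    rw [headOr_append hw.ne_nil, h1]
    simpa using h.uadj hW (by simp)

/-! ### Distances between configurations -/

/-- `Reach I k j C D`: there is a walk of `j` steps from `C` to `D`. -/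
def Reach (I : Inp) (k j : ℕ) (C D : Cfg) : Prop :=
  ∃ w, IsWalk I k w ∧ w.length = j + 1 ∧ headOr w [] = C ∧ lastOr w [] = D

theorem Reach.refl {C : Cfg} (h : IsNode I k C) : Reach I k 0 C C := ⟨[C], .single h, by simp⟩

theorem Reach.cons {j : ℕ} {C D E : Cfg} (hC : IsNode I k C) (h : UAdj I C D)
    (h' : Reach I k j D E) : Reach I k (j + 1) C E := by
  obtain ⟨w, h1, h2, h3, h4⟩ := h'
  refine ⟨[C] ++ w, (IsWalk.single hC).append h1 (by simpa [h3] using h), by simp [h2], by simp, ?_⟩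
  rw [lastOr_append _ h1.ne_nil, h4]

theorem reach_succ {j : ℕ} {C E : Cfg} (h : Reach I k (j + 1) C E) :
    ∃ D, IsNode I k C ∧ UAdj I C D ∧ Reach I k j D E := by
  obtain ⟨w, h1, h2, h3, h4⟩ := h
  match w, h2 with
  | A :: B :: w, h2 =>
    obtain rfl : A = C := by simpa using h3
    refine ⟨B, h1.node A (by simp), (List.isChain_cons_cons.1 h1.chain).1, B :: w,
      IsWalk.right (w := [A]) h1 (by simp), by simpa using h2, by simp, by simpa using h4⟩

theorem Reach.symm (hI : IsGraph I) {j : ℕ} {C D : Cfg} (h : Reach I k j C D) :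
    Reach I k j D C := by
  obtain ⟨w, h1, h2, h3, h4⟩ := h
  exact ⟨w.reverse, h1.reverse hI, by simpa using h2, by simpa using h4, by simpa using h3⟩

theorem Reach.trans {i j : ℕ} {C D E : Cfg} (h : Reach I k i C D) (h' : Reach I k j D E) :
    Reach I k (i + j) C E := by
  induction i generalizing C with
  | zero =>
    obtain ⟨w, h1, h2, h3, h4⟩ := h
    obtain ⟨A, rfl⟩ := List.length_eq_one_iff.1 h2
    simp at h3 h4
    subst h3; subst h4
    simpa using h'
  | succ i ih =>
    obtain ⟨B, h1, h2, h3⟩ := reach_succ h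
    rw [Nat.succ_add]
    exact .cons h1 h2 (ih h3)

theorem Reach.left {i : ℕ} {C D : Cfg} (h : Reach I k i C D) : IsNode I k C := by
  obtain ⟨w, h1, h2, h3, h4⟩ := h
  exact h3 ▸ h1.node _ (headOr_mem _ h1.ne_nil)

theorem Reach.right {i : ℕ} {C D : Cfg} (h : Reach I k i C D) : IsNode I k D := by
  obtain ⟨w, h1, h2, h3, h4⟩ := h
  exact h4 ▸ h1.node _ (lastOr_mem _ h1.ne_nil)

theorem Reach.mono {i j : ℕ} {C D : Cfg} (h : Reach I k i C D) (hij : i ≤ j) :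
    Reach I k j C D := by
  obtain ⟨d, rfl⟩ := Nat.exists_eq_add_of_le' hij
  clear hij
  induction d with
  | zero => simpa using h
  | succ d ih => rw [Nat.succ_add]; exact .cons h.left (.refl C) ih

theorem Reach.of_uadj {C D : Cfg} (hC : IsNode I k C) (hD : IsNode I k D) (h : UAdj I C D) :
    Reach I k 1 C D := .cons hC h (.refl hD)

/-- Configurations with a common vertex are at distance at most `k`. -/
theorem Reach.of_mem (hI : IsGraph I) {C D : Cfg} (hC : IsNode I k C) (hD : IsNode I k D)
    {v : ℕ} (hv : v ∈ C) (hv' : v ∈ D) : Reach I k k C D := by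
  obtain ⟨E, hE, h1, h2⟩ := Grow.exists_extension (hD.1.connSet hI)
    (fun x hx => hD.1.lt x (by simpa using hx)) (.single (hD.1.lt v hv'))
    (B := [v]) (by simpa using hv')
  have hp : E.Perm D := List.perm_of_nodup_nodup_toFinset_eq hE.nodup hD.1.nodup h2
  have hlen : E.length = k := hp.length_eq.trans hD.2
  -- `D` is listed outwards from `v`. Each step takes in the next vertex of this list and keeps the
  -- earlier ones, so after `k - 1` steps the right set is occupied; one further step changes its
  -- order into that of `D`.
  have key : ∀ B, Grow I B → B <:+ E → [v] <:+ B →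
      ∃ A, B ⊆ A ∧ Reach I k (B.length - 1) C A := by
    intro B hB
    induction hB with
    | single =>
      intro _ h
      have h := h.subset (List.mem_singleton_self v)
      rw [List.mem_singleton] at h
      subst h
      exact ⟨C, by simpa using hv, .refl hC⟩
    | @cons B u x g1 g2 g3 g4 g5 ih =>
      intro h3 h4
      obtain ⟨A, h5, h6⟩ := ih ((List.suffix_cons x B).trans h3) (by
        rcases List.suffix_cons_iff.1 h4 with h | h
        · simp at h; exact absurd h.2 g1.ne_nil
        · exact h)
      have hBl : (x :: B).length - 1 = B.length - 1 + 1 := by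
        have := List.length_pos_iff.2 g1.ne_nil
        simp; omega
      rw [hBl]
      by_cases hx : x ∈ A
      · exact ⟨A, by simpa [hx] using h5, h6.mono (by omega)⟩
      · obtain ⟨A', z, h7, h8, h9, h10⟩ := h6.right.exists_move hI (h5 g4) g5 hx
          (.cons g1 g2 g3 g4 g5) (List.cons_subset_cons x h5) (by
            have := h3.length_le; omega)
        exact ⟨A', h8.subset, h6.trans (.of_uadj h6.right h7 h10)⟩
  obtain ⟨A, h3, h4⟩ := key E hE List.suffix_rfl h1
  have h5 : E.Perm A := hE.perm_of_subset h3 (by rw [hlen, h4.right.2])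
  have h6 := h4.trans (.of_uadj h4.right hD (.of_perm (h5.symm.trans hp)))
  have hpos := List.length_pos_iff.2 hE.ne_nil
  exact h6.mono (by omega)

/-- One step takes in `v`, unless it is already occupied, and then the configurations share a
vertex. -/
theorem Reach.of_adj (hI : IsGraph I) {C D : Cfg} (hC : IsNode I k C) (hD : IsNode I k D)
    {u v : ℕ} (hu : u ∈ C) (hv : v ∈ D) (huv : adjB I u v = true) : Reach I k (k + 1) C D := by
  by_cases h : v ∈ C
  · exact (Reach.of_mem hI hC hD h hv).mono (by omega)
  · obtain ⟨A, z, h1, h2, h3, h4⟩ := hC.exists_move hI hu huv h (.single (hI.lt huv))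
      (by simp) (by rw [← hC.2]; exact List.length_pos_iff.2 hC.1.ne_nil)
    exact .cons hC h4 (.of_mem hI h1 hD (h2.subset (by simp)) hv)

end KHWP


namespace KHWP
open Data (size rep)

/-! ### From spanning walks to lists and back -/

/-- A walk between the two sides has an edge across the cut; conversely no edge leaves the set of
vertices reachable from `u`. -/
theorem connected_iff_cut {V : Type*} [Nonempty V] (H : SimpleGraph V) :
    H.Connected ↔ ∀ S : V → Prop, (∃ u, S u) → (∃ v, ¬ S v) → ∃ u v, S u ∧ ¬ S v ∧ H.Adj u v := by
  constructor
  · rintro h S ⟨u, hu⟩ ⟨v, hv⟩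
    obtain ⟨p⟩ := h.preconnected u v
    obtain ⟨d, -, h1, h2⟩ := p.exists_boundary_dart {x | S x} hu hv
    exact ⟨d.fst, d.snd, h1, h2, d.adj⟩
  · refine fun h => ⟨fun u v => ?_⟩
    by_contra hv
    obtain ⟨a, b, h1, h2, h3⟩ := h (fun x => H.Reachable u x) ⟨u, .refl u⟩ ⟨v, hv⟩
    exact h2 (h1.trans h3.reachable)

theorem adjB_encode {n : ℕ} {G : SimpleGraph (Fin n)} {u v : ℕ} :
    adjB (encode G) u v = true ↔ ∃ i j : Fin n, u = i ∧ v = j ∧ G.Adj i j := by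
  rw [adjB, memB_iff, mem_encode]

theorem adjB_encode_coe {n : ℕ} {G : SimpleGraph (Fin n)} {i j : Fin n} :
    adjB (encode G) i j = true ↔ G.Adj i j := by
  rw [adjB_encode]
  constructor
  · rintro ⟨i', j', h1, h2, h⟩
    rwa [Fin.ext h1, Fin.ext h2]
  · exact fun h => ⟨i, j, rfl, rfl, h⟩

theorem step_encode_coe {n : ℕ} {G : SimpleGraph (Fin n)} {i j : Fin n} :
    Step (encode G) i j ↔ i = j ∨ G.Adj i j := by
  rw [step_iff, adjB_encode_coe, Fin.ext_iff]

theorem isGraph_encode {n : ℕ} {G : SimpleGraph (Fin n)} (hG : G.Connected) :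
    IsGraph (encode G) where
  symm {u v} h := by
    obtain ⟨i, j, rfl, rfl, h'⟩ := adjB_encode.1 h
    exact adjB_encode_coe.2 h'.symm
  irrefl {u v} h := by
    obtain ⟨i, j, rfl, rfl, h'⟩ := adjB_encode.1 h
    exact fun e => h'.ne (Fin.ext e)
  lt {u v} h := by
    obtain ⟨i, j, rfl, rfl, h⟩ := adjB_encode.1 h
    exact j.2
  cut S := by
    rintro ⟨u, hu, hSu⟩ ⟨v, hv, hSv⟩
    have := hG.nonempty
    obtain ⟨i, j, h1, h2, h3⟩ := (connected_iff_cut G).1 hG (fun i => S i) ⟨⟨u, hu⟩, hSu⟩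
      ⟨⟨v, hv⟩, hSv⟩
    exact ⟨i, j, h1, h2, adjB_encode_coe.2 h3⟩

/-- Every vertex lies in a configuration of `w`. -/
def Covers (I : Inp) (w : List Cfg) : Prop := ∀ v < I.1, ∃ C ∈ w, v ∈ C

theorem exists_node_of_isConfiguration {n k : ℕ} (hk : 1 ≤ k) {G : SimpleGraph (Fin n)}
    {C : Fin k → Fin n} (hC : IsConfiguration G C) :
    ∃ D, IsNode (encode G) k D ∧ D.Perm (List.ofFn fun i => (C i : ℕ)) := by
  have hinj : Function.Injective fun i => (C i : ℕ) := Fin.val_injective.comp hC.1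
  have hnd : (List.ofFn fun i => (C i : ℕ)).Nodup := List.nodup_ofFn.2 hinj
  have hlt : ∀ v ∈ (List.ofFn fun i => (C i : ℕ)).toFinset, v < (encode G).1 := by
    intro v hv
    rw [List.mem_toFinset, List.mem_ofFn] at hv
    obtain ⟨i, rfl⟩ := hv
    exact (C i).2
  have hmem : ∀ i, (C i : ℕ) ∈ (List.ofFn fun i => (C i : ℕ)).toFinset := fun i => by
    rw [List.mem_toFinset, List.mem_ofFn]; exact ⟨i, rfl⟩
  have hconn : ConnSet (encode G) (List.ofFn fun i => (C i : ℕ)).toFinset := by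
    rintro S ⟨u, hu, hSu⟩ ⟨v, hv, hSv⟩
    rw [List.mem_toFinset, List.mem_ofFn] at hu hv
    obtain ⟨i, rfl⟩ := hu
    obtain ⟨j, rfl⟩ := hv
    have := hC.2.nonempty
    obtain ⟨⟨_, a, rfl⟩, ⟨_, b, rfl⟩, h1, h2, h3⟩ := (connected_iff_cut _).1 hC.2
      (fun x => S (x : Fin n)) ⟨⟨C i, i, rfl⟩, hSu⟩ ⟨⟨C j, j, rfl⟩, hSv⟩
    exact ⟨C a, hmem a, C b, hmem b, h1, h2, adjB_encode_coe.2 h3⟩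
  obtain ⟨D, hD, -, h⟩ := Grow.exists_extension hconn hlt
    (.single (hlt _ (hmem ⟨0, hk⟩))) (B := [(C ⟨0, hk⟩ : ℕ)]) (fun x hx => by
      rw [List.mem_toFinset, List.mem_singleton] at hx
      subst hx
      exact hmem _)
  have hp := List.perm_of_nodup_nodup_toFinset_eq hD.nodup hnd h
  exact ⟨D, ⟨hD, by simpa using hp.length_eq⟩, hp⟩

theorem IsSpanningWalk.exists_walk {n k l : ℕ} (hk : 1 ≤ k) {G : SimpleGraph (Fin n)}
    {W : Fin (l + 1) → Fin k → Fin n} (hW : IsSpanningWalk G W) :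
    ∃ w, IsWalk (encode G) k w ∧ Covers (encode G) w ∧ w.length = l + 1 := by
  choose D hD hp using fun t => exists_node_of_isConfiguration hk (hW.config t)
  refine ⟨List.ofFn D, ⟨by simp, ?_, ?_⟩, ?_, by simp⟩
  · intro C hC
    obtain ⟨t, rfl⟩ := (List.mem_ofFn).1 hC
    exact hD t
  · rw [List.isChain_ofFn]
    intro i hi
    have h1 : UAdj (encode G) (List.ofFn fun j => (W ⟨i, by omega⟩ j : ℕ))
        (List.ofFn fun j => (W ⟨i + 1, hi⟩ j : ℕ)) := by
      refine uadj_of_forall₂ (List.forall₂_iff_get.2 ⟨by simp, fun j h1 h2 => ?_⟩)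
      simp only [List.get_eq_getElem, List.getElem_ofFn]
      exact step_encode_coe.2 (hW.adj ⟨i, by omega⟩ _)
    exact (h1.perm_left (hp _).symm).perm_right (hp _).symm
  · intro v hv
    obtain ⟨t, i, h⟩ := hW.cover ⟨v, hv⟩
    refine ⟨D t, List.mem_ofFn.2 ⟨t, rfl⟩, (hp t).symm.subset (List.mem_ofFn.2 ⟨i, ?_⟩)⟩
    rw [h]

variable {I : Inp} {k : ℕ}

/-- In each step an order of the next configuration is chosen that matches the labelled previous one
agent by agent. Only the order changes, so the occupied sets stay the same. The accumulator is
reversed, hence the order of `D` and `C` in the chain. -/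
theorem relabel_spec {w : List Cfg} (hn : ∀ C ∈ w, IsNode I k C) (hc : w.IsChain (UAdj I)) :
    List.Forall₂ List.Perm (relabel I k w).reverse w ∧
      (relabel I k w).IsChain fun D C => List.Forall₂ (Step I) C D := by
  induction w using List.reverseRecOn with
  | nil => simp [relabel]
  | append_singleton w D ih =>
    obtain ⟨ih1, ih2⟩ := ih (fun C hC => hn C (by simp [hC])) (List.isChain_append.1 hc).1
    have hD := hn D (by simp)
    have e : relabel I k (w ++ [D]) = relabelStep I k (relabel I k w) D := by
      simp [relabel]
    rw [e]
    rcases hr : relabel I k w with _ | ⟨A, acc⟩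
    · rw [hr] at ih1
      cases ih1
      simp [relabelStep]
    · rw [hr] at ih1 ih2
      rcases List.eq_nil_or_concat' w with rfl | ⟨w, C, rfl⟩
      · simp at ih1
      · rw [List.reverse_cons] at ih1
        have hl : acc.reverse.length = w.length := by simpa using ih1.length_eq
        have h1 : List.Forall₂ List.Perm acc.reverse w := by
          have := List.forall₂_take_append _ w [C] ih1
          rwa [List.take_left' hl] at this
        have h2 : A.Perm C := by
          have := List.forall₂_drop_append _ w [C] ih1
          rw [List.drop_left' hl] at this
          simpa using this
        have hC := hn C (by simp)
        have hCD : UAdj I C D :=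
          (List.isChain_append.1 hc).2.2 C (by simp) D (by simp)
        obtain ⟨D', hD'⟩ := (hCD.perm_left h2.symm).exists_perm
        have hm := fun E => mem_aligns (I := I) (D' := E) (h2.length_eq.trans hC.2) hD.1.nodup hD.2
        have hne : aligns I k A D ≠ [] := List.ne_nil_of_mem ((hm D').2 hD')
        obtain ⟨h3, h4⟩ := (hm _).1 (headOr_mem D hne)
        simp only [relabelStep, listCase_cons, List.reverse_cons]
        exact ⟨List.rel_append ih1 (.cons h3 .nil), List.isChain_cons_cons.2 ⟨h4, ih2⟩⟩

theorem getElem?_flatMap_id {L : List Cfg} (hL : ∀ C ∈ L, C.length = k) {t i : ℕ}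
    (hi : i < k) : (L.flatMap fun C => C)[t * k + i]? = L[t]?.bind fun C => C[i]? := by
  induction L generalizing t with
  | nil => simp
  | cons C L ih =>
    have hC := hL C (by simp)
    rw [List.flatMap_cons]
    cases t with
    | zero => rw [List.getElem?_append_left (by omega)]; simp
    | succ t =>
      rw [List.getElem?_append_right (by rw [hC, add_mul]; omega),
        show (t + 1) * k + i - C.length = t * k + i by rw [hC, add_mul]; omega,
        ih fun C hC => hL C (by simp [hC])]
      simp

theorem isConfiguration_of_perm {n : ℕ} {G : SimpleGraph (Fin n)} (hG : G.Connected)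
    (hk : 1 ≤ k) {D : Cfg} (hD : IsNode (encode G) k D) {C : Fin k → Fin n}
    (hp : (List.ofFn fun i => (C i : ℕ)).Perm D) : IsConfiguration G C := by
  have hinj : Function.Injective C := by
    have := List.nodup_ofFn.1 (hp.nodup_iff.2 hD.1.nodup)
    exact fun a b h => this (congrArg Fin.val h)
  have hne : Nonempty (Set.range C) := ⟨⟨C ⟨0, hk⟩, _, rfl⟩⟩
  refine ⟨hinj, (connected_iff_cut _).2 ?_⟩
  rintro S ⟨⟨_, i, rfl⟩, hu⟩ ⟨⟨_, j, rfl⟩, hv⟩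
  have hmem : ∀ {x : ℕ}, x ∈ D.toFinset ↔ ∃ i, (C i : ℕ) = x := fun {x} => by
    rw [List.mem_toFinset, ← hp.mem_iff, List.mem_ofFn]
  obtain ⟨a, ha, b, hb, h1, h2, h3⟩ := hD.1.connSet (isGraph_encode hG)
    (fun x => ∃ i, (C i : ℕ) = x ∧ S ⟨C i, i, rfl⟩) ⟨C i, hmem.2 ⟨i, rfl⟩, i, rfl, hu⟩
    ⟨C j, hmem.2 ⟨j, rfl⟩, fun ⟨i', h, h'⟩ => hv (by
      obtain rfl := hinj (Fin.ext h); exact h')⟩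
  obtain ⟨i', rfl, h1⟩ := h1
  obtain ⟨j', rfl⟩ := hmem.1 hb
  exact ⟨⟨C i', i', rfl⟩, ⟨C j', j', rfl⟩, h1, fun h => h2 ⟨j', rfl, h⟩, adjB_encode_coe.1 h3⟩

theorem output_spec {n : ℕ} {G : SimpleGraph (Fin n)} (hG : G.Connected) (hk : 1 ≤ k)
    {w : List Cfg} (hw : IsWalk (encode G) k w) (hc : Covers (encode G) w) :
    ∃ W : Fin (w.length - 1 + 1) → Fin k → Fin n, IsSpanningWalk G W ∧
      ∀ (t : Fin (w.length - 1 + 1)) (i : Fin k),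
        (output (encode G) k w).2[(t : ℕ) * k + i]? = some (W t i : ℕ) := by
  obtain ⟨h1, h2⟩ := relabel_spec hw.node hw.chain
  set L := (relabel (encode G) k w).reverse with hL
  have hlen : L.length = w.length := h1.length_eq
  have hpos := List.length_pos_iff.2 hw.ne_nil
  have hperm : ∀ (t : ℕ) (ht : t < w.length), (L[t]'(by omega)).Perm w[t] := fun t ht =>
    (List.forall₂_iff_get.1 h1).2 t (by omega) ht
  have hstep : ∀ (t : ℕ) (ht : t + 1 < L.length),
      List.Forall₂ (Step (encode G)) (L[t]'(by omega)) L[t + 1] := by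
    have : L.IsChain fun C D => List.Forall₂ (Step (encode G)) C D := by
      rw [hL, List.isChain_reverse]; exact h2
    exact fun t ht => List.isChain_iff_getElem.1 this t ht
  have hlk : ∀ (t : ℕ) (ht : t < L.length), L[t].length = k := fun t ht =>
    (hperm t (by omega)).length_eq.trans (hw.node _ (List.getElem_mem _)).2
  have hlt : ∀ (t : ℕ) (ht : t < L.length) (i : ℕ) (hi : i < k),
      L[t][i]'(by rw [hlk]; exact hi) < n := fun t ht i hi =>
    (hw.node _ (List.getElem_mem (h := by omega))).1.lt _
      ((hperm t (by omega)).subset (List.getElem_mem _))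
  let W : Fin (w.length - 1 + 1) → Fin k → Fin n := fun t i =>
    ⟨(L[(t : ℕ)]'(by omega))[(i : ℕ)]'(by rw [hlk]; exact i.2), hlt t (by omega) i i.2⟩
  have hof : ∀ t : Fin (w.length - 1 + 1),
      (List.ofFn fun i => (W t i : ℕ)) = L[(t : ℕ)]'(by omega) := fun t =>
    List.ext_getElem (by simp [hlk]) fun i _ _ => by simp [W]
  refine ⟨W, ⟨fun t => ?_, fun t i => ?_, fun v => ?_⟩, fun t i => ?_⟩
  · exact isConfiguration_of_perm hG hk (hw.node _ (List.getElem_mem (n := (t : ℕ)) (by omega)))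
      (by rw [hof]; exact hperm t (by omega))
  · refine step_encode_coe.1 ?_
    exact (List.forall₂_iff_get.1 (hstep t (by omega))).2 i (by rw [hlk]; exact i.2)
      (by rw [hlk]; exact i.2)
  · obtain ⟨C, hC, hv⟩ := hc v v.2
    obtain ⟨t, ht, rfl⟩ := List.getElem_of_mem hC
    obtain ⟨i, hi, h⟩ := List.getElem_of_mem ((hperm t ht).symm.subset hv)
    exact ⟨⟨t, by omega⟩, ⟨i, by rw [hlk] at hi; exact hi⟩, Fin.ext h⟩
  · rw [output, getElem?_flatMap_id (fun C hC => ?_) i.2]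
    · rw [← hL, List.getElem?_eq_getElem (by omega), Option.bind_some,
        List.getElem?_eq_getElem (by rw [hlk]; exact i.2)]
    · obtain ⟨t, ht, rfl⟩ := List.getElem_of_mem (l := L) hC
      exact hlk t ht

/-! ### From covering walks to approximation algorithms -/

/-- A polynomial-time function that finds short covering walks yields an approximation
algorithm. -/
theorem exists_isPolyTimeApprox (hk : 1 ≤ k) {ρ : ℝ} {f : Inp → List Cfg} (hf : PC f)
    (h : ∀ {n : ℕ} (G : SimpleGraph (Fin n)), G.Connected → k ≤ n →
      IsWalk (encode G) k (f (encode G)) ∧ Covers (encode G) (f (encode G)) ∧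
      ∀ w, IsWalk (encode G) k w → Covers (encode G) w →
        ((f (encode G)).length - 1 : ℝ) ≤ ρ * (w.length - 1)) :
    ∃ P, IsPolyTimeApprox k ρ P := by
  obtain ⟨P, p, hP⟩ := exists_program (f := fun I => output I k (f I)) (by fun_prop)
  refine ⟨P, p, fun n G hG hn => ?_⟩
  obtain ⟨T, s, h1, h2, h3, h4⟩ := hP n G
  obtain ⟨h5, h6, h7⟩ := h G hG hn
  obtain ⟨W, h8, h9⟩ := output_spec hG hk h5 h6
  refine ⟨T, s, _, W, h1, h2, ⟨h3, fun t i => ?_⟩, h8, ?_⟩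
  · obtain ⟨h10, h11⟩ := List.getElem?_eq_some_iff.1 (h9 t i)
    rw [h4 _ h10, h11]
  · obtain ⟨W', hW'⟩ := Nat.sInf_mem (s := {l | ∃ W : Fin (l + 1) → Fin k → Fin n,
      IsSpanningWalk G W}) ⟨_, W, h8⟩
    obtain ⟨w, hw, hc, hl⟩ := hW'.exists_walk hk
    have := h7 w hw hc
    have hpos := List.length_pos_iff.2 h5.ne_nil
    rw [hl] at this
    rw [Nat.cast_sub hpos]
    simpa [minWalkLength] using this

theorem exists_shortest {w : List Cfg} (hw : IsWalk I k w) (hc : Covers I w) :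
    ∃ w₀, IsWalk I k w₀ ∧ Covers I w₀ ∧
      ∀ w, IsWalk I k w → Covers I w → w₀.length ≤ w.length := by
  classical
  have hP : ∃ l w, IsWalk I k w ∧ Covers I w ∧ w.length = l := ⟨_, w, hw, hc, rfl⟩
  obtain ⟨w₀, h1, h2, h3⟩ := Nat.find_spec hP
  exact ⟨w₀, h1, h2, fun w h4 h5 => h3 ▸ Nat.find_le ⟨w, h4, h5, rfl⟩⟩

/-- Finitely many graphs may be disregarded. -/
theorem exists_isPolyTimeApprox_of_eventually (hk : 1 ≤ k) {ρ : ℝ} (hρ : 1 ≤ ρ)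
    {f : Inp → List Cfg} (hf : PC f) (n₀ : ℕ)
    (hex : ∀ I, IsGraph I → k ≤ I.1 → ∃ w, IsWalk I k w ∧ Covers I w)
    (h : ∀ I, IsGraph I → k ≤ I.1 → n₀ ≤ I.1 → IsWalk I k (f I) ∧ Covers I (f I) ∧
      ∀ w, IsWalk I k w → Covers I w → ((f I).length - 1 : ℝ) ≤ ρ * (w.length - 1)) :
    ∃ P, IsPolyTimeApprox k ρ P := by
  have hopt : ∀ I, ∃ w₀, IsGraph I → k ≤ I.1 → IsWalk I k w₀ ∧ Covers I w₀ ∧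
      ∀ w, IsWalk I k w → Covers I w → w₀.length ≤ w.length := by
    intro I
    by_cases hI : IsGraph I ∧ k ≤ I.1
    · obtain ⟨w, h1, h2⟩ := hex I hI.1 hI.2
      obtain ⟨w₀, h3⟩ := exists_shortest h1 h2
      exact ⟨w₀, fun _ _ => h3⟩
    · exact ⟨[], fun h1 h2 => absurd ⟨h1, h2⟩ hI⟩
  choose opt hopt using hopt
  have hfin : (⋃ n ∈ Set.Iio n₀, Set.range fun G : SimpleGraph (Fin n) => encode G).Finite :=
    (Set.finite_Iio n₀).biUnion fun n _ => Set.finite_range _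
  -- The optimal walks for all graphs with fewer than `n₀` vertices are built into the program; as
  -- `ρ ≥ 1`, they meet the guarantee.
  refine exists_isPolyTimeApprox hk
    (PC.table (hfin.toFinset.toList.map fun I => (I, opt I)) hf) fun {n} G hG hn => ?_
  have hI := isGraph_encode hG
  rcases lt_or_ge n n₀ with hlt | hge
  · have e : headOr (((hfin.toFinset.toList.map fun I => (I, opt I)).filter
        fun e => decide (e.1 = encode G)).map fun e => e.2) (f (encode G)) = opt (encode G) := by
      have hm : (encode G, opt (encode G)) ∈ (hfin.toFinset.toList.map fun I => (I, opt I)).filter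
          fun e => decide (e.1 = encode G) := by
        simp only [List.mem_filter, List.mem_map, Finset.mem_toList, Set.Finite.mem_toFinset,
          Set.mem_iUnion, Set.mem_range, decide_true, and_true]
        exact ⟨encode G, ⟨n, hlt, G, rfl⟩, rfl⟩
      have h1 := headOr_mem (f (encode G)) (List.ne_nil_of_mem (List.mem_map_of_mem
        (f := fun e : Inp × List Cfg => e.2) hm))
      obtain ⟨x, hx, h2⟩ := List.mem_map.1 h1
      rw [← h2]
      simp only [List.mem_filter, List.mem_map, decide_eq_true_eq] at hx
      obtain ⟨⟨y, -, rfl⟩, rfl⟩ := hx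
      rfl
    rw [e]
    obtain ⟨h1, h2, h3⟩ := hopt (encode G) hI hn
    refine ⟨h1, h2, fun w hw hc => ?_⟩
    have h4 : ((opt (encode G)).length : ℝ) ≤ w.length := by exact_mod_cast h3 w hw hc
    have h5 : (1 : ℝ) ≤ w.length := by exact_mod_cast List.length_pos_iff.2 hw.ne_nil
    nlinarith
  · have e : headOr (((hfin.toFinset.toList.map fun I => (I, opt I)).filter
        fun e => decide (e.1 = encode G)).map fun e => e.2) (f (encode G)) = f (encode G) := by
      have : (hfin.toFinset.toList.map fun I => (I, opt I)).filter
          (fun e => decide (e.1 = encode G)) = [] := by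
        rw [List.filter_eq_nil_iff]
        intro x hx
        simp only [List.mem_map, Finset.mem_toList, Set.Finite.mem_toFinset,
          Set.mem_iUnion, Set.mem_range, Set.mem_Iio] at hx
        obtain ⟨y, ⟨m, hm, G', rfl⟩, rfl⟩ := hx
        intro h
        have : m = n := congrArg Prod.fst (of_decide_eq_true h)
        omega
      rw [this]; rfl
    rw [e]
    exact h (encode G) hI hn hge

end KHWP


namespace KHWP
open Data (size rep)

variable {I : Inp} {k : ℕ}

/-! ### Joining closed walks -/

theorem covB_iff {W : List Cfg} {v : ℕ} : covB W v = true ↔ ∃ C ∈ W, v ∈ C := by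
  simp [covB, List.any_eq_true]

theorem covF_iff {F : List (List Cfg)} {v : ℕ} : covF F v = true ↔ ∃ W ∈ F, covB W v = true := by
  simp [covF, List.any_eq_true]

theorem covB_mono {W W' : List Cfg} (h : W ⊆ W') {v : ℕ} (hv : covB W v = true) :
    covB W' v = true := by
  obtain ⟨C, hC, hv⟩ := covB_iff.1 hv
  exact covB_iff.2 ⟨C, h hC, hv⟩

/-- The vertices that `F` does not cover. -/
def uncov (I : Inp) (F : List (List Cfg)) : Finset ℕ :=
  (Finset.range I.1).filter fun v => covF F v = false

theorem mem_uncov {F : List (List Cfg)} {v : ℕ} :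
    v ∈ uncov I F ↔ v < I.1 ∧ covF F v = false := by simp [uncov]

theorem card_filter_range (n : ℕ) (p : ℕ → Bool) :
    ((List.range n).filter p).length = ((Finset.range n).filter fun v => p v = true).card := by
  rw [← List.toFinset_card_of_nodup (List.nodup_range.filter _), List.toFinset_filter,
    List.toFinset_range]

theorem gain_eq (F : List (List Cfg)) (w : List Cfg) :
    gain I F w = ((uncov I F).filter fun v => covB w v = true).card := by
  rw [gain, card_filter_range, uncov, Finset.filter_filter]
  congr 1
  ext v
  simp [and_comm]

/-- A walk that returns to its first configuration in one more step. -/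
structure IsLoop (I : Inp) (k : ℕ) (Z : List Cfg) : Prop extends IsWalk I k Z where
  close : UAdj I (lastOr Z []) (headOr Z [])

/-- A loop, cut open at one of its configurations. -/
theorem IsLoop.rotate {Z₁ Z₂ : List Cfg} {D : Cfg} (h : IsLoop I k (Z₁ ++ D :: Z₂)) :
    IsWalk I k (D :: (Z₂ ++ Z₁)) ∧ UAdj I (lastOr (D :: (Z₂ ++ Z₁)) []) D := by
  have hr := h.toIsWalk.right (List.cons_ne_nil _ _)
  have hc := h.close
  rw [lastOr_append _ (List.cons_ne_nil _ _)] at hc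
  rcases eq_or_ne Z₁ [] with rfl | hZ
  · simp at hr hc ⊢
    exact ⟨hr, hc⟩
  · rw [headOr_append hZ] at hc
    rw [← List.cons_append, lastOr_append _ hZ]
    exact ⟨hr.append (h.toIsWalk.left hZ) hc, by
      simpa using h.toIsWalk.uadj hZ (List.cons_ne_nil _ _)⟩

/-- Go along `w` from `C` to `D`, once around the loop, and back along `w`. The final `D` of `w`
stands for the one in the loop, and the two ends of the excursion stand for the `C` that is
replaced. -/
theorem IsWalk.splice (hI : IsGraph I) {W₁ W₂ Z₁ Z₂ w : List Cfg} {C D : Cfg}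
    (h : IsWalk I k (W₁ ++ C :: W₂)) (hZ : IsLoop I k (Z₁ ++ D :: Z₂)) (hw : IsWalk I k w)
    (h1 : headOr w [] = C) (h2 : lastOr w [] = D) :
    IsWalk I k (W₁ ++ (w ++ (Z₂ ++ (Z₁ ++ (w.reverse ++ W₂))))) := by
  obtain ⟨t, ht⟩ := eq_concat_lastOr hw.ne_nil []
  rw [h2] at ht
  obtain ⟨h3, h4⟩ := hZ.rotate
  have h5 : IsWalk I k (w ++ (Z₂ ++ Z₁)) := by
    rw [ht, List.append_assoc, List.singleton_append]
    rcases eq_or_ne t [] with rfl | htn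
    · exact h3
    · rw [ht] at hw
      exact (hw.left htn).append h3 (by simpa using hw.uadj htn (by simp))
  have h6 : lastOr (w ++ (Z₂ ++ Z₁)) [] = lastOr (D :: (Z₂ ++ Z₁)) [] := by
    rw [ht, List.append_assoc, List.singleton_append, lastOr_append _ (List.cons_ne_nil _ _)]
  have h7 : IsWalk I k ((w ++ (Z₂ ++ Z₁)) ++ w.reverse) :=
    h5.append (hw.reverse hI) (by rw [h6, headOr_reverse, h2]; exact h4)
  have h8 := h.insert h7 (by
    rw [headOr_append h5.ne_nil, headOr_append hw.ne_nil, h1]) (by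
    rw [lastOr_append _ (by simpa using hw.ne_nil), lastOr_reverse, h1])
  simpa only [List.append_assoc] using h8

/-- The allowance for a walk `W` that is joined from loops in `F` and single visits. -/
def budget (I : Inp) (k : ℕ) (F : List (List Cfg)) (W : List Cfg) : ℕ :=
  (F.map fun Z => if Z ⊆ W then Z.length + 2 * (k + 1) else 0).sum +
    2 * ((uncov I F).filter fun v => covB W v = true).card

theorem sum_map_if_mono {F : List (List Cfg)} {W W' : List Cfg} (h : W ⊆ W')
    (c : List Cfg → ℕ) : (F.map fun Z => if Z ⊆ W then c Z else 0).sum ≤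
      (F.map fun Z => if Z ⊆ W' then c Z else 0).sum := by
  refine List.sum_le_sum fun Z _ => ?_
  split_ifs with h1 h2
  · exact le_rfl
  · exact absurd (fun _ hx => h (h1 hx)) h2
  · exact Nat.zero_le _
  · exact le_rfl

theorem sum_map_if_add {F : List (List Cfg)} {W W' Z : List Cfg} (h : W ⊆ W')
    (c : List Cfg → ℕ) (hZ : Z ∈ F) (h1 : ¬ Z ⊆ W) (h2 : Z ⊆ W') :
    (F.map fun Z => if Z ⊆ W then c Z else 0).sum + c Z ≤
      (F.map fun Z => if Z ⊆ W' then c Z else 0).sum := by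
  obtain ⟨F₁, F₂, rfl⟩ := List.append_of_mem hZ
  have e1 := sum_map_if_mono (F := F₁) h c
  have e2 := sum_map_if_mono (F := F₂) h c
  simp only [List.map_append, List.map_cons, List.sum_append, List.sum_cons, h1, h2, if_true,
    if_false]
  omega

theorem card_filter_covB_mono {W W' : List Cfg} (h : W ⊆ W') (S : Finset ℕ) :
    (S.filter fun v => covB W v = true).card ≤ (S.filter fun v => covB W' v = true).card :=
  Finset.card_le_card fun v hv => by
    rw [Finset.mem_filter] at *
    exact ⟨hv.1, covB_mono h hv.2⟩

theorem card_filter_covB_lt {W W' : List Cfg} (h : W ⊆ W') {S : Finset ℕ} {v : ℕ} (hv : v ∈ S)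
    (h1 : covB W v = false) (h2 : covB W' v = true) :
    (S.filter fun v => covB W v = true).card + 1 ≤
      (S.filter fun v => covB W' v = true).card := by
  refine Finset.card_lt_card ⟨fun v hv => ?_, fun hs => ?_⟩
  · rw [Finset.mem_filter] at *
    exact ⟨hv.1, covB_mono h hv.2⟩
  · have := hs (Finset.mem_filter.2 ⟨hv, h2⟩)
    rw [Finset.mem_filter, h1] at this
    exact absurd this.2 (by simp)

/-- If `W` misses a vertex, some edge leads from a covered vertex to a vertex `v` that `W` misses.
Either a loop contains `v` and can be spliced in, or `v` can be visited in two steps. No loop is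
charged twice: a spliced loop contains a vertex that `W` missed, so it was not part of `W` before.
-/
theorem joinStep_spec (hI : IsGraph I) (hk : 1 ≤ k) {F : List (List Cfg)}
    (hF : ∀ Z ∈ F, IsLoop I k Z) {W : List Cfg} (hW : IsWalk I k W) :
    IsWalk I k (joinStep I k F W) ∧ W ⊆ joinStep I k F W ∧
      (joinStep I k F W).length + budget I k F W ≤ W.length + budget I k F (joinStep I k F W) ∧
      (¬ Covers I W → ∃ v < I.1, covB W v = false ∧ covB (joinStep I k F W) v = true) := by
  have hne : ¬ Covers I W → splices I k F W ++ visits I k F W ≠ [] := by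
    intro hc
    simp only [Covers, not_forall] at hc
    obtain ⟨x, hx, hc⟩ := hc
    obtain ⟨C₀, hC₀⟩ := List.exists_mem_of_ne_nil W hW.ne_nil
    obtain ⟨y, hy⟩ := List.exists_mem_of_ne_nil _ (hW.node C₀ hC₀).1.ne_nil
    obtain ⟨u, v, ⟨C, hC, hu⟩, hv, huv⟩ := hI.cut (fun v => ∃ C ∈ W, v ∈ C)
      ⟨y, (hW.node C₀ hC₀).1.lt y hy, C₀, hC₀, hy⟩ ⟨x, hx, hc⟩
    have hv' : covB W v = false := by
      rw [← Bool.not_eq_true, covB_iff]; exact hv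
    obtain ⟨W₁, W₂, rfl⟩ := List.append_of_mem hC
    have hCn := hW.node C hC
    rcases hcF : covF F v with _ | _
    · have hvC : v ∉ C := fun h => hv ⟨C, hC, h⟩
      obtain ⟨D, z, h1, h2, -, h4⟩ := hCn.exists_move hI hu huv hvC (.single (hI.lt huv))
        (by simp) (by simpa using hk)
      have hw : IsWalk I k [C, D, C] :=
        ⟨by simp, by simp [hCn, h1], by simp [h4, h4.symm hI]⟩
      refine List.ne_nil_of_mem (List.mem_append_right _ (mem_visits.2
        ⟨W₁, C, W₂, v, [C, D, C], rfl, hI.lt huv, hv', hcF, (mem_walks hk).2 ⟨hw, rfl⟩, rfl,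
          by simp, covB_iff.2 ⟨D, by simp, h2.subset (by simp)⟩, rfl⟩))
    · obtain ⟨Z, hZ, hc⟩ := covF_iff.1 hcF
      obtain ⟨D, hD, hvD⟩ := covB_iff.1 hc
      obtain ⟨Z₁, Z₂, rfl⟩ := List.append_of_mem hD
      obtain ⟨w, h1, h2, h3, h4⟩ := Reach.of_adj hI hCn ((hF _ hZ).node D hD) hu hvD huv
      exact List.ne_nil_of_mem (List.mem_append_left _ (mem_splices.2
        ⟨W₁, C, W₂, v, Z₁, D, Z₂, w, u, rfl, hI.lt huv, hv', hu, huv, hZ, hvD,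
          (mem_walks hk).2 ⟨h1, h2⟩, h3, h4, rfl⟩))
  rcases eq_or_ne (splices I k F W ++ visits I k F W) [] with h0 | h0
  · have : joinStep I k F W = W := by rw [joinStep, h0, headOr_nil]
    rw [this]
    exact ⟨hW, fun _ h => h, le_rfl, fun h => absurd h0 (hne h)⟩
  · have hm : joinStep I k F W ∈ splices I k F W ++ visits I k F W := headOr_mem _ h0
    clear hne
    generalize joinStep I k F W = W' at hm
    rcases List.mem_append.1 hm with hm | hm
    · obtain ⟨W₁, C, W₂, v, Z₁, D, Z₂, w, u, rfl, hv, hvW, hu, huv, hZ, hvD, hw, h3, h4, rfl⟩ :=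
        mem_splices.1 hm
      obtain ⟨hw, hwl⟩ := (mem_walks hk).1 hw
      have hCw : C ∈ w := h3 ▸ headOr_mem _ hw.ne_nil
      have hDw : D ∈ w := h4 ▸ lastOr_mem _ hw.ne_nil
      have hsub : W₁ ++ C :: W₂ ⊆ W₁ ++ (w ++ (Z₂ ++ (Z₁ ++ (w.reverse ++ W₂)))) := by
        intro A; simp only [List.mem_append, List.mem_cons]
        rintro (h | rfl | h) <;> tauto
      have hZsub : Z₁ ++ D :: Z₂ ⊆ W₁ ++ (w ++ (Z₂ ++ (Z₁ ++ (w.reverse ++ W₂)))) := by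
        intro A; simp only [List.mem_append, List.mem_cons]
        rintro (h | rfl | h) <;> tauto
      have hvZ : covB (Z₁ ++ D :: Z₂) v = true := covB_iff.2 ⟨D, by simp, hvD⟩
      refine ⟨hW.splice hI (hF _ hZ) hw h3 h4, hsub, ?_, fun _ => ⟨v, hv, hvW, covB_mono hZsub hvZ⟩⟩
      -- The splice adds two copies of `w` with `k + 2` configurations each and the loop without
      -- `D`, and removes `C`: altogether the length of the loop plus `2 * (k + 1)`.
      have e1 := sum_map_if_add hsub (fun Z => Z.length + 2 * (k + 1)) hZ (fun h => by
        rw [covB_mono h hvZ] at hvW; simp at hvW) hZsub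
      have e2 := card_filter_covB_mono hsub (uncov I F)
      simp only [budget]
      simp only [List.length_append, List.length_cons, List.length_reverse] at e1 hwl ⊢
      omega
    · obtain ⟨W₁, C, W₂, v, w, rfl, hv, hvW, hvF, hw, h3, h4, hvw, rfl⟩ := mem_visits.1 hm
      obtain ⟨hw, hwl⟩ := (mem_walks hk).1 hw
      have hCw : C ∈ w := h3 ▸ headOr_mem _ hw.ne_nil
      have hsub : W₁ ++ C :: W₂ ⊆ W₁ ++ (w ++ W₂) := by
        intro A; simp only [List.mem_append, List.mem_cons]
        rintro (h | rfl | h) <;> tauto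
      have hwsub : w ⊆ W₁ ++ (w ++ W₂) := by
        intro A; simp only [List.mem_append]; tauto
      refine ⟨hW.insert hw h3 h4, hsub, ?_, fun _ => ⟨v, hv, hvW, covB_mono hwsub hvw⟩⟩
      have e1 := sum_map_if_mono (F := F) hsub (fun Z => Z.length + 2 * (k + 1))
      have e2 := card_filter_covB_lt hsub (mem_uncov.2 ⟨hv, hvF⟩) hvW (covB_mono hwsub hvw)
      simp only [budget]
      simp only [List.length_append, List.length_cons] at hwl ⊢
      omega

theorem covers_iff {W : List Cfg} :
    Covers I W ↔ I.1 ≤ ((Finset.range I.1).filter fun v => covB W v = true).card := by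
  constructor
  · intro h
    rw [Finset.filter_true_of_mem fun v hv => covB_iff.2 (h v (Finset.mem_range.1 hv)),
      Finset.card_range]
  · intro h v hv
    have : (Finset.range I.1).filter (fun v => covB W v = true) = Finset.range I.1 :=
      Finset.eq_of_subset_of_card_le (Finset.filter_subset _ _) (by simpa using h)
    have hv' := Finset.mem_range.2 hv
    rw [← this, Finset.mem_filter] at hv'
    exact covB_iff.1 hv'.2

/-- Every round before completion covers a new vertex, so `I.1` rounds suffice. The budget of `[C₀]`
is what the starting configuration already covers for free; keeping it on the left gives the saving
of `2 * k` in `join_nil_spec`. -/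
theorem join_budget (hI : IsGraph I) (hk : 1 ≤ k) (hn : k ≤ I.1) {F : List (List Cfg)}
    (hF : ∀ Z ∈ F, IsLoop I k Z) :
    ∃ C₀, IsNode I k C₀ ∧ IsWalk I k (join I k F) ∧ Covers I (join I k F) ∧
      (join I k F).length + budget I k F [C₀] ≤
        1 + (F.map fun Z => Z.length + 2 * (k + 1)).sum + 2 * (uncov I F).card := by
  have hC₀ : IsNode I k (headOr (nodes I k) []) := by
    obtain ⟨C, hC, -⟩ := exists_node hI hk hn (v := 0) (by omega)
    exact (mem_nodes hk).1 (headOr_mem _ (List.ne_nil_of_mem ((mem_nodes hk).2 hC)))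
  have key : ∀ j, IsWalk I k ((joinStep I k F)^[j] [headOr (nodes I k) []]) ∧
      ((joinStep I k F)^[j] [headOr (nodes I k) []]).length +
        budget I k F [headOr (nodes I k) []] ≤
        1 + budget I k F ((joinStep I k F)^[j] [headOr (nodes I k) []]) ∧
      min j I.1 ≤ ((Finset.range I.1).filter fun v =>
        covB ((joinStep I k F)^[j] [headOr (nodes I k) []]) v = true).card := by
    intro j
    induction j with
    | zero => exact ⟨.single hC₀, by simp, by simp⟩
    | succ j ih =>
      rw [Function.iterate_succ_apply']
      generalize (joinStep I k F)^[j] [headOr (nodes I k) []] = W at ih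
      obtain ⟨h1, h2, h3⟩ := ih
      obtain ⟨h4, h5, h6, h7⟩ := joinStep_spec hI hk hF h1
      refine ⟨h4, by omega, ?_⟩
      by_cases hc : Covers I W
      · exact (min_le_right _ _).trans ((covers_iff.1 hc).trans (card_filter_covB_mono h5 _))
      · obtain ⟨v, h8, h9, h10⟩ := h7 hc
        have := card_filter_covB_lt h5 (Finset.mem_range.2 h8) h9 h10
        omega
  obtain ⟨h1, h2, h3⟩ := key I.1
  refine ⟨_, hC₀, h1, covers_iff.2 ((min_self I.1).symm.trans_le h3), h2.trans ?_⟩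
  rw [add_assoc]
  refine Nat.add_le_add_left (Nat.add_le_add ?_ ?_) 1
  · refine List.sum_le_sum fun Z _ => ?_
    split_ifs <;> omega
  · gcongr
    exact Finset.filter_subset _ _

theorem join_spec (hI : IsGraph I) (hk : 1 ≤ k) (hn : k ≤ I.1) {F : List (List Cfg)}
    (hF : ∀ Z ∈ F, IsLoop I k Z) :
    IsWalk I k (join I k F) ∧ Covers I (join I k F) ∧ (join I k F).length ≤
      1 + (F.map fun Z => Z.length + 2 * (k + 1)).sum + 2 * (uncov I F).card := by
  obtain ⟨C₀, -, h1, h2, h3⟩ := join_budget hI hk hn hF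
  exact ⟨h1, h2, by omega⟩

theorem uncov_nil : (uncov I []).card = I.1 := by simp [uncov, covF]

/-- A walk around a spanning tree. -/
theorem join_nil_spec (hI : IsGraph I) (hk : 1 ≤ k) (hn : k ≤ I.1) :
    IsWalk I k (join I k []) ∧ Covers I (join I k []) ∧
      (join I k []).length + 2 * k ≤ 1 + 2 * I.1 := by
  obtain ⟨C₀, h0, h1, h2, h3⟩ := join_budget hI hk hn (F := []) (by simp)
  refine ⟨h1, h2, ?_⟩
  have hb : budget I k [] [C₀] = 2 * k := by
    have e : ((uncov I []).filter fun v => covB [C₀] v = true) = C₀.toFinset := by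
      ext v
      simp only [Finset.mem_filter, mem_uncov, covB_iff, List.mem_singleton, exists_eq_left,
        List.mem_toFinset]
      exact ⟨fun h => h.2, fun h => ⟨⟨h0.1.lt v h, rfl⟩, h⟩⟩
    simp [budget, e, List.toFinset_card_of_nodup h0.1.nodup, h0.2]
  rw [hb, uncov_nil] at h3
  simpa using h3

end KHWP


namespace KHWP
open Data (size rep)

variable {I : Inp} {k : ℕ}

/-! ### The greedy algorithm -/

/-- An infinite walk whose first `L` configurations cover everything. -/
structure Route (I : Inp) (k : ℕ) (C : ℕ → Cfg) (L : ℕ) : Prop where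
  node : ∀ t, IsNode I k (C t)
  adj : ∀ t, UAdj I (C t) (C (t + 1))
  cover : ∀ v < I.1, ∃ t < L, v ∈ C t

/-- The walk rests at its last configuration forever, so that a block reaching beyond the end is
still a walk of full length. -/
theorem exists_route {w : List Cfg} (hw : IsWalk I k w) (hc : Covers I w) :
    ∃ C, Route I k C w.length := by
  have hpos := List.length_pos_iff.2 hw.ne_nil
  refine ⟨fun t => w[min t (w.length - 1)]'(by omega), fun t => hw.node _ (List.getElem_mem _),
    fun t => ?_, fun v hv => ?_⟩
  · by_cases h : t + 1 < w.length
    · have e1 : min t (w.length - 1) = t := by omega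
      have e2 : min (t + 1) (w.length - 1) = t + 1 := by omega
      simp only [e1, e2]
      exact List.isChain_iff_getElem.1 hw.chain t h
    · have e : min (t + 1) (w.length - 1) = min t (w.length - 1) := by omega
      simp only [e]
      exact .refl _
  · obtain ⟨C, hC, hv⟩ := hc v hv
    obtain ⟨t, ht, rfl⟩ := List.getElem_of_mem hC
    have e : min t (w.length - 1) = t := by omega
    exact ⟨t, ht, by simpa only [e] using hv⟩

/-- The part of a walk from time `a` to time `a + m - 1`. -/
def segment (C : ℕ → Cfg) (a m : ℕ) : List Cfg := (List.range m).map fun s => C (a + s)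

@[simp] theorem length_segment (C : ℕ → Cfg) (a m : ℕ) : (segment C a m).length = m := by
  simp [segment]

theorem mem_segment {C : ℕ → Cfg} {a m : ℕ} {D : Cfg} :
    D ∈ segment C a m ↔ ∃ s < m, C (a + s) = D := by simp [segment]

theorem Route.isWalk_segment {C : ℕ → Cfg} {L : ℕ} (h : Route I k C L) (a : ℕ) {m : ℕ}
    (hm : 1 ≤ m) : IsWalk I k (segment C a m) where
  ne_nil h0 := by
    have := length_segment C a m
    rw [h0] at this; simp at this; omega
  node D hD := by
    obtain ⟨s, -, rfl⟩ := mem_segment.1 hD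
    exact h.node _
  chain := by
    rw [List.isChain_iff_getElem]
    intro i hi
    simp only [segment, List.getElem_map, List.getElem_range]
    exact h.adj _

/-- The first `q` blocks of length `m` cover everything, and each contains at most `g` of the
uncovered vertices. -/
theorem Route.card_uncov_le {C : ℕ → Cfg} {L : ℕ} (h : Route I k C L) {F : List (List Cfg)}
    {m q g : ℕ} (hm : 1 ≤ m) (hq : L ≤ q * m)
    (hg : ∀ i < q, gain I F (segment C (i * m) m) ≤ g) : (uncov I F).card ≤ q * g := by
  have hsub : uncov I F ⊆ (Finset.range q).biUnion fun i =>
      (uncov I F).filter fun v => covB (segment C (i * m) m) v = true := by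
    intro v hv
    obtain ⟨t, ht, hvt⟩ := h.cover v (mem_uncov.1 hv).1
    rw [Finset.mem_biUnion]
    refine ⟨t / m, Finset.mem_range.2 ?_, Finset.mem_filter.2 ⟨hv, covB_iff.2 ⟨C t, ?_, hvt⟩⟩⟩
    · rw [Nat.div_lt_iff_lt_mul (by omega)]; omega
    · exact mem_segment.2 ⟨t % m, Nat.mod_lt _ hm, by rw [Nat.div_add_mod']⟩
  refine (Finset.card_le_card hsub).trans (Finset.card_biUnion_le.trans ?_)
  refine (Finset.sum_le_card_nsmul _ _ g fun i hi => ?_).trans (by simp)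
  rw [← gain_eq]
  exact hg i (Finset.mem_range.1 hi)

theorem covF_cons {w : List Cfg} {F : List (List Cfg)} {v : ℕ} :
    covF (w :: F) v = (covB w v || covF F v) := by simp [covF]

theorem card_uncov_cons (w : List Cfg) (F : List (List Cfg)) :
    (uncov I (w :: F)).card + gain I F w = (uncov I F).card := by
  have : uncov I (w :: F) = (uncov I F).filter fun v => ¬ covB w v = true := by
    ext v
    simp only [mem_uncov, covF_cons, Finset.mem_filter, Bool.or_eq_false_iff, Bool.not_eq_true]
    tauto
  rw [gain_eq, this, add_comm]
  exact Finset.card_filter_add_card_filter_not _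

theorem exists_bestWalk {l t : ℕ} {F : List (List Cfg)} {w : List Cfg}
    (hw : w ∈ walks I k l) (hg : t ≤ gain I F w) : bestWalks I k l t F ≠ [] := by
  obtain ⟨w', hw', hmax⟩ := Finset.exists_max_image (walks I k l).toFinset (gain I F)
    ⟨w, by simpa using hw⟩
  refine List.ne_nil_of_mem (a := w') (List.mem_filter.2 ⟨by simpa using hw', ?_⟩)
  simp only [Bool.and_eq_true, decide_eq_true_eq, List.all_eq_true]
  exact ⟨hg.trans (hmax w (by simpa using hw)), fun x hx => hmax x (by simpa using hx)⟩

/-- The potential `φ` must drop by the length `l + 1` of a walk whenever `x` vertices are uncovered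
and a gain `g` satisfies `t ≤ g` and `x ≤ q * g`. The latter holds for a best walk, since the `q`
blocks of the route are among its competitors. The abstract `φ` serves both the logarithmic
potential and a linear one. -/
theorem greedy_spec (hk : 1 ≤ k) {C : ℕ → Cfg} {L : ℕ} (hC : Route I k C L) {l t q : ℕ}
    (ht : 1 ≤ t) (hq : L ≤ q * (l + 1)) (φ : ℕ → ℝ)
    (hφ : ∀ x g : ℕ, t ≤ g → x ≤ q * g → g ≤ x → φ (x - g) + (l + 1) ≤ φ x)
    (F₀ : List (List Cfg)) :
    ∃ F, greedy I k l t F₀ = F ++ F₀ ∧ (∀ w ∈ F, IsWalk I k w ∧ w.length = l + 1) ∧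
      (F.length * (l + 1) : ℝ) + φ (uncov I (F ++ F₀)).card ≤ φ (uncov I F₀).card ∧
      ∀ w, IsWalk I k w → w.length = l + 1 → gain I (F ++ F₀) w < t := by
  have key : ∀ j, ∃ F, (greedyStep I k l t)^[j] F₀ = F ++ F₀ ∧
      (∀ w ∈ F, IsWalk I k w ∧ w.length = l + 1) ∧
      (F.length * (l + 1) : ℝ) + φ (uncov I (F ++ F₀)).card ≤ φ (uncov I F₀).card ∧
      ((∀ w, IsWalk I k w → w.length = l + 1 → gain I (F ++ F₀) w < t) ∨
        (uncov I (F ++ F₀)).card + j ≤ I.1) := by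
    intro j
    induction j with
    | zero =>
      refine ⟨[], by simp, by simp, by simp, Or.inr ?_⟩
      have := Finset.card_filter_le (Finset.range I.1) fun v => covF F₀ v = false
      simpa [uncov] using this
    | succ j ih =>
      obtain ⟨F, h1, h2, h3, h4⟩ := ih
      rw [Function.iterate_succ_apply', h1, greedyStep]
      rcases hb : bestWalks I k l t (F ++ F₀) with _ | ⟨w, ws⟩
      · refine ⟨F, by simp, h2, h3, Or.inl fun w hw hl => ?_⟩
        by_contra hcon
        exact exists_bestWalk ((mem_walks hk).2 ⟨hw, hl⟩) (not_lt.1 hcon) hb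
      · have hw : w ∈ bestWalks I k l t (F ++ F₀) := by rw [hb]; simp
        obtain ⟨hw1, hw2⟩ := List.mem_filter.1 hw
        simp only [Bool.and_eq_true, decide_eq_true_eq, List.all_eq_true] at hw2
        have hcard := card_uncov_cons (I := I) w (F ++ F₀)
        have hx : (uncov I (F ++ F₀)).card ≤ q * gain I (F ++ F₀) w :=
          hC.card_uncov_le (by omega) hq fun i _ => hw2.2 _ ((mem_walks hk).2
            ⟨hC.isWalk_segment _ (by omega), by simp⟩)
        have hstep := hφ _ _ hw2.1 hx (by omega)
        refine ⟨w :: F, by simp, ?_, ?_, ?_⟩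
        · rintro x (_ | ⟨_, hx⟩)
          exacts [(mem_walks hk).1 hw1, h2 x ‹_›]
        · rw [show (uncov I (F ++ F₀)).card - gain I (F ++ F₀) w =
            (uncov I (w :: F ++ F₀)).card by rw [List.cons_append]; omega] at hstep
          simp only [List.length_cons, Nat.cast_add, Nat.cast_one]
          linarith
        · refine Or.inr ?_
          rcases h4 with h4 | h4
          · have := h4 w ((mem_walks hk).1 hw1).1 ((mem_walks hk).1 hw1).2
            omega
          · rw [List.cons_append]; omega
  obtain ⟨F, h1, h2, h3, h4⟩ := key I.1
  refine ⟨F, h1, h2, h3, ?_⟩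
  rcases h4 with h4 | h4
  · exact h4
  · intro w _ _
    have : gain I (F ++ F₀) w ≤ (uncov I (F ++ F₀)).card := by
      rw [gain_eq]; exact Finset.card_filter_le _ _
    omega

/-- The potential function of the greedy algorithm. -/
noncomputable def pot (τ Q x : ℝ) : ℝ := if x ≤ τ * Q then x / τ else Q + Q * Real.log (x / (τ * Q))

/-- Below the threshold the potential is linear with slope `1/τ` and the gain is at least `τ * s`.
Above it, `Q * log (x / y) ≥ Q * (1 - y / x)`, which is at least `Q / q = s` because `x - y ≥ x /
q`. -/
theorem pot_step {τ Q x y s q : ℝ} (hτ : 0 < τ) (hQ : 0 < Q) (hs : 0 < s) (hq : Q = q * s)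
    (h1 : τ * s ≤ x - y) (h2 : x ≤ q * (x - y)) : pot τ Q y + s ≤ pot τ Q x := by
  have hyx : y ≤ x := by nlinarith
  by_cases hx : x ≤ τ * Q
  · rw [pot, pot, if_pos hx, if_pos (hyx.trans hx)]
    rw [div_add' _ _ _ hτ.ne', div_le_div_iff_of_pos_right hτ]
    linarith
  · push Not at hx
    have hτQ : 0 < τ * Q := by positivity
    have hx0 : 0 < x := hτQ.trans hx
    have hkey : s ≤ Q - Q * y / x := by
      have : Q - Q * y / x = s * (q * (x - y)) / x := by rw [hq]; field_simp
      rw [this, le_div_iff₀ hx0]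
      exact mul_le_mul_of_nonneg_left h2 hs.le
    rw [pot, pot, if_neg (not_le.2 hx)]
    split_ifs with hy'
    · have hl := Real.one_sub_inv_le_log_of_pos (show 0 < x / (τ * Q) by positivity)
      rw [inv_div] at hl
      -- The step crosses the threshold. Expanded, this product is the drop of the potential, with
      -- the logarithm replaced by its lower bound, minus `Q - Q * y / x`.
      have h3 : 0 ≤ (Q - y / τ) * (1 - τ * Q / x) := by
        refine mul_nonneg ?_ ?_
        · rw [sub_nonneg, div_le_iff₀ hτ]; linarith
        · rw [sub_nonneg, div_le_one hx0]; exact hx.le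
      have h4 : (Q - y / τ) * (1 - τ * Q / x) =
          Q + Q * (1 - τ * Q / x) - y / τ - (Q - Q * y / x) := by
        field_simp; ring
      have h5 := mul_le_mul_of_nonneg_left hl hQ.le
      linarith
    · push Not at hy'
      have hy0 : 0 < y := hτQ.trans hy'
      have hl := Real.one_sub_inv_le_log_of_pos (show 0 < x / y by positivity)
      rw [inv_div] at hl
      have h5 := mul_le_mul_of_nonneg_left hl hQ.le
      have h6 : Real.log (x / y) = Real.log (x / (τ * Q)) - Real.log (y / (τ * Q)) := by
        rw [Real.log_div hx0.ne' hy0.ne', Real.log_div hx0.ne' hτQ.ne',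
          Real.log_div hy0.ne' hτQ.ne']; ring
      have h7 : Q * (1 - y / x) = Q - Q * y / x := by ring
      rw [h6] at h5
      linarith

/-- The result of the greedy algorithm, with the threshold `t = τ (l + 1)` for the gain. -/
theorem greedy_bound (hk : 1 ≤ k) {C : ℕ → Cfg} {L : ℕ} (hC : Route I k C L) {l t q : ℕ}
    {τ : ℝ} (ht : 1 ≤ t) (hτ : (t : ℝ) = τ * (l + 1)) (hq : L ≤ q * (l + 1)) (hq1 : 1 ≤ q) :
    ∃ F, greedy I k l t [] = F ∧ (∀ w ∈ F, IsWalk I k w ∧ w.length = l + 1) ∧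
      ((uncov I F).card : ℝ) ≤ τ * (q * (l + 1)) ∧
      (F.length * (l + 1) : ℝ) + (uncov I F).card / τ ≤ pot τ (q * (l + 1)) I.1 ∧
      ∀ w, IsWalk I k w → w.length = l + 1 → gain I F w < t := by
  have hl : (0 : ℝ) < l + 1 := by positivity
  have hτ0 : 0 < τ := by
    have : (0 : ℝ) < t := by exact_mod_cast ht
    rw [hτ] at this
    exact pos_of_mul_pos_left this hl.le
  have hq0 : (0 : ℝ) < q := by exact_mod_cast hq1
  obtain ⟨F, h1, h2, h3, h4⟩ := greedy_spec hk hC ht hq (fun x => pot τ (q * (l + 1)) x)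
    (fun x g hg hx hgx => by
      have e1 : ((x - g : ℕ) : ℝ) = x - g := by rw [Nat.cast_sub hgx]
      have e2 : (x : ℝ) ≤ q * g := by exact_mod_cast hx
      have e3 : (t : ℝ) ≤ g := by exact_mod_cast hg
      have e4 : (g : ℝ) ≤ x := by exact_mod_cast hgx
      rw [e1]
      refine pot_step hτ0 (by positivity) hl rfl ?_ ?_ <;>
      · ring_nf at *; linarith) []
  rw [List.append_nil] at *
  have hu : ((uncov I F).card : ℝ) ≤ τ * (q * (l + 1)) := by
    have := hC.card_uncov_le (F := F) (m := l + 1) (q := q) (g := t) (by omega) hq fun i _ =>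
      (h4 _ (hC.isWalk_segment _ (by omega)) (by simp)).le
    have h5 : ((uncov I F).card : ℝ) ≤ q * t := by exact_mod_cast this
    rw [hτ] at h5
    linarith
  refine ⟨F, h1, h2, hu, ?_, h4⟩
  rw [uncov_nil] at h3
  rw [pot, if_pos hu] at h3
  exact h3

end KHWP


namespace KHWP
open Data (size rep)

variable {I : Inp} {k : ℕ}

/-! ### A short tree through the ends of the walks -/

theorem tab_spec (hk : 1 ≤ k) {C : Cfg} (hC : IsNode I k C) {i : ℕ} {w : List Cfg}
    (hw : w ∈ tab I k C i) : IsWalk I k w ∧ w.length = i + 1 ∧ lastOr w [] = C := by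
  induction i generalizing w with
  | zero =>
    simp [tab] at hw
    subst hw
    exact ⟨.single hC, rfl, by simp⟩
  | succ i ih =>
    rw [tab, Function.iterate_succ_apply'] at hw
    obtain ⟨D, hD, w', hw', h, rfl⟩ := mem_tabStep hw
    obtain ⟨h1, h2, h3⟩ := ih hw'
    have hD := (mem_nodes hk).1 hD
    rw [uadj_iff hD (h1.node _ (headOr_mem _ h1.ne_nil))] at h
    refine ⟨(IsWalk.single hD).append h1 (by simpa using h), by simp [h2], ?_⟩
    rw [← List.singleton_append, lastOr_append _ h1.ne_nil, h3]

/-- Keeping one walk per configuration loses no starting point: any walk from `E` to `C` can be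
extended by a step from `D` to `E`. -/
theorem exists_mem_tab (hk : 1 ≤ k) {C D : Cfg} {i : ℕ} (h : Reach I k i D C) :
    ∃ w ∈ tab I k C i, headOr w [] = D := by
  induction i generalizing D with
  | zero =>
    obtain ⟨w, h1, h2, h3, h4⟩ := h
    obtain ⟨A, rfl⟩ := List.length_eq_one_iff.1 h2
    exact ⟨[A], by simp [tab, ← h4], h3⟩
  | succ i ih =>
    obtain ⟨E, h1, h2, h3⟩ := reach_succ h
    obtain ⟨w, hw, hE⟩ := ih h3
    have hne : ((tab I k C i).filter fun w => uadj I k D (headOr w [])).map (fun w => D :: w) ≠ [] :=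
      List.ne_nil_of_mem (List.mem_map_of_mem (f := fun w => D :: w) (List.mem_filter.2 ⟨hw, by
        rw [hE, uadj_iff h1 h3.left]; exact h2⟩))
    rcases hl : ((tab I k C i).filter fun w => uadj I k D (headOr w [])).map fun w => D :: w with
      _ | ⟨w', ws⟩
    · exact absurd hl hne
    · refine ⟨w', ?_, ?_⟩
      · rw [tab, Function.iterate_succ_apply', ← tab]
        exact List.mem_flatMap.2 ⟨D, (mem_nodes hk).2 h1, by rw [hl]; simp [firstOf]⟩
      · have : w' ∈ ((tab I k C i).filter fun w => uadj I k D (headOr w [])).map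
            fun w => D :: w := by rw [hl]; simp
        obtain ⟨_, -, rfl⟩ := List.mem_map.1 this
        rfl

/-- Shows that the first entry of `links` comes from the smallest length for which there is a link.
-/
theorem flatMap_eq_cons {α : Type} {f : ℕ → List α} {w : α} {ws : List α} {l : List ℕ}
    (hl : l.Pairwise (· < ·)) (h : l.flatMap f = w :: ws) :
    ∃ i ∈ l, w ∈ f i ∧ ∀ j ∈ l, f j ≠ [] → i ≤ j := by
  induction l with
  | nil => simp at h
  | cons a l ih =>
    rw [List.pairwise_cons] at hl
    rw [List.flatMap_cons] at h
    rcases hf : f a with _ | ⟨x, xs⟩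
    · rw [hf, List.nil_append] at h
      obtain ⟨i, hi, h1, h2⟩ := ih hl.2 h
      exact ⟨i, by simp [hi], h1, by simpa [hf] using h2⟩
    · rw [hf, List.cons_append, List.cons.injEq] at h
      refine ⟨a, by simp, by simp [hf, h.1], ?_⟩
      simp only [List.mem_cons]
      rintro j (rfl | hj) _
      exacts [le_rfl, (hl.1 j hj).le]

/-- The configurations reached by a tree. -/
def heads (st : List (List Cfg)) : List Cfg := st.map fun w => headOr w []

/-- A tree on configurations in `T`: walks from a new configuration to an earlier one. -/
inductive Tree (I : Inp) (k : ℕ) (T : List Cfg) : List (List Cfg) → Prop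
  | root {r : Cfg} : r ∈ T → Tree I k T [[r]]
  | cons {st : List (List Cfg)} {p : List Cfg} : Tree I k T st → IsWalk I k p → headOr p [] ∈ T →
      headOr p [] ∉ heads st → lastOr p [] ∈ heads st → Tree I k T (p :: st)

theorem Tree.subset {T : List Cfg} {st : List (List Cfg)} (h : Tree I k T st) :
    heads st ⊆ T := by
  induction h with
  | root h => simpa [heads] using h
  | cons _ _ h _ _ ih => simpa [heads, h] using ih

theorem Tree.nodup {T : List Cfg} {st : List (List Cfg)} (h : Tree I k T st) :
    (heads st).Nodup := by
  induction h with
  | root h => simp [heads]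
  | cons _ _ _ h _ ih => exact List.nodup_cons.2 ⟨h, ih⟩

/-- The unit intervals between two times. -/
def gap (a b : ℕ) : Finset ℕ := Finset.Ico (min a b) (max a b)

theorem mem_gap {a b j : ℕ} : j ∈ gap a b ↔ min a b ≤ j ∧ j < max a b := Finset.mem_Ico

/-- Prim's algorithm on the time line. `A` holds the times of reached configurations, `B` those of
unreached ones, and `J` unit intervals through which every unreached time is connected to a reached
one. When `y₀` is reached next, the intervals between a closest pair `a`, `z` may be deleted from
`J`, and they pay for the link. That pair need not involve `y₀`: the link actually chosen is only
known to be no longer than the bound for any pair. -/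
theorem exchange {A : ℕ → Prop} {B : ℕ → Prop} {J : Finset ℕ}
    (hJ : ∀ y, B y → ∃ a, A a ∧ gap a y ⊆ J) {y₀ : ℕ} (hy₀ : B y₀) :
    ∃ a z, A a ∧ B z ∧ (J \ gap a z).card + (gap a z).card ≤ J.card ∧
      ∀ y, B y → ∃ b, (A b ∨ b = y₀) ∧ gap b y ⊆ J \ gap a z := by
  classical
  obtain ⟨a₀, ha₀, h0⟩ := hJ y₀ hy₀
  -- A closest pair inside the gap between `y₀` and the reached time `a₀` that serves it; such a
  -- pair has no relevant time strictly between.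
  have hP : ∃ d a z, A a ∧ B z ∧ gap a z ⊆ gap a₀ y₀ ∧ (gap a z).card = d :=
    ⟨_, a₀, y₀, ha₀, hy₀, Finset.Subset.refl _, rfl⟩
  obtain ⟨a, z, ha, hz, haz, hd⟩ := Nat.find_spec hP
  have hmin : ∀ a' z', A a' → B z' → gap a' z' ⊆ gap a₀ y₀ → (gap a z).card ≤ (gap a' z').card :=
    fun a' z' h1 h2 h3 => hd ▸ Nat.find_le ⟨a', z', h1, h2, h3, rfl⟩
  refine ⟨a, z, ha, hz, ?_, fun y hy => ?_⟩
  · rw [Finset.card_sdiff_add_card_eq_card (haz.trans h0)]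
  · obtain ⟨a', ha', h1⟩ := hJ y hy
    by_cases hdis : Disjoint (gap a' y) (gap a z)
    · exact ⟨a', Or.inl ha', fun j hj => Finset.mem_sdiff.2
        ⟨h1 hj, Finset.disjoint_left.1 hdis hj⟩⟩
    · obtain ⟨j₀, hj1, hj2⟩ := Finset.not_disjoint_iff.1 hdis
      have hj3 := haz hj2
      rw [mem_gap] at hj1 hj2 hj3
      have hcard : ∀ c d, (gap c d).card = max c d - min c d := fun c d => Nat.card_Ico _ _
      have hends : min a₀ y₀ ≤ min a z ∧ max a z ≤ max a₀ y₀ := by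
        have e1 := haz (mem_gap.2 ⟨le_rfl, by omega⟩)
        have e2 := haz (mem_gap (j := max a z - 1).2 ⟨by omega, by omega⟩)
        rw [mem_gap] at e1 e2
        omega
      have hout : ∀ x, (A x ∨ B x) → x ≤ min a z ∨ max a z ≤ x := by
        intro x hx
        by_contra hcon
        push Not at hcon
        rcases hx with hx | hx
        · have := hmin x z hx hz fun j hj => by rw [mem_gap] at *; omega
          rw [hcard, hcard] at this; omega
        · have := hmin a x ha hx fun j hj => by rw [mem_gap] at *; omega
          rw [hcard, hcard] at this; omega
      have e1 := hout a' (Or.inl ha')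
      have e2 := hout y (Or.inr hy)
      have hJ1 : ∀ j, min a' y ≤ j → j < max a' y → j ∈ J := fun j e f => h1 (mem_gap.2 ⟨e, f⟩)
      have hJ2 : ∀ j, min a₀ y₀ ≤ j → j < max a₀ y₀ → j ∈ J := fun j e f => h0 (mem_gap.2 ⟨e, f⟩)
      -- The deleted gap splits the line. A time on the side of `a` is connected to `a`. A time on
      -- the side of `z` is connected to `a₀` or `y₀`, whichever lies on that side; they lie on
      -- opposite sides, because their gap contains the deleted one.
      by_cases hside : (y ≤ min a z ↔ a ≤ min a z)
      · refine ⟨a, Or.inl ha, fun j hj => ?_⟩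
        rw [Finset.mem_sdiff, mem_gap] at *
        exact ⟨hJ1 j (by omega) (by omega), by omega⟩
      · by_cases hb : (a₀ ≤ min a z ↔ z ≤ min a z)
        · refine ⟨a₀, Or.inl ha₀, fun j hj => ?_⟩
          rw [Finset.mem_sdiff, mem_gap] at *
          refine ⟨?_, by omega⟩
          by_cases hjj : min a' y ≤ j ∧ j < max a' y
          · exact hJ1 j hjj.1 hjj.2
          · exact hJ2 j (by omega) (by omega)
        · refine ⟨y₀, Or.inr rfl, fun j hj => ?_⟩
          rw [Finset.mem_sdiff, mem_gap] at *
          refine ⟨?_, by omega⟩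
          by_cases hjj : min a' y ≤ j ∧ j < max a' y
          · exact hJ1 j hjj.1 hjj.2
          · exact hJ2 j (by omega) (by omega)

theorem card_gap (a b : ℕ) : (gap a b).card = max a b - min a b := Nat.card_Ico _ _

theorem Route.reach (hI : IsGraph I) {C : ℕ → Cfg} {L : ℕ} (h : Route I k C L) (a b : ℕ) :
    Reach I k (gap a b).card (C a) (C b) := by
  have key : ∀ a d, Reach I k d (C a) (C (a + d)) := by
    intro a d
    induction d generalizing a with
    | zero => exact .refl (h.node a)
    | succ d ih =>
      have := ih (a + 1)
      rw [add_assoc, add_comm 1 d] at this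
      exact .cons (h.node a) (h.adj a) this
  rw [card_gap]
  rcases le_total a b with hab | hab
  · have := key a (b - a)
    rw [Nat.add_sub_cancel' hab] at this
    simpa [hab] using this
  · have := (key b (a - b)).symm hI
    rw [Nat.add_sub_cancel' hab] at this
    simpa [hab] using this

theorem Route.reach_of_mem (hI : IsGraph I) {C : ℕ → Cfg} {L : ℕ} (h : Route I k C L)
    {D E : Cfg} (hD : IsNode I k D) (hE : IsNode I k E) {a b u v : ℕ} (hu : u ∈ D)
    (hu' : u ∈ C a) (hv : v ∈ E) (hv' : v ∈ C b) : Reach I k (2 * k + (gap a b).card) D E := by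
  have := ((Reach.of_mem hI hD (h.node a) hu hu').trans (h.reach hI a b)).trans
    (Reach.of_mem hI (h.node b) hE hv' hv)
  exact this.mono (by omega)

/-- The number of steps of the walks of a tree. -/
def treeCost (st : List (List Cfg)) : ℕ := (st.map fun p => p.length - 1).sum

/-- Configurations that meet the route at times `s` and `t` are at most `2 * k + |s - t|` steps
apart. This is within the range searched, as `|s - t| < L ≤ 2 * I.1 + 1`, so the shortest link
respects this bound for every pair. -/
theorem links_spec (hI : IsGraph I) (hk : 1 ≤ k) {C : ℕ → Cfg} {L : ℕ} (h : Route I k C L)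
    (hL : L ≤ 2 * I.1 + 1) {T : List Cfg} (hT : ∀ D ∈ T, IsNode I k D)
    {tm : Cfg → ℕ} (htm : ∀ D ∈ T, tm D < L ∧ ∃ u ∈ D, u ∈ C (tm D)) {st : List (List Cfg)}
    (hst : Tree I k T st) {z a : Cfg} (hz : z ∈ T) (hz' : z ∉ heads st) (ha : a ∈ heads st) :
    ∃ w ws, links I k T st = w :: ws ∧ Tree I k T (w :: st) ∧
      ∀ z a, z ∈ T → z ∉ heads st → a ∈ heads st →
        w.length - 1 ≤ 2 * k + (gap (tm a) (tm z)).card := by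
  have hlink : ∀ z a, z ∈ T → z ∉ heads st → a ∈ heads st →
      2 * k + (gap (tm a) (tm z)).card < I.1 + I.1 + (2 * k + 10) ∧
      ∃ w ∈ tab I k a (2 * k + (gap (tm a) (tm z)).card), headOr w [] = z := by
    intro z a hz hz' ha
    have haT := hst.subset ha
    obtain ⟨h1, u, hu, hu'⟩ := htm z hz
    obtain ⟨h2, v, hv, hv'⟩ := htm a haT
    refine ⟨?_, exists_mem_tab hk ((h.reach_of_mem hI (hT a haT) (hT z hz) hv hv' hu hu').symm hI)⟩
    rw [card_gap]; omega
  obtain ⟨h1, w₀, h2, h3⟩ := hlink z a hz hz' ha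
  have hm : w₀ ∈ links I k T st :=
    mem_links.2 ⟨_, h1, a, hst.subset ha, ha, h2, h3 ▸ hz, h3 ▸ hz'⟩
  rcases hl : links I k T st with _ | ⟨w, ws⟩
  · rw [hl] at hm; simp at hm
  · refine ⟨w, ws, rfl, ?_, ?_⟩
    · obtain ⟨i, hi, D, hD, h4, h5, h6, h7⟩ := mem_links.1 (hl ▸ List.mem_cons_self :
        w ∈ links I k T st)
      obtain ⟨h8, h9, h10⟩ := tab_spec hk (hT D hD) h5
      exact .cons hst h8 h6 h7 (h10 ▸ h4)
    · intro z a hz hz' ha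
      rw [links] at hl
      obtain ⟨i, hi, h4, h5⟩ := flatMap_eq_cons List.pairwise_lt_range hl
      obtain ⟨h6, w', h7, h8⟩ := hlink z a hz hz' ha
      have h9 := h5 _ (List.mem_range.2 h6) (List.ne_nil_of_mem (a := w') (List.mem_flatMap.2
        ⟨a, List.mem_filter.2 ⟨hst.subset ha, memB_iff.2 ha⟩, List.mem_filter.2 ⟨h7, by
          rw [h8]
          simp only [Bool.and_eq_true, memB_iff, Bool.not_eq_true', ← Bool.not_eq_true]
          exact ⟨hz, hz'⟩⟩⟩))
      obtain ⟨D, hD, h10⟩ := List.mem_flatMap.1 h4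
      obtain ⟨-, h11, -⟩ := tab_spec hk (hT D (List.mem_filter.1 hD).1) (List.mem_filter.1 h10).1
      omega

/-- Invariant: the cost so far plus the intervals still in `J` is at most `L - 1` plus `2 * k` per
round. Distances to the route add the `2 * k`; the remaining length of a link is paid from `J`. -/
theorem prim_spec (hI : IsGraph I) (hk : 1 ≤ k) {C : ℕ → Cfg} {L : ℕ} (h : Route I k C L)
    (hL : L ≤ 2 * I.1 + 1) {T : List Cfg} (hT : ∀ D ∈ T, IsNode I k D) (hne : T ≠ []) :
    Tree I k T (prim I k T) ∧ T ⊆ heads (prim I k T) ∧ (prim I k T).length ≤ T.length + 1 ∧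
      treeCost (prim I k T) ≤ L - 1 + 2 * k * T.length := by
  classical
  have hex : ∀ D, ∃ t, D ∈ T → t < L ∧ ∃ u ∈ D, u ∈ C t := by
    intro D
    by_cases hD : D ∈ T
    · obtain ⟨u, hu⟩ := List.exists_mem_of_ne_nil D (hT D hD).1.ne_nil
      obtain ⟨t, ht, hut⟩ := h.cover u ((hT D hD).1.lt u hu)
      exact ⟨t, fun _ => ⟨ht, u, hu, hut⟩⟩
    · exact ⟨0, fun h => absurd h hD⟩
  choose tm htm using hex
  have key : ∀ j, ∃ st, (primStep I k T)^[j] [[headOr T []]] = st ∧ Tree I k T st ∧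
      st.length ≤ j + 1 ∧ (T ⊆ heads st ∨ j + 1 ≤ st.length) ∧
      ∃ J : Finset ℕ, treeCost st + J.card ≤ L - 1 + 2 * k * j ∧
        ∀ y, (∃ z ∈ T, z ∉ heads st ∧ tm z = y) → ∃ a, (∃ x ∈ heads st, tm x = a) ∧ gap a y ⊆ J := by
    intro j
    induction j with
    | zero =>
      -- At the start `J` consists of all `L - 1` unit intervals between the `L` times.
      refine ⟨_, rfl, .root (headOr_mem _ hne), by simp, Or.inr (by simp), Finset.range (L - 1),
        by simp [treeCost], ?_⟩
      rintro y ⟨z, hz, -, rfl⟩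
      refine ⟨_, ⟨headOr T [], by simp [heads], rfl⟩, fun j hj => ?_⟩
      have h1 := (htm z hz).1
      have h2 := (htm _ (headOr_mem [] hne)).1
      rw [mem_gap] at hj
      rw [Finset.mem_range]; omega
    | succ j ih =>
      obtain ⟨st, h1, h2, h3, h4, J, h5, h6⟩ := ih
      rw [Function.iterate_succ_apply', h1]
      have hmul : 2 * k * (j + 1) = 2 * k * j + 2 * k := by ring
      by_cases hall : T ⊆ heads st
      · have hnil : links I k T st = [] := by
          rw [List.eq_nil_iff_forall_not_mem]
          intro w hw
          obtain ⟨i, hi, D, hD, h4, h5, h6, h7⟩ := mem_links.1 hw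
          exact h7 (hall h6)
        refine ⟨st, by rw [primStep, hnil, listCase_nil], h2, by omega, Or.inl hall, J, by omega, h6⟩
      · obtain ⟨z₀, hz₀, hz₀'⟩ : ∃ z, z ∈ T ∧ z ∉ heads st := by
          by_contra hcon; push Not at hcon; exact hall hcon
        obtain ⟨_, ⟨a₀, ha₀, -⟩, -⟩ := h6 _ ⟨z₀, hz₀, hz₀', rfl⟩
        obtain ⟨w, ws, hl, hw, hmin⟩ := links_spec hI hk h hL hT htm h2 hz₀ hz₀' ha₀
        cases hw with
        | root _ => cases h2
        | cons _ hw1 hw2 hw3 hw4 =>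
        obtain ⟨_, _, ⟨a, ha, rfl⟩, ⟨z, hz, hz', rfl⟩, h7, h8⟩ := exchange h6
          ⟨headOr w [], hw2, hw3, rfl⟩
        have h9 := hmin z a hz hz' ha
        refine ⟨w :: st, by rw [primStep, hl, listCase_cons], .cons h2 hw1 hw2 hw3 hw4, by simpa,
          Or.inr (by rcases h4 with h4 | h4; exacts [absurd h4 hall, by simpa]),
          J \ gap (tm a) (tm z), ?_, ?_⟩
        · simp only [treeCost, List.map_cons, List.sum_cons] at h5 ⊢
          omega
        · rintro y ⟨x, hx, hx', rfl⟩
          obtain ⟨b, hb, hb'⟩ := h8 (tm x) ⟨x, hx, fun h => hx' (by simp [heads] at h ⊢; exact Or.inr h),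
            rfl⟩
          refine ⟨b, ?_, hb'⟩
          rcases hb with ⟨c, hc, rfl⟩ | rfl
          · exact ⟨c, by simp [heads] at hc ⊢; exact Or.inr hc, rfl⟩
          · exact ⟨headOr w [], by simp [heads], rfl⟩
  obtain ⟨st, h1, h2, h3, h4, J, h5, h6⟩ := key T.length
  rw [prim, h1]
  refine ⟨h2, ?_, h3, by omega⟩
  rcases h4 with h4 | h4
  · exact h4
  · exfalso
    have := (List.subperm_of_subset h2.nodup h2.subset).length_le
    simp [heads] at this
    omega

/-! ### Closing the walks along the tree -/

/-- A walk that is closed or has both ends in `A`. -/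
def Ends (I : Inp) (k : ℕ) (A : List Cfg) (w : List Cfg) : Prop :=
  IsWalk I k w ∧ (headOr w [] = lastOr w [] ∨ headOr w [] ∈ A ∧ lastOr w [] ∈ A)

/-- While the walks with an end at `y` are paired up. -/
def Pairing (I : Inp) (k : ℕ) (y : Cfg) (A : List Cfg) (c : List Cfg × List (List Cfg)) : Prop :=
  (c.1 = [] ∨ IsWalk I k c.1 ∧ lastOr c.1 [] = y ∧ headOr c.1 [] ∈ A) ∧ ∀ w ∈ c.2, Ends I k A w

theorem pairUp_spec (hI : IsGraph I) {y : Cfg} {A : List Cfg} {c : List Cfg × List (List Cfg)}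
    (hc : Pairing I k y A c) {w : List Cfg} (hw : IsWalk I k w) (h1 : lastOr w [] = y)
    (h2 : headOr w [] ∈ A) : Pairing I k y A (pairUp c w) := by
  obtain ⟨u, O⟩ := c
  cases u with
  | nil => exact ⟨Or.inr ⟨hw, h1, h2⟩, hc.2⟩
  | cons D u =>
    obtain ⟨hu, hO⟩ := hc
    rcases hu with hu | ⟨hu1, hu2, hu3⟩
    · simp at hu
    · simp only at hu1 hu2 hu3
      have hw' := hw.reverse hI
      refine ⟨Or.inl rfl, fun x hx => ?_⟩
      simp only [pairUp, listCase_cons, List.mem_cons] at hx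
      rcases hx with rfl | hx
      · refine ⟨hu1.append hw' (by rw [hu2, headOr_reverse, h1]; exact .refl y), Or.inr ?_⟩
        rw [headOr_append hu1.ne_nil, lastOr_append _ hw'.ne_nil, lastOr_reverse]
        exact ⟨hu3, h2⟩
      · exact hO x hx

theorem absorb_spec (hI : IsGraph I) {y : Cfg} {A : List Cfg} {c : List Cfg × List (List Cfg)}
    (hc : Pairing I k y A c) {w : List Cfg} (hw : Ends I k (y :: A) w) :
    Pairing I k y A (absorb y c w) := by
  have hadd : Ends I k A w → Pairing I k y A (c.1, w :: c.2) := fun h =>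
    ⟨hc.1, by simpa [h] using hc.2⟩
  simp only [absorb, cond_eq_ite, decide_eq_true_eq]
  split_ifs with h1 h2 h3
  · exact hadd ⟨hw.1, Or.inl h1⟩
  · obtain ⟨h3, -⟩ := hw.2.resolve_left h1
    exact pairUp_spec hI hc hw.1 h2 ((List.mem_cons.1 h3).resolve_left fun h => h1 (h.trans h2.symm))
  · obtain ⟨-, h4⟩ := hw.2.resolve_left h1
    exact pairUp_spec hI hc (hw.1.reverse hI) (by simpa using h3)
      (by simpa using (List.mem_cons.1 h4).resolve_left h2)
  · obtain ⟨h4, h5⟩ := hw.2.resolve_left h1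
    exact hadd ⟨hw.1, Or.inr ⟨(List.mem_cons.1 h4).resolve_left h3,
      (List.mem_cons.1 h5).resolve_left h2⟩⟩

theorem foldl_absorb_spec (hI : IsGraph I) {y : Cfg} {A : List Cfg} {O : List (List Cfg)}
    (hO : ∀ w ∈ O, Ends I k (y :: A) w) {c : List Cfg × List (List Cfg)}
    (hc : Pairing I k y A c) : Pairing I k y A (O.foldl (absorb y) c) := by
  induction O generalizing c with
  | nil => exact hc
  | cons w O ih =>
    exact ih (fun x hx => hO x (by simp [hx])) (absorb_spec hI hc (hO w (by simp)))

/-- The total length of a family of walks. -/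
def total (F : List (List Cfg)) : ℕ := (F.map List.length).sum

theorem pairUp_measure (c : List Cfg × List (List Cfg)) (w : List Cfg) :
    total ((pairUp c w).1 :: (pairUp c w).2) = total (c.1 :: c.2) + w.length ∧
      (pairUp c w).2.length ≤ c.2.length + 1 ∧
      ∀ C, (C ∈ w ∨ ∃ x ∈ c.1 :: c.2, C ∈ x) → ∃ x ∈ (pairUp c w).1 :: (pairUp c w).2, C ∈ x := by
  obtain ⟨u, O⟩ := c
  cases u with
  | nil => simp [pairUp, total]; omega
  | cons D u =>
    refine ⟨by simp [pairUp, total]; omega, by simp [pairUp], fun C hC => ?_⟩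
    simp [pairUp] at hC ⊢
    tauto

theorem absorb_measure (y : Cfg) (c : List Cfg × List (List Cfg)) (w : List Cfg) :
    total ((absorb y c w).1 :: (absorb y c w).2) = total (c.1 :: c.2) + w.length ∧
      (absorb y c w).2.length ≤ c.2.length + 1 ∧
      ∀ C, (C ∈ w ∨ ∃ x ∈ c.1 :: c.2, C ∈ x) → ∃ x ∈ (absorb y c w).1 :: (absorb y c w).2, C ∈ x := by
  have h1 := pairUp_measure c w
  have h2 := pairUp_measure c w.reverse
  simp only [List.length_reverse, List.mem_reverse] at h2
  have h3 : total (c.1 :: w :: c.2) = total (c.1 :: c.2) + w.length := by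
    simp [total]; omega
  simp only [absorb, cond_eq_ite, decide_eq_true_eq]
  split_ifs
  · refine ⟨h3, by simp, fun C hC => ?_⟩
    simp at hC ⊢; tauto
  · exact h1
  · exact h2
  · refine ⟨h3, by simp, fun C hC => ?_⟩
    simp at hC ⊢; tauto

theorem foldl_absorb_measure (y : Cfg) (O : List (List Cfg)) (c : List Cfg × List (List Cfg)) :
    total ((O.foldl (absorb y) c).1 :: (O.foldl (absorb y) c).2) = total (c.1 :: c.2) + total O ∧
      (O.foldl (absorb y) c).2.length ≤ c.2.length + O.length ∧
      ∀ C, (∃ x ∈ c.1 :: (c.2 ++ O), C ∈ x) →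
        ∃ x ∈ (O.foldl (absorb y) c).1 :: (O.foldl (absorb y) c).2, C ∈ x := by
  induction O generalizing c with
  | nil => simp [total]
  | cons w O ih =>
    obtain ⟨h1, h2, h3⟩ := ih (absorb y c w)
    obtain ⟨h4, h5, h6⟩ := absorb_measure y c w
    rw [List.foldl_cons]
    refine ⟨?_, by simp; omega, fun C hC => h3 C ?_⟩
    · rw [h1, h4]; simp [total]; omega
    · obtain ⟨x, hx, hCx⟩ := hC
      simp only [List.mem_cons, List.mem_append] at hx ⊢
      by_cases hxO : x ∈ O
      · exact ⟨x, Or.inr (Or.inr hxO), hCx⟩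
      · obtain ⟨z, hz, hCz⟩ := h6 C (by
          by_cases hxw : x = w
          · exact Or.inl (hxw ▸ hCx)
          · exact Or.inr ⟨x, by simp only [List.mem_cons]; tauto, hCx⟩)
        exact ⟨z, (List.mem_cons.1 hz).imp_right Or.inl, hCz⟩

theorem closeStep_measure (O : List (List Cfg)) (p : List Cfg) :
    total (closeStep O p) ≤ total O + p.length ∧ (closeStep O p).length ≤ O.length + 1 ∧
      ∀ C, (∃ x ∈ O, C ∈ x) → ∃ x ∈ closeStep O p, C ∈ x := by
  obtain ⟨h1, h2, h3⟩ := foldl_absorb_measure (headOr p []) O ([], [])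
  simp only [closeStep]
  generalize O.foldl (absorb (headOr p [])) ([], []) = c at *
  obtain ⟨u, O'⟩ := c
  cases u with
  | nil =>
    simp [total] at h1 h2 h3 ⊢
    exact ⟨by omega, by omega, h3⟩
  | cons D u =>
    simp [total] at h1 h2 h3 ⊢
    refine ⟨by omega, by omega, fun C x hx hC => ?_⟩
    rcases h3 C x hx hC with h | h <;> tauto

/-- Open walks ending at the start of `p` are joined in pairs there, and a single one left over is
led along `p` to the parent. At the root `A` is empty and nothing can be left over, as the other end
of such a walk would have to lie in `A`. -/
theorem closeStep_spec (hI : IsGraph I) {A : List Cfg} {O : List (List Cfg)} {p : List Cfg}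
    (hp : IsWalk I k p) (hl : lastOr p [] ∈ A ∨ A = [])
    (hO : ∀ w ∈ O, Ends I k (headOr p [] :: A) w) : ∀ w ∈ closeStep O p, Ends I k A w := by
  have h := foldl_absorb_spec hI hO (c := ([], [])) ⟨Or.inl rfl, by simp⟩
  intro w
  simp only [closeStep]
  generalize O.foldl (absorb (headOr p [])) ([], []) = c at *
  obtain ⟨u, O'⟩ := c
  obtain ⟨h1, h2⟩ := h
  cases u with
  | nil => exact h2 w
  | cons D u =>
    rcases h1 with h1 | ⟨h1, h3, h4⟩
    · simp at h1
    simp only [listCase_cons, List.mem_cons] at h1 h3 h4 ⊢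
    rintro (rfl | hw)
    · refine ⟨h1.append hp (h3 ▸ .refl _), Or.inr ?_⟩
      rw [headOr_append h1.ne_nil, lastOr_append _ hp.ne_nil]
      rcases hl with hl | hl
      · exact ⟨h4, hl⟩
      · rw [hl] at h4; simp at h4
    · exact h2 w hw

/-- The tree is processed from the latest node to the root, so each configuration comes before its
parent. Open ends retreat towards the root, and each tree walk is used at most once. An open walk
has two different ends, so none survives when only the root remains. -/
theorem foldl_closeStep_spec (hI : IsGraph I) {T : List Cfg} (hT : ∀ D ∈ T, IsNode I k D)
    {st O : List (List Cfg)} (hst : Tree I k T st) (hO : ∀ w ∈ O, Ends I k (heads st) w) :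
    (∀ w ∈ st.foldl closeStep O, IsLoop I k w) ∧
      total (st.foldl closeStep O) ≤ total O + total st ∧
      (st.foldl closeStep O).length ≤ O.length + st.length ∧
      ∀ C, (∃ x ∈ O, C ∈ x) → ∃ x ∈ st.foldl closeStep O, C ∈ x := by
  induction hst generalizing O with
  | @root r hr =>
    have h1 := closeStep_spec hI (A := []) (IsWalk.single (hT r hr)) (Or.inr rfl) hO
    obtain ⟨h2, h3, h4⟩ := closeStep_measure O [r]
    refine ⟨fun w hw => ?_, by simpa [total] using h2, by simpa using h3, h4⟩
    obtain ⟨h5, h6⟩ := h1 w hw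
    rcases h6 with h6 | h6
    · exact ⟨h5, h6 ▸ .refl _⟩
    · simp at h6
  | @cons st p h1 h2 h3 h4 h5 ih =>
    obtain ⟨h6, h7, h8, h9⟩ := ih (closeStep_spec hI h2 (Or.inl h5) hO)
    obtain ⟨h10, h11, h12⟩ := closeStep_measure O p
    rw [List.foldl_cons]
    refine ⟨h6, ?_, by simp; omega, fun C hC => h9 C (h12 C hC)⟩
    simp only [total, List.map_cons, List.sum_cons] at *
    omega

theorem treeCost_add_length {T : List Cfg} {st : List (List Cfg)} (h : Tree I k T st) :
    total st = treeCost st + st.length := by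
  induction h with
  | root => simp [total, treeCost]
  | cons _ h _ _ _ ih =>
    have := List.length_pos_iff.2 h.ne_nil
    simp [total, treeCost] at *
    omega

/-- There are two ends per walk, so the tree has at most `2 * F.length + 1` members and costs at
most `L - 1` plus `4 * k` steps per walk. -/
theorem closeUp_spec (hI : IsGraph I) (hk : 1 ≤ k) {C : ℕ → Cfg} {L : ℕ} (h : Route I k C L)
    (hL : L ≤ 2 * I.1 + 1) {F : List (List Cfg)} (hF : ∀ w ∈ F, IsWalk I k w) :
    (∀ w ∈ closeUp I k F, IsLoop I k w) ∧
      total (closeUp I k F) ≤ total F + L + (4 * k + 2) * F.length ∧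
      (closeUp I k F).length ≤ 4 * F.length ∧ uncov I (closeUp I k F) ⊆ uncov I F := by
  rcases eq_or_ne F [] with rfl | hne
  · have : closeUp I k [] = [] := rfl
    rw [this]
    exact ⟨by simp, by simp [total], by simp, Finset.Subset.refl _⟩
  · have hlen : (ends F).length = 2 * F.length := by simp [ends, List.length_flatMap]; omega
    have hpos := List.length_pos_iff.2 hne
    have hT : ∀ D ∈ ends F, IsNode I k D := by
      intro D hD
      obtain ⟨w, hw, hD⟩ := List.mem_flatMap.1 hD
      have h1 := (hF w hw).node _ (headOr_mem [] (hF w hw).ne_nil)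
      have h2 := (hF w hw).node _ (lastOr_mem [] (hF w hw).ne_nil)
      simp at hD
      rcases hD with rfl | rfl <;> assumption
    obtain ⟨h1, h2, h3, h4⟩ := prim_spec hI hk h hL hT (fun h0 => by
      rw [h0, List.length_nil] at hlen; omega)
    have hE : ∀ w ∈ F, Ends I k (heads (prim I k (ends F))) w := fun w hw =>
      ⟨hF w hw, Or.inr ⟨h2 (List.mem_flatMap.2 ⟨w, hw, by simp⟩),
        h2 (List.mem_flatMap.2 ⟨w, hw, by simp⟩)⟩⟩
    obtain ⟨h5, h6, h7, h8⟩ := foldl_closeStep_spec hI hT h1 hE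
    rw [treeCost_add_length h1] at h6
    have hL0 : 1 ≤ L := by
      obtain ⟨w, hw⟩ := List.exists_mem_of_ne_nil F hne
      have hn := (hF w hw).node _ (headOr_mem [] (hF w hw).ne_nil)
      obtain ⟨u, hu⟩ := List.exists_mem_of_ne_nil _ hn.1.ne_nil
      obtain ⟨t, ht, -⟩ := h.cover u (hn.1.lt u hu)
      omega
    rw [hlen] at h3 h4
    refine ⟨h5, ?_, ?_, fun v hv => ?_⟩
    · have e : (4 * k + 2) * F.length = 2 * k * (2 * F.length) + 2 * F.length := by ring
      rw [closeUp, e]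
      omega
    · rw [closeUp]; omega
    · rw [mem_uncov, ← Bool.not_eq_true, covF_iff] at *
      refine ⟨hv.1, fun ⟨w, hw, hc⟩ => hv.2 ?_⟩
      obtain ⟨D, hD, hvD⟩ := covB_iff.1 hc
      obtain ⟨x, hx, hDx⟩ := h8 D ⟨w, hw, hD⟩
      exact ⟨x, hx, covB_iff.2 ⟨D, hDx, hvD⟩⟩

end KHWP


namespace KHWP
open Data (size rep)

variable {I : Inp} {k : ℕ}

/-! ### The approximation guarantee for one agent and for at least three agents -/

theorem Route.card_le {C : ℕ → Cfg} {L : ℕ} (h : Route I k C L) : I.1 ≤ k * L := by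
  have hsub : Finset.range I.1 ⊆ (Finset.range L).biUnion fun t => (C t).toFinset := by
    intro v hv
    obtain ⟨t, ht, hvt⟩ := h.cover v (Finset.mem_range.1 hv)
    exact Finset.mem_biUnion.2 ⟨t, Finset.mem_range.2 ht, by simpa using hvt⟩
  have h1 := (Finset.card_le_card hsub).trans Finset.card_biUnion_le
  rw [Finset.card_range] at h1
  refine h1.trans ((Finset.sum_le_card_nsmul _ _ k fun t _ => ?_).trans
    (by simp [mul_comm]))
  exact (List.toFinset_card_le _).trans (h.node t).2.le

/-- Comparison with a shortest covering walk suffices, and that one is no longer than the walk of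
single visits, which gives `L ≤ 2 * I.1 + 1`. -/
theorem exists_isPolyTimeApprox_of_route (hk : 1 ≤ k) {ρ : ℝ} (hρ : 1 ≤ ρ)
    {f : Inp → List Cfg} (hf : PC f) (n₀ : ℕ)
    (h : ∀ I, IsGraph I → k ≤ I.1 → n₀ ≤ I.1 → ∀ C L, Route I k C L → L ≤ 2 * I.1 + 1 →
      IsWalk I k (f I) ∧ Covers I (f I) ∧ ((f I).length - 1 : ℝ) ≤ ρ * (L - 1)) :
    ∃ P, IsPolyTimeApprox k ρ P := by
  refine exists_isPolyTimeApprox_of_eventually hk hρ hf n₀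
    (fun I hI hn => ⟨_, (join_nil_spec hI hk hn).1, (join_nil_spec hI hk hn).2.1⟩)
    fun I hI hn hn₀ => ?_
  obtain ⟨h1, h2, h3⟩ := join_nil_spec hI hk hn
  obtain ⟨w₀, h4, h5, h6⟩ := exists_shortest h1 h2
  obtain ⟨C, hC⟩ := exists_route h4 h5
  obtain ⟨h7, h8, h9⟩ := h I hI hn hn₀ C _ hC ((h6 _ h1 h2).trans (by omega))
  refine ⟨h7, h8, fun w hw hc => h9.trans ?_⟩
  have : (w₀.length : ℝ) ≤ w.length := by exact_mod_cast h6 w hw hc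
  exact mul_le_mul_of_nonneg_left (by linarith) (by linarith)

/-- Single visits take at most `2 * (n - 1)` steps, and one agent needs at least `n` configurations.
-/
theorem exists_approx_one : ∃ P, IsPolyTimeApprox 1 (2 * (1 + Real.log (1 : ℕ))) P := by
  rw [Nat.cast_one, Real.log_one, add_zero, mul_one]
  refine exists_isPolyTimeApprox_of_route le_rfl (by norm_num) (f := fun I => join I 1 [])
    (by fun_prop) 0 fun I hI hn _ C L hC _ => ?_
  obtain ⟨h1, h2, h3⟩ := join_nil_spec hI le_rfl hn
  refine ⟨h1, h2, ?_⟩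
  have h4 := hC.card_le
  have h5 : (join I 1 []).length + 1 ≤ 2 * L := by omega
  have h6 : ((join I 1 []).length : ℝ) + 1 ≤ 2 * L := by exact_mod_cast h5
  linarith

theorem pot_le {τ Q x c : ℝ} (hτ : 1 ≤ τ) (hQ : 0 < Q) (hx : 0 ≤ x) (hc : 1 ≤ c)
    (h : x ≤ c * Q) : pot τ Q x ≤ Q * (1 + Real.log c) := by
  have hlc : 0 ≤ Real.log c := Real.log_nonneg hc
  rw [pot]
  split_ifs with h1
  · have : x / τ ≤ Q := by rw [div_le_iff₀ (by linarith)]; linarith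
    nlinarith
  · push Not at h1
    have hx0 : 0 < x / (τ * Q) := by
      have : 0 < τ * Q := by positivity
      exact div_pos (this.trans h1) this
    have : Real.log (x / (τ * Q)) ≤ Real.log c := by
      refine Real.log_le_log hx0 ?_
      rw [div_le_iff₀ (by positivity)]
      nlinarith [mul_nonneg (by linarith : (0:ℝ) ≤ c) hQ.le]
    nlinarith

/-- The number of blocks of `l + 1` configurations. -/
theorem exists_blocks (L l : ℕ) (hL : 1 ≤ L) :
    ∃ q, 1 ≤ q ∧ L ≤ q * (l + 1) ∧ q * (l + 1) ≤ L + l := by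
  refine ⟨(L + l) / (l + 1), ?_, ?_, Nat.div_mul_le_self _ _⟩
  · exact (Nat.one_le_div_iff (by omega)).2 (by omega)
  · have := Nat.lt_div_mul_add (a := L + l) (b := l + 1) (by omega)
    omega

theorem sum_map_add_const (F : List (List Cfg)) (c : ℕ) :
    (F.map fun Z => Z.length + c).sum = total F + c * F.length := by
  induction F with
  | nil => simp [total]
  | cons Z F ih =>
    simp only [total, List.map_cons, List.sum_cons, List.length_cons] at *
    rw [ih]; ring

theorem total_eq {F : List (List Cfg)} {l : ℕ} (h : ∀ w ∈ F, w.length = l) :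
    total F = F.length * l := by
  induction F with
  | nil => simp [total]
  | cons w F ih =>
    have h1 := ih fun x hx => h x (by simp [hx])
    simp only [total, List.map_cons, List.sum_cons, List.length_cons] at *
    rw [h1, h w (by simp)]; ring

/-- The tree contributes the first `L`. Walk lengths plus leftovers are at most `(L + l) * (1 + log
k)` by the potential; leftovers cost two steps each and number at most `L + l`, which adds another
`L + l`. Per walk there remain `4 * k + 2` for the tree and `2 * (k + 1)` for each of at most four
loops, together `12 * k + 10`. -/
theorem join_closeUp_greedy_le (hI : IsGraph I) (hk : 1 ≤ k) (hn : k ≤ I.1) {C : ℕ → Cfg}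
    {L : ℕ} (hC : Route I k C L) (hL : L ≤ 2 * I.1 + 1) (l : ℕ) :
    IsWalk I k (join I k (closeUp I k (greedy I k l (l + 1) []))) ∧
    Covers I (join I k (closeUp I k (greedy I k l (l + 1) []))) ∧
    ((join I k (closeUp I k (greedy I k l (l + 1) []))).length - 1 : ℝ) ≤
      L + (L + l) * (2 + Real.log k + (12 * k + 10) * (1 + Real.log k) / (l + 1)) := by
  have hL1 : 1 ≤ L := by
    have := hC.card_le
    rcases Nat.eq_zero_or_pos L with h | h
    · subst h; omega
    · exact h
  obtain ⟨q, hq1, hq2, hq3⟩ := exists_blocks L l hL1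
  obtain ⟨F, hF, h1, h2, h3, -⟩ := greedy_bound hk hC (τ := 1) (t := l + 1) (by omega)
    (by push_cast; ring) hq2 hq1
  rw [hF]
  obtain ⟨h4, h5, h6, h7⟩ := closeUp_spec hI hk hC hL fun w hw => (h1 w hw).1
  obtain ⟨h8, h9, h10⟩ := join_spec hI hk hn h4
  refine ⟨h8, h9, ?_⟩
  rw [sum_map_add_const] at h10
  rw [total_eq fun w hw => (h1 w hw).2] at h5
  have h11 := Finset.card_le_card h7
  have h12 : (join I k (closeUp I k F)).length ≤ 1 + (F.length * (l + 1) + L +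
      (4 * k + 2) * F.length + 2 * (k + 1) * (4 * F.length)) + 2 * (uncov I F).card :=
    h10.trans (by gcongr)
  have h13 : ((join I k (closeUp I k F)).length : ℝ) ≤ 1 + (F.length * (l + 1) + L +
      (4 * k + 2) * F.length + 2 * (k + 1) * (4 * F.length)) + 2 * (uncov I F).card := by
    exact_mod_cast h12
  have hl : (0 : ℝ) < l + 1 := by positivity
  have hQ : (0 : ℝ) < q * (l + 1) := by
    have : (0 : ℝ) < q := by exact_mod_cast hq1
    positivity
  have hQL : (q * (l + 1) : ℝ) ≤ L + l := by exact_mod_cast hq3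
  have hk1 : (1 : ℝ) ≤ k := by exact_mod_cast hk
  have hlk : 0 ≤ Real.log k := Real.log_nonneg hk1
  have hpot := pot_le (τ := 1) (x := I.1) le_rfl hQ (by positivity) hk1 (by
    have e1 : (I.1 : ℝ) ≤ k * L := by exact_mod_cast hC.card_le
    have e2 : (L : ℝ) ≤ q * (l + 1) := by exact_mod_cast hq2
    nlinarith)
  rw [one_mul] at h2
  rw [div_one] at h3
  have hA : (q * (l + 1) : ℝ) * (1 + Real.log k) ≤ (L + l) * (1 + Real.log k) :=
    mul_le_mul_of_nonneg_right hQL (by linarith)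
  have hm : (F.length : ℝ) ≤ (L + l) * (1 + Real.log k) / (l + 1) := by
    rw [le_div_iff₀ hl]
    have : (0 : ℝ) ≤ (uncov I F).card := by positivity
    linarith
  have hm2 := mul_le_mul_of_nonneg_left hm (show (0 : ℝ) ≤ 12 * k + 10 by positivity)
  have e : (L + l : ℝ) * (2 + Real.log k + (12 * k + 10) * (1 + Real.log k) / (l + 1)) =
      (L + l) * (1 + Real.log k) + (L + l) +
        (12 * k + 10) * ((L + l) * (1 + Real.log k) / (l + 1)) := by ring
  rw [e]
  nlinarith

/-- With `c = log k` the main term is `3 + c` against the allowed `2 + 2 * c`. The slack `c - 1` is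
positive because `3 > e`. Half of it absorbs the cost per walk, through the choice of `l`, and half
the additive terms, through the choice of `n₀`. -/
theorem exists_approx_of_three_le (hk : 3 ≤ k) :
    ∃ P, IsPolyTimeApprox k (2 * (1 + Real.log k)) P := by
  have hk3 : (3 : ℝ) ≤ k := by exact_mod_cast hk
  have hlog : 1 < Real.log k := by
    rw [Real.lt_log_iff_exp_lt (by linarith)]
    exact (Real.exp_one_lt_d9.trans (by norm_num)).trans_le hk3
  set c := Real.log k with hc
  obtain ⟨l, hl⟩ := exists_nat_gt (2 * ((12 * k + 10) * (1 + c)) / (c - 1))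
  have hl1 : (12 * k + 10) * (1 + c) / (l + 1) ≤ (c - 1) / 2 := by
    rw [div_lt_iff₀ (by linarith)] at hl
    rw [div_le_div_iff₀ (by positivity) (by norm_num)]
    nlinarith
  -- Large `n` forces large `L` by `n ≤ k * L`; this value makes `(L - 1) * (c - 1) / 2` exceed all
  -- terms that do not grow with `L`.
  obtain ⟨n₀, hn₀⟩ := exists_nat_gt
    (k * (1 + (2 * (1 + c) + (l : ℝ) * (2 + c + (c - 1) / 2)) / ((c - 1) / 2)))
  refine exists_isPolyTimeApprox_of_route (by omega) (by linarith)
    (f := fun I => join I k (closeUp I k (greedy I k l (l + 1) []))) (by fun_prop) n₀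
    fun I hI hn hn' C L hC hL => ?_
  obtain ⟨h1, h2, h3⟩ := join_closeUp_greedy_le hI (by omega) hn hC hL l
  refine ⟨h1, h2, h3.trans ?_⟩
  have h4 : (I.1 : ℝ) ≤ k * L := by exact_mod_cast hC.card_le
  have h5 : (n₀ : ℝ) ≤ I.1 := by exact_mod_cast hn'
  have h6 : 1 + (2 * (1 + c) + (l : ℝ) * (2 + c + (c - 1) / 2)) / ((c - 1) / 2) < L := by
    have := hn₀.trans_le (h5.trans h4)
    exact lt_of_mul_lt_mul_left this (by linarith)
  have h7 : (2 * (1 + c) + (l : ℝ) * (2 + c + (c - 1) / 2)) < (L - 1) * ((c - 1) / 2) := by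
    rw [← div_lt_iff₀ (by linarith)]; linarith
  have hLl : (0 : ℝ) ≤ L + l := by positivity
  have h8 := mul_le_mul_of_nonneg_left hl1 hLl
  nlinarith

end KHWP


namespace KHWP
open Data (size rep)

variable {I : Inp} {k : ℕ}

/-! ### Detours for two agents -/

theorem IsLoop.insert {W₁ W₂ w : List Cfg} {C : Cfg} (h : IsLoop I k (W₁ ++ C :: W₂))
    (hw : IsWalk I k w) (h1 : headOr w [] = C) (h2 : lastOr w [] = C) :
    IsLoop I k (W₁ ++ (w ++ W₂)) := by
  refine ⟨h.toIsWalk.insert hw h1 h2, ?_⟩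
  have hl : lastOr (W₁ ++ (w ++ W₂)) [] = lastOr (W₁ ++ C :: W₂) [] := by
    rw [lastOr_append _ (by simp [hw.ne_nil]), lastOr_append _ (List.cons_ne_nil _ _)]
    rcases eq_or_ne W₂ [] with rfl | hW
    · simpa using h2
    · rw [lastOr_append _ hW, ← List.singleton_append, lastOr_append _ hW]
  have hh : headOr (W₁ ++ (w ++ W₂)) [] = headOr (W₁ ++ C :: W₂) [] := by
    rcases eq_or_ne W₁ [] with rfl | hW
    · simpa [headOr_append hw.ne_nil] using h1
    · rw [headOr_append hW, headOr_append hW]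
  rw [hl, hh]
  exact h.close

theorem detour_spec (hk : 1 ≤ k) {j g : ℕ} {F F' : List (List Cfg)}
    (hF : ∀ Z ∈ F, IsLoop I k Z) (h : F' ∈ detours I k j g F) :
    (∀ Z ∈ F', IsLoop I k Z) ∧ F'.length = F.length ∧ total F' = total F + j ∧
      uncov I F' ⊆ uncov I F ∧ (uncov I F').card + g ≤ (uncov I F).card := by
  obtain ⟨F₁, F₂, W₁, C, W₂, w, rfl, hw, h1, h2, hg, rfl⟩ := mem_detours.1 h
  obtain ⟨hw, hl⟩ := (mem_walks hk).1 hw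
  have hCw : C ∈ w := h1 ▸ headOr_mem _ hw.ne_nil
  have hcov : ∀ v, covF (F₁ ++ (W₁ ++ (w ++ W₂)) :: F₂) v =
      (covB w v || covF (F₁ ++ (W₁ ++ C :: W₂) :: F₂) v) := by
    intro v
    have : covB w v = (covB w v || memB v C) := by
      rcases hm : memB v C with _ | _
      · simp
      · simp only [Bool.or_true]
        exact covB_iff.2 ⟨C, hCw, memB_iff.1 hm⟩
    simp only [covF, covB, List.any_append, List.any_cons] at this ⊢
    rw [this]
    generalize (w.any fun C => memB v C) = b1
    generalize (W₁.any fun C => memB v C) = b2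
    generalize (W₂.any fun C => memB v C) = b3
    generalize memB v C = b4
    generalize (F₁.any fun W => W.any fun C => memB v C) = b5
    generalize (F₂.any fun W => W.any fun C => memB v C) = b6
    revert b1 b2 b3 b4 b5 b6
    decide
  have hunc : uncov I (F₁ ++ (W₁ ++ (w ++ W₂)) :: F₂) =
      uncov I (w :: (F₁ ++ (W₁ ++ C :: W₂) :: F₂)) := by
    ext v
    rw [mem_uncov, mem_uncov, hcov, covF_cons]
  refine ⟨fun Z hZ => ?_, by simp, ?_, ?_, ?_⟩
  · simp only [List.mem_append, List.mem_cons] at hZ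
    rcases hZ with hZ | rfl | hZ
    · exact hF Z (by simp [hZ])
    · exact (hF (W₁ ++ C :: W₂) (by simp)).insert hw h1 h2
    · exact hF Z (by simp [hZ])
  · simp [total, hl]; omega
  · rw [hunc]
    intro v hv
    rw [mem_uncov, covF_cons, Bool.or_eq_false_iff] at hv
    exact mem_uncov.2 ⟨hv.1, hv.2.2⟩
  · have := card_uncov_cons (I := I) w (F₁ ++ (W₁ ++ C :: W₂) :: F₂)
    rw [hunc]; omega

/-- The weights 3 and 5 make both detours harmless: lengths grow by 3 for at least 2 new vertices (9
≤ 10), or by 5 for at least 3 (15 ≤ 15). Each detour covers something new, so after `I.1` rounds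
none is left. -/
theorem gadgets_spec (hk : 1 ≤ k) {F : List (List Cfg)} (hF : ∀ Z ∈ F, IsLoop I k Z) :
    (∀ Z ∈ gadgets I k F, IsLoop I k Z) ∧ (gadgets I k F).length = F.length ∧
      uncov I (gadgets I k F) ⊆ uncov I F ∧
      3 * total (gadgets I k F) + 5 * (uncov I (gadgets I k F)).card ≤
        3 * total F + 5 * (uncov I F).card ∧
      detours I k 3 2 (gadgets I k F) = [] ∧ detours I k 5 3 (gadgets I k F) = [] := by
  have key : ∀ j, ∃ G, (gadgetStep I k)^[j] F = G ∧ (∀ Z ∈ G, IsLoop I k Z) ∧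
      G.length = F.length ∧ uncov I G ⊆ uncov I F ∧
      3 * total G + 5 * (uncov I G).card ≤ 3 * total F + 5 * (uncov I F).card ∧
      ((detours I k 3 2 G = [] ∧ detours I k 5 3 G = []) ∨ (uncov I G).card + j ≤ I.1) := by
    intro j
    induction j with
    | zero =>
      refine ⟨F, rfl, hF, rfl, Finset.Subset.refl _, le_rfl, Or.inr ?_⟩
      have := Finset.card_filter_le (Finset.range I.1) fun v => covF F v = false
      simpa [uncov] using this
    | succ j ih =>
      obtain ⟨G, h1, h2, h3, h4, h5, h6⟩ := ih
      rw [Function.iterate_succ_apply', h1]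
      rcases eq_or_ne (detours I k 3 2 G ++ detours I k 5 3 G) [] with h0 | h0
      · rw [gadgetStep, h0, headOr_nil]
        exact ⟨G, rfl, h2, h3, h4, h5, Or.inl (List.append_eq_nil_iff.1 h0)⟩
      · have hj : (uncov I G).card + j ≤ I.1 := by
          rcases h6 with h6 | h6
          · exact absurd (List.append_eq_nil_iff.2 h6) h0
          · exact h6
        refine ⟨_, rfl, ?_⟩
        have hm := headOr_mem G h0
        rw [gadgetStep]
        generalize headOr (detours I k 3 2 G ++ detours I k 5 3 G) G = G' at hm
        rcases List.mem_append.1 hm with hm | hm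
        · obtain ⟨g1, g2, g3, g4, g5⟩ := detour_spec hk h2 hm
          exact ⟨g1, g2.trans h3, g4.trans h4, by omega, Or.inr (by omega)⟩
        · obtain ⟨g1, g2, g3, g4, g5⟩ := detour_spec hk h2 hm
          exact ⟨g1, g2.trans h3, g4.trans h4, by omega, Or.inr (by omega)⟩
  obtain ⟨G, h1, h2, h3, h4, h5, h6⟩ := key I.1
  rw [gadgets, h1]
  refine ⟨h2, h3, h4, h5, ?_⟩
  rcases h6 with h6 | h6
  · exact h6
  · have hz : ∀ j g, 1 ≤ g → detours I k j g G = [] := by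
      intro j g hg
      rw [List.eq_nil_iff_forall_not_mem]
      intro G' hG'
      have := (detour_spec hk h2 hG').2.2.2.2
      omega
    exact ⟨hz 3 2 (by norm_num), hz 5 3 (by norm_num)⟩

theorem isNode_pair {u v : ℕ} (hI : IsGraph I) (h : adjB I u v = true) : IsNode I 2 [v, u] :=
  ⟨.cons (.single (hI.lt (hI.symm h))) (hI.lt h) (by simpa using Ne.symm (hI.irrefl h))
    (List.mem_singleton_self u) h, rfl⟩

theorem IsNode.exists_pair (hI : IsGraph I) {D : Cfg} (hD : IsNode I 2 D) {x : ℕ} (hx : x ∈ D) :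
    ∃ y, D.Perm [y, x] ∧ adjB I y x = true := by
  obtain ⟨h, hl⟩ := hD
  cases h with
  | single => simp at hl
  | @cons C u v h1 h2 h3 h4 h5 =>
    obtain ⟨c, rfl⟩ := List.length_eq_one_iff.1 (by simpa using hl : C.length = 1)
    obtain rfl : u = c := by simpa using h4
    rcases List.mem_cons.1 hx with rfl | hx
    · exact ⟨u, .swap _ _ _, h5⟩
    · obtain rfl : x = u := by simpa using hx
      exact ⟨v, .refl _, hI.symm h5⟩

/-- The agent at `b` advances to `c` while the one at `a` follows to `b`. -/
theorem uadj_pair {a b c : ℕ} (h1 : adjB I a b = true) (h2 : adjB I b c = true) :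
    UAdj I [a, b] [c, b] :=
  (uadj_of_forall₂ (.cons (step_iff.2 (Or.inr h1)) (.cons (step_iff.2 (Or.inr h2)) .nil))).perm_right
    (.swap _ _ _)

theorem card_le_gain {F : List (List Cfg)} {w : List Cfg} {S : Finset ℕ}
    (h : ∀ v ∈ S, v ∈ uncov I F ∧ covB w v = true) : S.card ≤ gain I F w := by
  rw [gain_eq]
  exact Finset.card_le_card fun v hv => Finset.mem_filter.2 (h v hv)

/-- With `x` occupied throughout, the two agents pass through `{p, x}` and `{q, x}` and return:
three steps for two new vertices. -/
theorem exists_detour_of_covered (hI : IsGraph I) {F : List (List Cfg)}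
    (hF : ∀ Z ∈ F, IsLoop I 2 Z) {x p q : ℕ} (hx : covF F x = true) (hp : p ∈ uncov I F)
    (hq : q ∈ uncov I F) (hpq : p ≠ q) (h1 : adjB I x p = true) (h2 : adjB I x q = true) :
    detours I 2 3 2 F ≠ [] := by
  obtain ⟨Z, hZ, hx'⟩ := covF_iff.1 hx
  obtain ⟨D, hD, hxD⟩ := covB_iff.1 hx'
  obtain ⟨F₁, F₂, rfl⟩ := List.append_of_mem hZ
  obtain ⟨W₁, W₂, rfl⟩ := List.append_of_mem hD
  have hDn := (hF _ hZ).node D hD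
  obtain ⟨y, hy, hyx⟩ := hDn.exists_pair hI hxD
  have e1 : UAdj I D [p, x] := (uadj_pair hyx h1).perm_left hy.symm
  have e2 : UAdj I [p, x] [q, x] := uadj_pair (hI.symm h1) h2
  have e3 : UAdj I [q, x] D := ((uadj_pair hyx h2).perm_left hy.symm).symm hI
  have hw : IsWalk I 2 [D, [p, x], [q, x], D] :=
    ⟨by simp, by simp [hDn, isNode_pair hI h1, isNode_pair hI h2], by simp [e1, e2, e3]⟩
  refine List.ne_nil_of_mem (mem_detours.2 ⟨F₁, F₂, W₁, D, W₂, _, rfl,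
    (mem_walks (by norm_num)).2 ⟨hw, rfl⟩, rfl, by simp, ?_, rfl⟩)
  rw [← Finset.card_pair hpq]
  refine card_le_gain fun v hv => ?_
  rw [Finset.mem_insert, Finset.mem_singleton] at hv
  rcases hv with rfl | rfl
  · exact ⟨hp, covB_iff.2 ⟨[v, x], by simp, by simp⟩⟩
  · exact ⟨hq, covB_iff.2 ⟨[v, x], by simp, by simp⟩⟩

/-- From the covered vertex `s` the agents pass through `{r, s}`, `{p, r}`, `{q, r}` and `{r, s}`
and return: five steps for the three new vertices `r`, `p`, `q`. -/
theorem exists_detour_of_uncovered (hI : IsGraph I) {F : List (List Cfg)}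
    (hF : ∀ Z ∈ F, IsLoop I 2 Z) {s r p q : ℕ} (hs : covF F s = true) (hr : r ∈ uncov I F)
    (hp : p ∈ uncov I F) (hq : q ∈ uncov I F) (hpq : p ≠ q) (h0 : adjB I s r = true)
    (h1 : adjB I r p = true) (h2 : adjB I r q = true) : detours I 2 5 3 F ≠ [] := by
  obtain ⟨Z, hZ, hs'⟩ := covF_iff.1 hs
  obtain ⟨D, hD, hsD⟩ := covB_iff.1 hs'
  obtain ⟨F₁, F₂, rfl⟩ := List.append_of_mem hZ
  obtain ⟨W₁, W₂, rfl⟩ := List.append_of_mem hD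
  have hDn := (hF _ hZ).node D hD
  obtain ⟨y, hy, hys⟩ := hDn.exists_pair hI hsD
  have e1 : UAdj I D [r, s] := (uadj_pair hys h0).perm_left hy.symm
  have e2 : UAdj I [r, s] [p, r] := (uadj_pair h0 h1).perm_left (.swap _ _ _)
  have e3 : UAdj I [p, r] [q, r] := uadj_pair (hI.symm h1) h2
  have e4 : UAdj I [q, r] [r, s] := ((uadj_pair h0 h2).perm_left (.swap _ _ _)).symm hI
  have e5 : UAdj I [r, s] D := e1.symm hI
  have hw : IsWalk I 2 [D, [r, s], [p, r], [q, r], [r, s], D] :=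
    ⟨by simp, by simp [hDn, isNode_pair hI h0, isNode_pair hI h1, isNode_pair hI h2],
      by simp [e1, e2, e3, e4, e5]⟩
  refine List.ne_nil_of_mem (mem_detours.2 ⟨F₁, F₂, W₁, D, W₂, _, rfl,
    (mem_walks (by norm_num)).2 ⟨hw, rfl⟩, rfl, by simp, ?_, rfl⟩)
  have hcard : ({r, p, q} : Finset ℕ).card = 3 :=
    Finset.card_eq_three.2 ⟨r, p, q, hI.irrefl h1, hI.irrefl h2, hpq, rfl⟩
  rw [← hcard]
  refine card_le_gain fun v hv => ?_
  rw [Finset.mem_insert, Finset.mem_insert, Finset.mem_singleton] at hv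
  rcases hv with rfl | rfl | rfl
  · exact ⟨hr, covB_iff.2 ⟨[v, s], by simp, by simp⟩⟩
  · exact ⟨hp, covB_iff.2 ⟨[v, r], by simp, by simp⟩⟩
  · exact ⟨hq, covB_iff.2 ⟨[v, r], by simp, by simp⟩⟩

/-! ### Ladders -/

/-- The uncovered vertices of one side `A` of a ladder, when no detour is possible. -/
structure Rail (A B : ℕ → Bool) (n : ℕ) : Prop where
  next : ∀ s, s + 1 < n → A s = true → B (s + 1) = true → A (s + 1) = true
  prev : ∀ s, s + 1 < n → A (s + 1) = true → B s = true → A s = true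
  mid : ∀ s, s + 2 < n → A s = true → A (s + 2) = true → A (s + 1) = true
  up : ∀ s, s + 2 < n → A (s + 1) = true → A s = true → B (s + 1) = true → A (s + 2) = true
  down : ∀ s, s + 2 < n → A (s + 1) = true → A (s + 2) = true → B (s + 1) = true → A s = true
  side : ∀ s, s + 2 < n → A (s + 1) = true → A s = true → A (s + 2) = true → B (s + 1) = true

/-- Three rungs have at most two uncovered vertices, or they are completely uncovered. -/
theorem Rail.three {A B : ℕ → Bool} {n : ℕ} (h : Rail A B n) (h' : Rail B A n) {s : ℕ}
    (hs : s + 2 < n) :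
    ((A s = true ∧ B s = true) ∧ A (s + 1) = true ∧ B (s + 1) = true) ∨
      (A s).toNat + (B s).toNat + ((A (s + 1)).toNat + (B (s + 1)).toNat) +
        ((A (s + 2)).toNat + (B (s + 2)).toNat) ≤ 2 := by
  have e1 := h.next s (by omega)
  have e2 := h'.next s (by omega)
  have e3 := h.prev s (by omega)
  have e4 := h'.prev s (by omega)
  have e5 := h.next (s + 1) (by omega)
  have e6 := h'.next (s + 1) (by omega)
  have e7 := h.prev (s + 1) (by omega)
  have e8 := h'.prev (s + 1) (by omega)
  have e9 := h.mid s hs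
  have e10 := h'.mid s hs
  have e11 := h.side s hs
  have e12 := h'.side s hs
  have e13 := h.down s hs
  rw [add_assoc] at e5 e6 e7 e8
  norm_num at e5 e6 e7 e8
  clear h h'
  generalize A s = a₁ at *
  generalize B s = b₁ at *
  generalize A (s + 1) = a₂ at *
  generalize B (s + 1) = b₂ at *
  generalize A (s + 2) = a₃ at *
  generalize B (s + 2) = b₃ at *
  -- Each of the 64 patterns on three rungs either satisfies the claim or violates one of the rules.
  cases a₁ <;> cases b₁ <;> cases a₂ <;> cases b₂ <;> cases a₃ <;> cases b₃ <;>
    first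
    | exact Or.inr (by decide)
    | exact Or.inl (by decide)
    | exact absurd (e1 rfl rfl) Bool.false_ne_true
    | exact absurd (e2 rfl rfl) Bool.false_ne_true
    | exact absurd (e3 rfl rfl) Bool.false_ne_true
    | exact absurd (e4 rfl rfl) Bool.false_ne_true
    | exact absurd (e5 rfl rfl) Bool.false_ne_true
    | exact absurd (e6 rfl rfl) Bool.false_ne_true
    | exact absurd (e7 rfl rfl) Bool.false_ne_true
    | exact absurd (e8 rfl rfl) Bool.false_ne_true
    | exact absurd (e9 rfl rfl) Bool.false_ne_true
    | exact absurd (e10 rfl rfl) Bool.false_ne_true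
    | exact absurd (e11 rfl rfl rfl) Bool.false_ne_true
    | exact absurd (e12 rfl rfl rfl) Bool.false_ne_true
    | exact absurd (e13 rfl rfl rfl) Bool.false_ne_true

/-- Two neighbouring rungs that are entirely uncovered force the next rung on either side to be
uncovered, by `up` and `down`. -/
theorem Rail.all {A B : ℕ → Bool} {n : ℕ} (h : Rail A B n) (h' : Rail B A n) {s : ℕ}
    (hs : s + 1 < n) (h1 : A s = true ∧ B s = true) (h2 : A (s + 1) = true ∧ B (s + 1) = true) :
    ∀ j < n, A j = true ∧ B j = true := by
  have hup : ∀ d, s + d + 1 < n → (A (s + d) = true ∧ B (s + d) = true) ∧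
      A (s + d + 1) = true ∧ B (s + d + 1) = true := by
    intro d
    induction d with
    | zero => exact fun _ => ⟨h1, h2⟩
    | succ d ih =>
      intro hd
      obtain ⟨g1, g2⟩ := ih (by omega)
      exact ⟨g2, h.up (s + d) (by omega) g2.1 g1.1 g2.2, h'.up (s + d) (by omega) g2.2 g1.2 g2.1⟩
  have hdown : ∀ d ≤ s, (A (s - d) = true ∧ B (s - d) = true) ∧
      A (s - d + 1) = true ∧ B (s - d + 1) = true := by
    intro d
    induction d with
    | zero => exact fun _ => ⟨h1, h2⟩
    | succ d ih =>
      intro hd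
      obtain ⟨g1, g2⟩ := ih (by omega)
      obtain ⟨r, hr⟩ : ∃ r, s - d = r + 1 := ⟨s - d - 1, by omega⟩
      rw [show s - (d + 1) = r by omega]
      rw [hr] at g1 g2
      exact ⟨⟨h.down r (by omega) g1.1 g2.1 g1.2, h'.down r (by omega) g1.2 g2.2 g1.1⟩, g1⟩
  intro j hj
  rcases le_total j s with hjs | hjs
  · have := (hdown (s - j) (by omega)).1
    rwa [Nat.sub_sub_self hjs] at this
  · rcases Nat.eq_or_lt_of_le hjs with rfl | hlt
    · exact h1
    · have := (hup (j - s - 1) (by omega)).2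
      rwa [show s + (j - s - 1) + 1 = j by omega] at this

theorem sum_range_three_mul {f : ℕ → ℕ} {m : ℕ}
    (h : ∀ j < m, f (3 * j) + f (3 * j + 1) + f (3 * j + 2) ≤ 2) :
    ∑ s ∈ Finset.range (3 * m), f s ≤ 2 * m := by
  induction m with
  | zero => simp
  | succ m ih =>
    rw [show 3 * (m + 1) = 3 * m + 1 + 1 + 1 by ring, Finset.sum_range_succ, Finset.sum_range_succ,
      Finset.sum_range_succ]
    have := ih fun j hj => h j (by omega)
    have := h m (by omega)
    omega

theorem Rail.sum_le {A B : ℕ → Bool} {m : ℕ} (h : Rail A B (3 * m)) (h' : Rail B A (3 * m)) :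
    (∀ j < 3 * m, A j = true ∧ B j = true) ∨
      ∑ s ∈ Finset.range (3 * m), ((A s).toNat + (B s).toNat) ≤ 2 * m := by
  by_cases hall : ∃ s, s + 1 < 3 * m ∧ (A s = true ∧ B s = true) ∧
      A (s + 1) = true ∧ B (s + 1) = true
  · obtain ⟨s, hs, h1, h2⟩ := hall
    exact Or.inl (h.all h' hs h1 h2)
  · refine Or.inr (sum_range_three_mul fun j hj => ?_)
    rcases h.three h' (s := 3 * j) (by omega) with h1 | h1
    · exact absurd ⟨3 * j, by omega, h1⟩ hall
    · exact h1

/-! ### Uncovered vertices on a ladder of distinct vertices -/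

/-- Labels are propagated along the route by recursion, giving the trajectories of the two agents.
-/
theorem Route.exists_sides {C : ℕ → Cfg} {L : ℕ} (h : Route I 2 C L) :
    ∃ a b : ℕ → ℕ, ∀ t, (C t).Perm [a t, b t] ∧ Step I (a t) (a (t + 1)) ∧
      Step I (b t) (b (t + 1)) := by
  have hstep : ∀ t (X : {X : Cfg // X.Perm (C t)}), ∃ Y : {Y : Cfg // Y.Perm (C (t + 1))},
      List.Forall₂ (Step I) X.1 Y.1 := by
    intro t X
    obtain ⟨Y, h1, h2⟩ := ((h.adj t).perm_left X.2.symm).exists_perm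
    exact ⟨⟨Y, h1⟩, h2⟩
  choose g hg using hstep
  let D : ∀ t, {X : Cfg // X.Perm (C t)} := fun t => Nat.rec ⟨C 0, .refl _⟩ g t
  have hD : ∀ t, List.Forall₂ (Step I) (D t).1 (D (t + 1)).1 := fun t => hg t (D t)
  have hpair : ∀ t, ∃ a b, (D t).1 = [a, b] := fun t =>
    List.length_eq_two.1 ((D t).2.length_eq.trans (h.node t).2)
  choose a b hab using hpair
  refine ⟨a, b, fun t => ⟨hab t ▸ (D t).2.symm, ?_⟩⟩
  have := hD t
  rw [hab t, hab (t + 1)] at this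
  simpa using this

/-- When no detour is possible, a completely new part of a walk has few uncovered vertices, or
none of its vertices is covered. -/
theorem Route.rail (hI : IsGraph I) {F : List (List Cfg)} (hF : ∀ Z ∈ F, IsLoop I 2 Z)
    (h3 : detours I 2 3 2 F = []) (h5 : detours I 2 5 3 F = []) {a b : ℕ → ℕ} {n : ℕ}
    (hab : ∀ s < n, adjB I (a s) (b s) = true)
    (ha : ∀ s, s + 1 < n → adjB I (a s) (a (s + 1)) = true)
    (hne : ∀ s < n, ∀ t < n, a s ≠ b t) (hinj : ∀ s < n, ∀ t < n, s ≠ t → a s ≠ a t)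
    {A B : ℕ → Bool} (hA : ∀ s, A s = !covF F (a s)) (hB : ∀ s, B s = !covF F (b s)) :
    Rail A B n := by
  have hlt : ∀ s < n, a s < I.1 ∧ b s < I.1 := fun s hs =>
    ⟨hI.lt (hI.symm (hab s hs)), hI.lt (hab s hs)⟩
  have hmA : ∀ s < n, A s = true → a s ∈ uncov I F := fun s hs h => by
    rw [hA, Bool.not_eq_true'] at h
    exact mem_uncov.2 ⟨(hlt s hs).1, h⟩
  have hmB : ∀ s < n, B s = true → b s ∈ uncov I F := fun s hs h => by
    rw [hB, Bool.not_eq_true'] at h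
    exact mem_uncov.2 ⟨(hlt s hs).2, h⟩
  have hcA : ∀ s, ¬ A s = true → covF F (a s) = true := fun s h => by
    rw [hA, Bool.not_eq_true', Bool.not_eq_false] at h; exact h
  have hcB : ∀ s, ¬ B s = true → covF F (b s) = true := fun s h => by
    rw [hB, Bool.not_eq_true', Bool.not_eq_false] at h; exact h
  constructor
  · intro s hs h1 h2
    by_contra hc
    exact exists_detour_of_covered hI hF (hcA _ hc) (hmA s (by omega) h1) (hmB _ hs h2)
      (hne s (by omega) _ hs) (hI.symm (ha s hs)) (hab _ hs) h3
  · intro s hs h1 h2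
    by_contra hc
    exact exists_detour_of_covered hI hF (hcA _ hc) (hmA _ hs h1) (hmB s (by omega) h2)
      (hne _ hs s (by omega)) (ha s hs) (hab s (by omega)) h3
  · intro s hs h1 h2
    by_contra hc
    exact exists_detour_of_covered hI hF (hcA _ hc) (hmA s (by omega) h1) (hmA _ hs h2)
      (hinj s (by omega) _ hs (by omega)) (hI.symm (ha s (by omega))) (ha (s + 1) hs) h3
  · intro s hs h0 h1 h2
    by_contra hc
    exact exists_detour_of_uncovered hI hF (hcA _ hc) (hmA (s + 1) (by omega) h0)
      (hmA s (by omega) h1) (hmB (s + 1) (by omega) h2) (hne s (by omega) _ (by omega))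
      (hI.symm (ha (s + 1) hs)) (hI.symm (ha s (by omega))) (hab _ (by omega)) h5
  · intro s hs h0 h1 h2
    by_contra hc
    exact exists_detour_of_uncovered hI hF (hcA _ hc) (hmA (s + 1) (by omega) h0)
      (hmA _ hs h1) (hmB (s + 1) (by omega) h2) (hne _ hs _ (by omega))
      (ha s (by omega)) (ha (s + 1) hs) (hab _ (by omega)) h5
  · intro s hs h0 h1 h2
    by_contra hc
    exact exists_detour_of_uncovered hI hF (hcB _ hc) (hmA (s + 1) (by omega) h0)
      (hmA s (by omega) h1) (hmA _ hs h2) (hinj s (by omega) _ hs (by omega))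
      (hI.symm (hab _ (by omega))) (hI.symm (ha s (by omega))) (ha (s + 1) hs) h5

/-- The vertices of a part of a walk. -/
def segCover (C : ℕ → Cfg) (i m : ℕ) : Finset ℕ :=
  (Finset.range m).biUnion fun s => (C (i + s)).toFinset

theorem mem_segCover {C : ℕ → Cfg} {i m v : ℕ} :
    v ∈ segCover C i m ↔ ∃ s < m, v ∈ C (i + s) := by simp [segCover]

theorem mem_segCover_iff_covB {C : ℕ → Cfg} {i m v : ℕ} :
    v ∈ segCover C i m ↔ covB (segment C i m) v = true := by
  rw [mem_segCover, covB_iff]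
  simp [segment]

theorem Route.card_segCover_le {C : ℕ → Cfg} {L : ℕ} (h : Route I 2 C L) (i m : ℕ) :
    (segCover C i m).card ≤ 2 * m := by
  refine Finset.card_biUnion_le.trans ((Finset.sum_le_card_nsmul _ _ 2 fun s _ => ?_).trans
    (by simp [mul_comm]))
  exact (List.toFinset_card_le _).trans (h.node _).2.le

/-- If no vertex repeats, both agents move along an edge in every step and always sit on adjacent
vertices, so the segment is a ladder with distinct vertices. A covered vertex on it rules out the
entirely uncovered ladder, which leaves at most two uncovered vertices per three rungs. -/
theorem Route.uncov_segCover_le (hI : IsGraph I) {C : ℕ → Cfg} {L : ℕ} (h : Route I 2 C L)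
    {F : List (List Cfg)} (hF : ∀ Z ∈ F, IsLoop I 2 Z)
    (h3 : detours I 2 3 2 F = []) (h5 : detours I 2 5 3 F = []) {i m : ℕ}
    (hfull : (segCover C i (3 * m)).card = 2 * (3 * m))
    (hhot : ∃ v ∈ segCover C i (3 * m), v ∉ uncov I F) :
    ((uncov I F).filter fun v => v ∈ segCover C i (3 * m)).card ≤ 2 * m := by
  obtain ⟨a, b, hab⟩ := h.exists_sides
  have hmem : ∀ t v, v ∈ C t ↔ v = a t ∨ v = b t := fun t v => by
    rw [(hab t).1.mem_iff]; simp
  have himg : segCover C i (3 * m) = (Finset.range (3 * m) ×ˢ (Finset.univ : Finset Bool)).image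
      fun x => bif x.2 then a (i + x.1) else b (i + x.1) := by
    ext v
    simp only [mem_segCover, hmem, Finset.mem_image, Finset.mem_product, Finset.mem_range,
      Finset.mem_univ, and_true, Prod.exists, Bool.exists_bool, cond_false, cond_true]
    constructor
    · rintro ⟨s, hs, rfl | rfl⟩
      exacts [⟨s, Or.inr ⟨hs, rfl⟩⟩, ⟨s, Or.inl ⟨hs, rfl⟩⟩]
    · rintro ⟨s, ⟨hs, rfl⟩ | ⟨hs, rfl⟩⟩
      exacts [⟨s, hs, Or.inr rfl⟩, ⟨s, hs, Or.inl rfl⟩]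
  -- The cardinality is the largest possible, so the parametrization by time and side is injective.
  have hinj : Set.InjOn (fun x : ℕ × Bool => bif x.2 then a (i + x.1) else b (i + x.1))
      (Finset.range (3 * m) ×ˢ (Finset.univ : Finset Bool) : Finset (ℕ × Bool)) := by
    rw [← Finset.card_image_iff, ← himg, hfull]
    simp [mul_comm]
  have key : ∀ s < 3 * m, ∀ t < 3 * m, ∀ x y : Bool,
      (bif x then a (i + s) else b (i + s)) = (bif y then a (i + t) else b (i + t)) →
        s = t ∧ x = y := by
    intro s hs t ht x y hxy
    have := hinj (x₁ := (s, x)) (by simpa using hs) (x₂ := (t, y)) (by simpa using ht) hxy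
    simpa using this
  have hadj : ∀ t, adjB I (a t) (b t) = true := by
    intro t
    obtain ⟨y, hy, hya⟩ := (h.node t).exists_pair hI ((hmem t (a t)).2 (Or.inl rfl))
    have hp : [a t, b t].Perm [a t, y] := ((hab t).1.symm.trans hy).trans (.swap _ _ _)
    have : b t = y := by
      have := (List.perm_cons _).1 hp
      simpa using this
    rw [this]; exact hI.symm hya
  have hR : Rail (fun s => !covF F (a (i + s))) (fun s => !covF F (b (i + s))) (3 * m) := by
    refine Route.rail hI hF h3 h5 (a := fun s => a (i + s)) (b := fun s => b (i + s))
      (fun s _ => hadj _) (fun s hs => ?_) (fun s hs t ht e => ?_) (fun s hs t ht hst e => ?_)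
      (fun _ => rfl) (fun _ => rfl)
    · refine (step_iff.1 (hab (i + s)).2.1).resolve_left fun e => ?_
      have := (key s (by omega) (s + 1) hs true true e).1
      omega
    · exact absurd (key s hs t ht true false e).2 (by decide)
    · exact hst (key s hs t ht true true e).1
  have hR' : Rail (fun s => !covF F (b (i + s))) (fun s => !covF F (a (i + s))) (3 * m) := by
    refine Route.rail hI hF h3 h5 (a := fun s => b (i + s)) (b := fun s => a (i + s))
      (fun s _ => hI.symm (hadj _)) (fun s hs => ?_) (fun s hs t ht e => ?_)
      (fun s hs t ht hst e => ?_) (fun _ => rfl) (fun _ => rfl)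
    · refine (step_iff.1 (hab (i + s)).2.2).resolve_left fun e => ?_
      have := (key s (by omega) (s + 1) hs false false e).1
      omega
    · exact absurd (key s hs t ht false true e).2 (by decide)
    · exact hst (key s hs t ht false false e).1
  rcases hR.sum_le hR' with hall | hsum
  · exfalso
    obtain ⟨v, hv, hv'⟩ := hhot
    obtain ⟨s, hs, hvs⟩ := mem_segCover.1 hv
    have hlt := (h.node _).1.lt v hvs
    obtain ⟨e1, e2⟩ := hall s hs
    simp only [Bool.not_eq_true'] at e1 e2
    rcases (hmem _ _).1 hvs with rfl | rfl
    · exact hv' (mem_uncov.2 ⟨hlt, e1⟩)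
    · exact hv' (mem_uncov.2 ⟨hlt, e2⟩)
  · refine le_trans ?_ hsum
    have hsub : ((uncov I F).filter fun v => v ∈ segCover C i (3 * m)) ⊆
        (Finset.range (3 * m)).biUnion fun s =>
          ({a (i + s), b (i + s)} : Finset ℕ).filter fun v => covF F v = false := by
      intro v hv
      rw [Finset.mem_filter, mem_segCover] at hv
      obtain ⟨hv, s, hs, hvs⟩ := hv
      rw [Finset.mem_biUnion]
      refine ⟨s, Finset.mem_range.2 hs, Finset.mem_filter.2 ⟨?_, (mem_uncov.1 hv).2⟩⟩
      simpa using (hmem _ _).1 hvs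
    refine (Finset.card_le_card hsub).trans (Finset.card_biUnion_le.trans
      (Finset.sum_le_sum fun s _ => ?_))
    refine (Finset.card_le_card (Finset.filter_subset_filter _ (Finset.insert_eq _ _).le)).trans ?_
    rw [Finset.filter_union]
    refine (Finset.card_union_le _ _).trans ?_
    gcongr
    · rw [Finset.filter_singleton]
      rcases covF F (a (i + s)) with _ | _ <;> simp
    · rw [Finset.filter_singleton]
      rcases covF F (b (i + s)) with _ | _ <;> simp

/-- The number of uncovered vertices when neither a completely new walk of six configurations nor
a detour exists. -/
theorem Route.card_uncov_le_of_stuck (hI : IsGraph I) {C : ℕ → Cfg} {L : ℕ}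
    (h : Route I 2 C L) {F : List (List Cfg)} (hF : ∀ Z ∈ F, IsLoop I 2 Z)
    (h3 : detours I 2 3 2 F = []) (h5 : detours I 2 5 3 F = [])
    (h6 : ∀ w, IsWalk I 2 w → w.length = 6 → gain I F w < 12) {q : ℕ} (hq : L ≤ q * 6) :
    (uncov I F).card + 8 * I.1 ≤ 100 * q := by
  -- A block with at most 11 vertices contributes at most 9 · 11 = 99. A block with 12 distinct
  -- vertices is not entirely uncovered, so at most 4 are uncovered, and 4 + 8 · 12 = 100. The
  -- weight 8 is the one that balances the potential in `tourTwo_le`.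
  have hpart : ∀ i < q, ((uncov I F).filter fun v => v ∈ segCover C (i * 6) 6).card +
      8 * (segCover C (i * 6) 6).card ≤ 100 := by
    intro i _
    have h1 := h.card_segCover_le (i * 6) 6
    rcases Nat.lt_or_ge (segCover C (i * 6) 6).card 12 with h2 | h2
    · have : ((uncov I F).filter fun v => v ∈ segCover C (i * 6) 6).card ≤
          (segCover C (i * 6) 6).card := Finset.card_le_card fun v hv => (Finset.mem_filter.1 hv).2
      omega
    · have hfull : (segCover C (i * 6) (3 * 2)).card = 2 * (3 * 2) := by norm_num; omega
      have hhot : ∃ v ∈ segCover C (i * 6) (3 * 2), v ∉ uncov I F := by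
        by_contra hcon
        push Not at hcon
        have := h6 _ (h.isWalk_segment (i * 6) (m := 6) (by norm_num)) (by simp)
        rw [gain_eq] at this
        have hsub : segCover C (i * 6) 6 ⊆
            (uncov I F).filter fun v => covB (segment C (i * 6) 6) v = true := fun v hv =>
          Finset.mem_filter.2 ⟨hcon v hv, mem_segCover_iff_covB.1 hv⟩
        have := Finset.card_le_card hsub
        omega
      have := h.uncov_segCover_le hI hF h3 h5 hfull hhot
      norm_num at this
      omega
  have hloc : ∀ v < I.1, ∃ i < q, v ∈ segCover C (i * 6) 6 := by
    intro v hv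
    obtain ⟨t, ht, hvt⟩ := h.cover v hv
    exact ⟨t / 6, by omega, mem_segCover.2 ⟨t % 6, by omega, by
      rwa [show t / 6 * 6 + t % 6 = t by omega]⟩⟩
  have e1 : (uncov I F).card ≤ ∑ i ∈ Finset.range q,
      ((uncov I F).filter fun v => v ∈ segCover C (i * 6) 6).card := by
    refine (Finset.card_le_card fun v hv => ?_).trans Finset.card_biUnion_le
    obtain ⟨i, hi, hvi⟩ := hloc v (mem_uncov.1 hv).1
    exact Finset.mem_biUnion.2 ⟨i, Finset.mem_range.2 hi, Finset.mem_filter.2 ⟨hv, hvi⟩⟩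
  have e2 : I.1 ≤ ∑ i ∈ Finset.range q, (segCover C (i * 6) 6).card := by
    have : Finset.range I.1 ⊆ (Finset.range q).biUnion fun i => segCover C (i * 6) 6 := by
      intro v hv
      obtain ⟨i, hi, hvi⟩ := hloc v (Finset.mem_range.1 hv)
      exact Finset.mem_biUnion.2 ⟨i, Finset.mem_range.2 hi, hvi⟩
    simpa using (Finset.card_le_card this).trans Finset.card_biUnion_le
  have e3 := Finset.sum_le_sum (s := Finset.range q) fun i hi => hpart i (Finset.mem_range.1 hi)
  rw [Finset.sum_add_distrib, ← Finset.mul_sum] at e3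
  simp only [Finset.sum_const, Finset.card_range, smul_eq_mul] at e3
  omega

end KHWP


namespace KHWP
open Data (size rep)

variable {I : Inp} {k : ℕ}

/-! ### The approximation guarantee for two agents -/

/-- There and back again. -/
def double (w : List Cfg) : List Cfg := w ++ w.reverse

theorem IsWalk.isLoop_double (hI : IsGraph I) {w : List Cfg} (h : IsWalk I k w) :
    IsLoop I k (double w) := by
  have hr := h.reverse hI
  refine ⟨h.append hr (by rw [headOr_reverse]; exact .refl _), ?_⟩
  rw [double, lastOr_append _ hr.ne_nil, headOr_append h.ne_nil, lastOr_reverse]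
  exact .refl _

theorem uncov_map_double (F : List (List Cfg)) : uncov I (F.map double) = uncov I F := by
  have : ∀ v, covF (F.map double) v = covF F v := by
    intro v
    simp only [covF, List.any_map]
    congr 1
    funext w
    simp [double, covB]
  ext v
  simp [mem_uncov, this]

theorem total_map_double (F : List (List Cfg)) : total (F.map double) = 2 * total F := by
  induction F with
  | nil => simp [total]
  | cons w F ih => simp [total, double] at *; omega

theorem gain_anti {F G : List (List Cfg)} (h : uncov I G ⊆ uncov I F) (w : List Cfg) :
    gain I G w ≤ gain I F w := by
  rw [gain_eq, gain_eq]
  exact Finset.card_le_card (Finset.filter_subset_filter _ h)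

/-- The walk for two agents. -/
def tourTwo (I : Inp) : List Cfg :=
  join I 2 (gadgets I 2 ((greedy I 2 5 12 (greedy I 2 599 640 [])).map double))

theorem pc_tourTwo : PC tourTwo := by
  unfold tourTwo double; fun_prop

/-- Here `m` is the number of long walks, `R` counts the vertices uncovered after them and `R'`
those uncovered before the final join. A long walk costs 2 · 600 plus 6 for joining. A walk of six
configurations costs 18 for at least 12 new vertices, which like the detours is at most 5/3 per
vertex; the last `R'` vertices cost 2 = 5/3 + 1/3 each. -/
theorem tourTwo_spec (hI : IsGraph I) (hn : 2 ≤ I.1) {C : ℕ → Cfg} {L : ℕ}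
    (hC : Route I 2 C L) : IsWalk I 2 (tourTwo I) ∧ Covers I (tourTwo I) ∧
      ∃ m R R' Q : ℝ, 0 ≤ R' ∧ R' ≤ R ∧ L ≤ Q ∧ Q ≤ L + 599 ∧ R ≤ 16 / 15 * Q ∧ 0 ≤ m ∧
        m * 600 + R / (16 / 15) ≤ pot (16 / 15) Q I.1 ∧
        R' + 8 * I.1 ≤ 100 / 6 * (Q + 5) ∧
        ((tourTwo I).length - 1 : ℝ) ≤ 1206 * m + 5 / 3 * R + 1 / 3 * R' := by
  have hL1 : 1 ≤ L := by
    have := hC.card_le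
    rcases Nat.eq_zero_or_pos L with h | h
    · subst h; omega
    · exact h
  obtain ⟨q, hq1, hq2, hq3⟩ := exists_blocks L 599 hL1
  obtain ⟨F₁, e1, h1, h2, h3, -⟩ := greedy_bound (l := 599) (t := 640) (τ := 16 / 15)
    (by norm_num) hC (by norm_num) (by norm_num) hq2 hq1
  obtain ⟨q', hq1', hq2', hq3'⟩ := exists_blocks L 5 hL1
  -- A linear potential suffices here: a gain of 12 lowers `x / 2` by the six configurations of the
  -- walk.
  obtain ⟨F₂, e2, h4, h5, h6⟩ := greedy_spec (l := 5) (t := 12) (by norm_num) hC (by norm_num)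
    hq2' (fun x => (x : ℝ) / 2) (fun x g hg _ hgx => by
      have e : (12 : ℝ) ≤ g := by exact_mod_cast hg
      simp only [Nat.cast_sub hgx]; push_cast; linarith) F₁
  have hT : tourTwo I = join I 2 (gadgets I 2 ((F₂ ++ F₁).map double)) := by
    rw [tourTwo, e1, e2]
  have hloop : ∀ Z ∈ (F₂ ++ F₁).map double, IsLoop I 2 Z := by
    intro Z hZ
    obtain ⟨w, hw, rfl⟩ := List.mem_map.1 hZ
    refine IsWalk.isLoop_double hI ?_
    rcases List.mem_append.1 hw with hw | hw
    exacts [(h4 w hw).1, (h1 w hw).1]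
  obtain ⟨g1, g2, g3, g4, g5, g6⟩ := gadgets_spec (by norm_num) hloop
  obtain ⟨j1, j2, j3⟩ := join_spec hI (by norm_num) hn g1
  rw [hT]
  set G := gadgets I 2 ((F₂ ++ F₁).map double) with hG
  rw [uncov_map_double] at g3 g4
  rw [total_map_double] at g4
  rw [List.length_map, List.length_append] at g2
  rw [sum_map_add_const, g2] at j3
  have ht : total (F₂ ++ F₁) = F₂.length * 6 + F₁.length * 600 := by
    rw [← total_eq fun w hw => (h4 w hw).2, ← total_eq fun w hw => (h1 w hw).2]
    simp [total]
  rw [ht] at g4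
  have hsub : uncov I (F₂ ++ F₁) ⊆ uncov I F₁ := by
    intro v hv
    rw [mem_uncov, ← Bool.not_eq_true, covF_iff] at *
    exact ⟨hv.1, fun ⟨w, hw, h⟩ => hv.2 ⟨w, List.mem_append_right _ hw, h⟩⟩
  have hstuck := hC.card_uncov_le_of_stuck hI g1 g5 g6
    (fun w hw hl => (gain_anti g3 w).trans_lt (h6 w hw hl)) hq2'
  have c1 : ((uncov I G).card : ℝ) + 8 * I.1 ≤ 100 * q' := by exact_mod_cast hstuck
  have c2 : ((uncov I G).card : ℝ) ≤ (uncov I F₁).card := by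
    exact_mod_cast Finset.card_le_card (g3.trans hsub)
  have c2' : ((uncov I (F₂ ++ F₁)).card : ℝ) ≤ (uncov I F₁).card := by
    exact_mod_cast Finset.card_le_card hsub
  have c3 : (3 * total G + 5 * (uncov I G).card : ℝ) ≤
      3 * (2 * (F₂.length * 6 + F₁.length * 600)) + 5 * (uncov I (F₂ ++ F₁)).card := by
    exact_mod_cast g4
  have c4 : ((join I 2 G).length : ℝ) ≤ 1 + (total G + 2 * (2 + 1) * (F₂.length + F₁.length)) +
      2 * (uncov I G).card := by exact_mod_cast j3
  have c5 : (q' : ℝ) * (5 + 1) ≤ L + 5 := by exact_mod_cast hq3'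
  have c6 : (L : ℝ) ≤ q * ((599 : ℕ) + 1) := by exact_mod_cast hq2
  have c7 : (q * ((599 : ℕ) + 1) : ℝ) ≤ L + 599 := by exact_mod_cast hq3
  refine ⟨j1, j2, F₁.length, (uncov I F₁).card, (uncov I G).card, q * ((599 : ℕ) + 1),
    by positivity, c2, c6, c7, h2, by positivity, ?_, by push_cast at c6 ⊢; linarith, ?_⟩
  · push_cast at h3 ⊢
    linarith
  · push_cast at h5
    linarith

/-- At `n = 2 * Q` the threshold 16/15 saves at least `Q / 8` in `2 * P`, while `R' / 8` is about `Q
/ 12` and joining costs `0.017 * Q`, so a positive slack remains. If `n` falls short by `d = 2 * Q -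
n`, the bound on `2 * P` falls by `d` and the bound on `R' / 8` rises by exactly `d`. -/
theorem tourTwo_le {n L P m R R' Q : ℝ} (hL : 100000 ≤ L) (hn : 0 ≤ n) (hn2 : n ≤ 2 * L)
    (hR' : 0 ≤ R') (hRR : R' ≤ R) (hLQ : L ≤ Q) (hQL : Q ≤ L + 599) (hRQ : R ≤ 16 / 15 * Q)
    (hP : P = pot (16 / 15) Q n)
    (h1 : m * 600 + R / (16 / 15) ≤ P) (h2 : R' + 8 * n ≤ 100 / 6 * (Q + 5)) :
    1206 * m + 5 / 3 * R + 1 / 3 * R' ≤ 2 * (1 + Real.log 2) * (L - 1) := by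
  have hl1 := Real.log_two_gt_d9
  have hl2 := Real.log_two_lt_d9
  have hQ : 0 < Q := by linarith
  have hP2 : P ≤ Q * (1 + Real.log 2) := hP ▸
    pot_le (by norm_num) hQ hn (by norm_num) (by linarith)
  have hP3 : P ≤ 1.7 * Q := by nlinarith
  -- Doubling `h1` pays for `1200 * m` and `15/8 * R`. The excess of 15/8 over 5/3 is 5/24, which
  -- reduces `R' / 3` to `R' / 8` by `R' ≤ R`; the remaining `6 * m` is at most `P / 100`.
  have h3 : 1206 * m + 5 / 3 * R + 1 / 3 * R' ≤ 2 * P + 0.017 * Q + R' / 8 := by linarith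
  refine h3.trans ?_
  rw [pot] at hP
  split_ifs at hP with hc
  · have : P ≤ Q := by rw [hP, div_le_iff₀ (by norm_num)]; linarith
    nlinarith
  · push Not at hc
    have hn0 : 0 < n := by linarith
    have e : n / (16 / 15 * Q) = 2 * (n / (2 * Q) * (15 / 16)) := by field_simp
    have hlog : Real.log (n / (16 / 15 * Q)) =
        Real.log 2 + (Real.log (n / (2 * Q)) + Real.log (15 / 16)) := by
      rw [e, Real.log_mul (by norm_num) (by positivity), Real.log_mul (by positivity) (by norm_num)]
    have g1 := Real.log_le_sub_one_of_pos (show 0 < n / (2 * Q) by positivity)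
    have g2 := Real.log_le_sub_one_of_pos (show (0 : ℝ) < 15 / 16 by norm_num)
    -- The bound `log y ≤ y - 1` is applied to the deficit of `n` against `2 * Q` and to the
    -- threshold factor 15/16.
    have g3 : Q * Real.log (n / (16 / 15 * Q)) ≤ Q * Real.log 2 + n / 2 - Q - Q / 16 := by
      rw [hlog]
      have e2 : Q * (n / (2 * Q)) = n / 2 := by field_simp
      have := mul_le_mul_of_nonneg_left (add_le_add g1 g2) hQ.le
      nlinarith
    have g4 : Q * Real.log 2 ≤ (L + 599) * Real.log 2 :=
      mul_le_mul_of_nonneg_right hQL (by linarith)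
    nlinarith

theorem exists_approx_two : ∃ P, IsPolyTimeApprox 2 (2 * (1 + Real.log (2 : ℕ))) P := by
  have hl := Real.log_two_gt_d9
  rw [Nat.cast_ofNat]
  refine exists_isPolyTimeApprox_of_route (by norm_num) (by linarith) pc_tourTwo 200000
    fun I hI hn hn' C L hC _ => ?_
  obtain ⟨h1, h2, m, R, R', Q, h3, h4, h5, h6, h7, -, h8, h9, h10⟩ := tourTwo_spec hI hn hC
  have hcard : (I.1 : ℝ) ≤ 2 * L := by exact_mod_cast hC.card_le
  have hn'' : (200000 : ℝ) ≤ I.1 := by exact_mod_cast hn'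
  exact ⟨h1, h2, h10.trans (tourTwo_le (by linarith) (by positivity) hcard h3 h4 h5 h6 h7 rfl
    h8 h9)⟩

end KHWP


theorem mainTheorem4 (k : ℕ) (hk : 1 ≤ k) :
    ∃ P : KHWP.Program, KHWP.IsPolyTimeApprox k (2 * (1 + Real.log (k : ℝ))) P := by
  rcases (by omega : k = 1 ∨ k = 2 ∨ 3 ≤ k) with rfl | rfl | h
  · exact KHWP.exists_approx_one
  · exact KHWP.exists_approx_two
  · exact KHWP.exists_approx_of_three_le h
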